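/- Let $\Omega\subset\mathbb R^2$ be a bounded strictly convex open domain (convex, with no segment in its boundary) with $C^2$ boundary, let $O\in\Omega$, let $\mathbb S=\mathbb R/2\pi\mathbb Z$, and let $\gamma:\mathbb S\to\mathbb R^2$ be a regular ($\gamma'\neq 0$), injective, counter-clockwise $C^2$ parametrization of $\partial\Omega$. For $t\in\mathbb S$ let $t^*\neq t$ be the unique other parameter with $\gamma'(t^*)$ parallel to $\gamma'(t)$. Let $\hat{\mathcal P}\subset\mathbb S\times\mathbb S$ be the set of pairs $(t_1,t_2)$ which have lifts $T_1,T_2\in\mathbb R$ with $T_1<T_2<T_1^*$, where $T_1^*$ is the lift of $t_1^*$ in $(T_1,T_1+2\pi)$. The symplectic billiard map is $\hat T:\hat{\mathcal P}\to\hat{\mathcal P}$, $\hat T(t_1,t_2)=(t_2,t_3)$, where $t_3$ is the unique parameter such that $(t_2,t_3)\in\hat{\mathcal P}$ and $\det(\gamma'(t_2),\gamma(t_3)-\gamma(t_1))=0$. Let $\phi(t_1,t_2)=(t_1,-\det(\gamma'(t_1),\gamma(t_2)-O))$, which is injective on $\hat{\mathcal P}$, let $\mathcal P=\phi(\hat{\mathcal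 P})\subset\mathbb S\times\mathbb R$ be the phase space, and write $T=\phi\circ\hat T\circ\phi^{-1}:\mathcal P\to\mathcal P$ for the same map in the coordinates $(t,s)$. An essential curve is the image of a topological embedding $\mathbb S\to\mathbb S\times\mathbb R$ that is not homotopic to a constant map; a $T$-invariant essential curve is an essential curve $\Gamma\subset\mathcal P$ with $T(\Gamma)=\Gamma$. Let $\mathcal V(T)$ be the union of all $T$-invariant essential curves. An instability region for $T$ is an open bounded connected component of $\mathcal P\setminus\mathcal V(T)$ that contains an essential curve in its interior. If the curvature $\det(\gamma',\gamma'')/|\gamma'|^3$ of $\partial\Omega$ vanishes at some point, then the whole phase space $\mathcal P$ is an instability region for $T$; in particular, $T$ has no invariant essential curve. -/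

import Mathlib

open Real Set

noncomputable section

namespace SymplecticBilliard

/-- The Euclidean plane. -/
abbrev Plane := EuclideanSpace ℝ (Fin 2)

/-- The circle `ℝ / 2πℤ`. -/
abbrev Circ := AddCircle (2 * π)

/-- `det2 u v` is the determinant of the matrix with columns `u`, `v`. -/
def det2 (u v : Plane) : ℝ := u 0 * v 1 - u 1 * v 0

/-- The derivative of a plane curve parametrized by `ℝ / 2πℤ`. -/
def velocity (γ : Circ → Plane) (t : Circ) : Plane :=
  deriv (fun h : ℝ => γ (t + (h : Circ))) 0

/-- The signed curvature `det (γ', γ'') / |γ'| ^ 3` of a plane curve. -/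
def curvature (γ : Circ → Plane) (t : Circ) : ℝ :=
  det2 (velocity γ t) (velocity (velocity γ) t) / ‖velocity γ t‖ ^ 3

/-- A strictly convex billiard table with `C²` boundary: a bounded convex domain `Ω` whose boundary
contains no segment, a regular `C²` counter-clockwise parametrization `γ` of its boundary by
`ℝ / 2πℤ`, and an origin `O` in `Ω`. -/
structure Table where
  Ω : Set Plane
  isOpen : IsOpen Ω
  isBounded : Bornology.IsBounded Ω
  convex : Convex ℝ Ω
  /-- Strict convexity is asked of the closure: for the open set `Ω` itself it would be void. -/
  strictConvex : StrictConvex ℝ (closure Ω)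
  γ : Circ → Plane
  contDiff : ContDiff ℝ 2 (fun x : ℝ => γ (x : Circ))
  injective : Function.Injective γ
  range_eq : range γ = frontier Ω
  regular : ∀ t, velocity γ t ≠ 0
  /-- Counter-clockwise orientation: `Ω` lies to the left of its oriented tangent lines. -/
  orientation : ∀ t, ∀ x ∈ Ω, 0 < det2 (velocity γ t) (x - γ t)
  O : Plane
  origin_mem : O ∈ Ω

namespace Table

variable (B : Table)

/-- `t'` is the parameter `t*`, the one different from `t` whose tangent is parallel to the tangent
at `t`. -/
def IsOpposite (t t' : Circ) : Prop :=
  t' ≠ t ∧ det2 (velocity B.γ t) (velocity B.γ t') = 0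

/-- `(t₁, t₂)` is positive admissible: there are lifts with `T₁ < T₂ < T₁*`, where `T₁*` is the
lift of `t₁*` in `(T₁, T₁ + 2π)`. -/
def PosAdmissible (t₁ t₂ : Circ) : Prop :=
  ∃ T₁ S₁ T₂ : ℝ, (T₁ : Circ) = t₁ ∧ (T₂ : Circ) = t₂ ∧ B.IsOpposite (T₁ : Circ) (S₁ : Circ) ∧
    T₁ < S₁ ∧ S₁ < T₁ + 2 * π ∧ T₁ < T₂ ∧ T₂ < S₁

/-- The phase space in the coordinates `(t₁, t₂)`. -/
def PhaseHat : Set (Circ × Circ) := {p | B.PosAdmissible p.1 p.2}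

/-- The change of coordinates `(t₁, t₂) ↦ (t₁, -det (γ' t₁, γ t₂ - O))`. -/
def φ (p : Circ × Circ) : Circ × ℝ :=
  (p.1, -det2 (velocity B.γ p.1) (B.γ p.2 - B.O))

/-- The phase space in the coordinates `(t, s)`. -/
def Phase : Set (Circ × ℝ) := B.φ '' B.PhaseHat

end Table

/-! Well-posedness of the billiard map. -/

lemma det2_sub_right (u v w : Plane) : det2 u (v - w) = det2 u v - det2 u w := by
  simp only [det2, PiLp.sub_apply]; ring

lemma velocity_coe (γ : Circ → Plane) (x : ℝ) :
    velocity γ (x : Circ) = deriv (fun y : ℝ => γ (y : Circ)) x := by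
  have := deriv_comp_const_add (f := fun y : ℝ => γ (y : Circ)) x 0
  simpa [velocity, AddCircle.coe_add] using this

namespace Table

variable (B : Table)

lemma det2_pos {t u : Circ} (h : u ≠ t) : 0 < det2 (velocity B.γ t) (B.γ u - B.γ t) := by
  have hmem : ∀ v, B.γ v ∈ closure B.Ω := fun v =>
    frontier_subset_closure (B.range_eq ▸ mem_range_self v)
  have hint : interior (closure B.Ω) = B.Ω := by
    rw [B.convex.interior_closure_eq_interior_of_nonempty_interior, B.isOpen.interior_eq]
    rw [B.isOpen.interior_eq]; exact ⟨_, B.origin_mem⟩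
  have hm := B.strictConvex (hmem t) (hmem u) (fun e => h (B.injective e).symm)
    (show (0 : ℝ) < 1 / 2 by norm_num) (show (0 : ℝ) < 1 / 2 by norm_num) (by norm_num)
  rw [hint] at hm
  have := B.orientation t _ hm
  simp only [det2, PiLp.sub_apply, PiLp.add_apply, PiLp.smul_apply, smul_eq_mul] at this ⊢
  linarith

lemma hasDerivAt_det2 (w : Plane) (x : ℝ) :
    HasDerivAt (fun y : ℝ => det2 w (B.γ (y : Circ))) (det2 w (velocity B.γ (x : Circ))) x := by
  have hd : HasDerivAt (fun y : ℝ => B.γ (y : Circ)) (velocity B.γ (x : Circ)) x := by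
    rw [velocity_coe]
    exact (B.contDiff.differentiable (by norm_num) x).hasDerivAt
  have hc : ∀ i, HasDerivAt (fun y : ℝ => B.γ (y : Circ) i) (velocity B.γ (x : Circ) i) x :=
    fun i => (EuclideanSpace.proj (𝕜 := ℝ) i).hasFDerivAt.comp_hasDerivAt x hd
  exact ((hc 1).const_mul (w 0)).sub ((hc 0).const_mul (w 1))

/-- Parallel tangents at distinct points point in opposite directions. -/
lemma opposite_smul {t u : Circ} (h : B.IsOpposite t u) :
    ∃ c : ℝ, c < 0 ∧ velocity B.γ u = c • velocity B.γ t := by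
  obtain ⟨hne, h0⟩ := h
  have hr := B.regular t
  have hc : ∃ c : ℝ, velocity B.γ u = c • velocity B.γ t := by
    simp only [det2] at h0
    by_cases h1 : velocity B.γ t 0 = 0
    · have h2 : velocity B.γ t 1 ≠ 0 := by
        intro h2; apply hr; ext i; fin_cases i <;> simpa
      refine ⟨velocity B.γ u 1 / velocity B.γ t 1, ?_⟩
      ext i; fin_cases i
      · have : velocity B.γ u 0 = 0 := by
          have : velocity B.γ t 1 * velocity B.γ u 0 = 0 := by rw [h1] at h0; linarith
          exact (mul_eq_zero.1 this).resolve_left h2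
        simp [h1, this]
      · simp [h2]
    · refine ⟨velocity B.γ u 0 / velocity B.γ t 0, ?_⟩
      ext i; fin_cases i
      · simp [h1]
      · simp; field_simp; linarith
  obtain ⟨c, hc⟩ := hc
  refine ⟨c, ?_, hc⟩
  have h1 := B.det2_pos hne
  have h2 := B.det2_pos hne.symm
  have h3 : det2 (velocity B.γ u) (B.γ t - B.γ u) =
      -c * det2 (velocity B.γ t) (B.γ u - B.γ t) := by
    rw [hc]; simp only [det2, PiLp.sub_apply, PiLp.smul_apply, smul_eq_mul]; ring
  rw [h3] at h2
  nlinarith [pos_of_mul_pos_left h2 h1.le]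

lemma opposite_unique {t u v : Circ} (hu : B.IsOpposite t u) (hv : B.IsOpposite t v) : u = v := by
  by_contra hne
  obtain ⟨c, hc, hcu⟩ := B.opposite_smul hu
  obtain ⟨d, hd, hdv⟩ := B.opposite_smul hv
  have h1 := B.det2_pos hne
  have h2 := B.det2_pos (Ne.symm hne)
  rw [hdv] at h1
  rw [hcu] at h2
  simp only [det2, PiLp.sub_apply, PiLp.smul_apply, smul_eq_mul] at h1 h2
  have h3 : d * det2 (velocity B.γ t) (B.γ u - B.γ v) > 0 := by
    simp only [det2, PiLp.sub_apply]; linarith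
  have h4 : c * -det2 (velocity B.γ t) (B.γ u - B.γ v) > 0 := by
    simp only [det2, PiLp.sub_apply]; linarith
  nlinarith [neg_of_mul_pos_right h3 hd.le, neg_of_mul_pos_right h4 hc.le]

lemma exists_lift (T : ℝ) {u : Circ} (h : u ≠ (T : Circ)) :
    ∃ S : ℝ, (S : Circ) = u ∧ T < S ∧ S < T + 2 * π := by
  have hfact : Fact (0 < 2 * π) := ⟨Real.two_pi_pos⟩
  obtain ⟨x, hx, rfl⟩ : u ∈ ((↑) : ℝ → Circ) '' Ico T (T + 2 * π) := by
    rw [AddCircle.coe_image_Ico_eq]; trivial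
  exact ⟨x, rfl, lt_of_le_of_ne hx.1 (fun e => h (by rw [e])), hx.2⟩

lemma continuous_γ : Continuous B.γ := by
  refine (QuotientAddGroup.isQuotientMap_mk (N := AddSubgroup.zmultiples (2 * π))).continuous_iff.2 ?_
  exact B.contDiff.continuous

lemma exists_opposite (t : Circ) : ∃ u, B.IsOpposite t u := by
  have hfact : Fact (0 < 2 * π) := ⟨Real.two_pi_pos⟩
  have hc : Continuous fun u => det2 (velocity B.γ t) (B.γ u) := by
    have := B.continuous_γ
    unfold det2; fun_prop
  obtain ⟨u, -, hu⟩ := isCompact_univ.exists_isMaxOn univ_nonempty hc.continuousOn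
  have hmax : ∀ v, det2 (velocity B.γ t) (B.γ v) ≤ det2 (velocity B.γ t) (B.γ u) :=
    fun v => hu (mem_univ v)
  refine ⟨u, ?_, ?_⟩
  · rintro rfl
    obtain ⟨v, hv⟩ : ∃ v : Circ, v ≠ u := by
      refine ⟨u + ((π : ℝ) : Circ), fun e => ?_⟩
      have h0 : ((π : ℝ) : Circ) = ((0 : ℝ) : Circ) := by simpa using e
      have := (AddCircle.coe_eq_coe_iff_of_mem_Ico (p := 2 * π) (a := 0)
        ⟨Real.pi_pos.le, by linarith [Real.pi_pos]⟩ ⟨le_rfl, by linarith [Real.pi_pos]⟩).1 h0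
      exact Real.pi_ne_zero this
    have h1 := B.det2_pos hv
    rw [det2_sub_right] at h1
    linarith [hmax v]
  · obtain ⟨x, rfl⟩ := QuotientAddGroup.mk_surjective u
    refine IsLocalMax.hasDerivAt_eq_zero ?_ (B.hasDerivAt_det2 (velocity B.γ t) x)
    exact Filter.Eventually.of_forall fun y => hmax (y : Circ)

/-- Between `T` and the lift `S` of its opposite the tangent turns to the left. -/
lemma det2_velocity_pos {T S x : ℝ} (hS : B.IsOpposite (T : Circ) (S : Circ)) (hTS : T < S)
    (hS' : S < T + 2 * π) (hx : x ∈ Ioo T S) :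
    0 < det2 (velocity B.γ (T : Circ)) (velocity B.γ (x : Circ)) := by
  have hfact : Fact (0 < 2 * π) := ⟨Real.two_pi_pos⟩
  set w := velocity B.γ (T : Circ)
  have hinj : ∀ a b : ℝ, a ∈ Ico T (T + 2 * π) → b ∈ Ico T (T + 2 * π) →
      (a : Circ) = (b : Circ) → a = b := fun a b ha hb e =>
    (AddCircle.coe_eq_coe_iff_of_mem_Ico ha hb).1 e
  have hne : ∀ y ∈ Ioo T S, det2 w (velocity B.γ (y : Circ)) ≠ 0 := by
    intro y hy h0
    have hyo : B.IsOpposite (T : Circ) (y : Circ) := by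
      refine ⟨fun e => ?_, h0⟩
      have := hinj y T ⟨hy.1.le, hy.2.trans hS'⟩ ⟨le_rfl, by linarith [Real.two_pi_pos]⟩ e
      linarith [hy.1]
    have := hinj y S ⟨hy.1.le, hy.2.trans hS'⟩ ⟨hTS.le, hS'⟩ (B.opposite_unique hyo hS)
    linarith [hy.2]
  have hcd : ContinuousOn (fun y : ℝ => det2 w (velocity B.γ (y : Circ))) (Ioo T S) := by
    have : Continuous fun y : ℝ => velocity B.γ (y : Circ) := by
      simp_rw [velocity_coe]
      exact B.contDiff.continuous_deriv (by norm_num)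
    refine Continuous.continuousOn ?_
    unfold det2; fun_prop
  obtain ⟨y, hy, hyd⟩ := exists_hasDerivAt_eq_slope (fun y : ℝ => det2 w (B.γ (y : Circ)))
    (fun y : ℝ => det2 w (velocity B.γ (y : Circ))) hTS
    (fun y _ => (B.hasDerivAt_det2 w y).continuousAt.continuousWithinAt)
    (fun y _ => B.hasDerivAt_det2 w y)
  have hypos : 0 < det2 w (velocity B.γ (y : Circ)) := by
    have := B.det2_pos hS.1
    rw [det2_sub_right] at this
    rw [hyd]
    exact div_pos this (by linarith)
  by_contra hcon
  obtain ⟨z, hz, hz0⟩ := isPreconnected_Ioo.intermediate_value hx hy hcd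
    (show (0 : ℝ) ∈ Icc _ _ from ⟨not_lt.1 hcon, hypos.le⟩)
  exact hne z hz hz0

lemma PosAdmissible.det2_pos {t₁ t₂ : Circ} (h : B.PosAdmissible t₁ t₂) :
    0 < det2 (velocity B.γ t₁) (velocity B.γ t₂) := by
  obtain ⟨T, S, x, rfl, rfl, hS, h1, h2, h3, h4⟩ := h
  exact B.det2_velocity_pos hS h1 h2 ⟨h3, h4⟩

lemma PosAdmissible.exists_mem_Ioo {T S : ℝ} {u : Circ}
    (hS : B.IsOpposite (T : Circ) (S : Circ)) (hTS : T < S) (hST : S < T + 2 * π)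
    (hu : B.PosAdmissible (T : Circ) u) : ∃ x ∈ Ioo T S, (x : Circ) = u := by
  have hfact : Fact (0 < 2 * π) := ⟨Real.two_pi_pos⟩
  obtain ⟨T', S', x, hT', rfl, hS', h1, h2, h3, h4⟩ := hu
  have hd : ((T' - T : ℝ) : Circ) = 0 := by rw [AddCircle.coe_sub, hT', sub_self]
  have hsh : ∀ y : ℝ, ((y - (T' - T) : ℝ) : Circ) = (y : Circ) := fun y => by
    rw [AddCircle.coe_sub, hd, sub_zero]
  rw [hT', ← hsh S'] at hS'
  have he : S' - (T' - T) = S :=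
    (AddCircle.coe_eq_coe_iff_of_mem_Ico (p := 2 * π) (a := T)
      ⟨by linarith, by linarith⟩ ⟨by linarith, by linarith⟩).1 (B.opposite_unique hS' hS)
  exact ⟨x - (T' - T), ⟨by linarith, by linarith⟩, hsh x⟩

/-- Positive admissible points `(t, u)` are determined by `t` and `det (γ' t, γ u)`. -/
lemma PosAdmissible.eq_of_det2_eq {t u v : Circ} (hu : B.PosAdmissible t u)
    (hv : B.PosAdmissible t v)
    (h : det2 (velocity B.γ t) (B.γ u) = det2 (velocity B.γ t) (B.γ v)) : u = v := by
  obtain ⟨T, S, x, rfl, rfl, hS, h1, h2, h3, h4⟩ := hu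
  obtain ⟨y, hy, rfl⟩ := PosAdmissible.exists_mem_Ioo B hS h1 h2 hv
  have hmono : StrictMonoOn (fun y : ℝ => det2 (velocity B.γ (T : Circ)) (B.γ (y : Circ)))
      (Ioo T S) := by
    refine strictMonoOn_of_deriv_pos (convex_Ioo T S)
      (fun y _ => (B.hasDerivAt_det2 _ y).continuousAt.continuousWithinAt) fun y hy => ?_
    rw [(B.hasDerivAt_det2 _ y).deriv]
    exact B.det2_velocity_pos hS h1 h2 (interior_subset hy)
  rw [hmono.injOn ⟨h3, h4⟩ hy h]

/-- The next bounce exists and is unique. The point `t₁` itself solves the equation as well, but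
`(t₂, t₁)` is not positive admissible. -/
lemma existsUnique_next {t₁ t₂ : Circ} (h : B.PosAdmissible t₁ t₂) :
    ∃! t₃, B.PosAdmissible t₂ t₃ ∧ det2 (velocity B.γ t₂) (B.γ t₃ - B.γ t₁) = 0 := by
  have hpos := PosAdmissible.det2_pos B h
  have hne : t₁ ≠ t₂ := by
    rintro rfl
    simp only [det2] at hpos; linarith
  obtain ⟨T, rfl⟩ := QuotientAddGroup.mk_surjective t₂
  change B.PosAdmissible t₁ (T : Circ) at h
  change 0 < det2 (velocity B.γ t₁) (velocity B.γ (T : Circ)) at hpos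
  change t₁ ≠ (T : Circ) at hne
  obtain ⟨u, hu⟩ := B.exists_opposite (T : Circ)
  obtain ⟨S, rfl, hTS, hST⟩ := exists_lift T hu.1
  have hne' : t₁ ≠ (S : Circ) := by
    rintro rfl
    have := hu.2
    simp only [det2] at this hpos; linarith
  set w := velocity B.γ (T : Circ) with hw
  have hlow : det2 w (B.γ (T : Circ)) < det2 w (B.γ t₁) := by
    have := B.det2_pos hne
    rw [det2_sub_right] at this; linarith
  have hhigh : det2 w (B.γ t₁) < det2 w (B.γ (S : Circ)) := by
    obtain ⟨c, hc, hcv⟩ := B.opposite_smul hu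
    have h1 := B.det2_pos hne'
    rw [hcv, ← hw] at h1
    have h2 : det2 (c • w) (B.γ t₁ - B.γ (S : Circ)) =
        c * (det2 w (B.γ t₁) - det2 w (B.γ (S : Circ))) := by
      simp only [det2, PiLp.sub_apply, PiLp.smul_apply, smul_eq_mul]; ring
    rw [h2] at h1
    linarith [neg_of_mul_pos_right h1 hc.le]
  obtain ⟨x, hx, hxe⟩ := intermediate_value_Ioo hTS.le
    (fun y _ => (B.hasDerivAt_det2 w y).continuousAt.continuousWithinAt) ⟨hlow, hhigh⟩
  simp only at hxe
  refine ⟨(x : Circ), ⟨⟨T, S, x, rfl, rfl, hu, hTS, hST, hx.1, hx.2⟩, ?_⟩, ?_⟩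
  · rw [det2_sub_right, hxe, sub_self]
  · rintro v ⟨hv, hve⟩
    change det2 w (B.γ v - B.γ t₁) = 0 at hve
    rw [det2_sub_right] at hve
    refine PosAdmissible.eq_of_det2_eq B hv ⟨T, S, x, rfl, rfl, hu, hTS, hST, hx.1, hx.2⟩ ?_
    change det2 w (B.γ v) = det2 w (B.γ (x : Circ))
    linarith

lemma φ_injOn : InjOn B.φ B.PhaseHat := by
  rintro ⟨t, u⟩ hu ⟨t', v⟩ hv h
  simp only [φ, Prod.mk.injEq, neg_inj] at h
  obtain ⟨rfl, h⟩ := h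
  rw [det2_sub_right, det2_sub_right] at h
  have := PosAdmissible.eq_of_det2_eq B hu hv (by linarith)
  exact Prod.ext rfl this

/-- The symplectic billiard map `(t₁, t₂) ↦ (t₂, t₃)`, where `(t₂, t₃)` is positive admissible and
`γ t₃ - γ t₁` is parallel to `γ' t₂`. -/
def THat (p : B.PhaseHat) : B.PhaseHat :=
  ⟨(p.1.2, (B.existsUnique_next p.2).choose), (B.existsUnique_next p.2).choose_spec.1.1⟩

/-- `φ` as a bijection between the two phase spaces. -/
def φEquiv : B.PhaseHat ≃ B.Phase := Equiv.Set.imageOfInjOn B.φ B.PhaseHat B.φ_injOn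

/-- The symplectic billiard map in the coordinates `(t, s)`. -/
def T (z : B.Phase) : B.Phase := B.φEquiv (B.THat (B.φEquiv.symm z))

end Table

/-- An essential curve in the cylinder: the image of a topological embedding of the circle that is
not homotopic to a constant map. -/
def IsEssentialCurve (Γ : Set (Circ × ℝ)) : Prop :=
  ∃ c : C(Circ, Circ × ℝ), Topology.IsEmbedding c ∧ ¬ c.Nullhomotopic ∧ range c = Γ

namespace Table

variable (B : Table)

/-- An essential curve contained in the phase space with `T(Γ) = Γ`. -/
def IsInvariantEssentialCurve (Γ : Set (Circ × ℝ)) : Prop :=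
  IsEssentialCurve Γ ∧ Γ ⊆ B.Phase ∧
    B.T '' (Subtype.val ⁻¹' Γ) = (Subtype.val ⁻¹' Γ : Set B.Phase)

/-- The union of all invariant essential curves of `T`. -/
def V : Set (Circ × ℝ) := ⋃₀ {Γ | B.IsInvariantEssentialCurve Γ}

/-- An instability region of `T`: an open bounded connected component of the complement in the phase
space of the invariant essential curves, with an essential curve in its interior. -/
def IsInstabilityRegion (U : Set (Circ × ℝ)) : Prop :=
  IsOpen U ∧ Bornology.IsBounded U ∧
    (∃ z ∈ B.Phase \ B.V, U = connectedComponentIn (B.Phase \ B.V) z) ∧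
    ∃ Γ, IsEssentialCurve Γ ∧ Γ ⊆ interior U

end Table

end SymplecticBilliard

end

/-!
# Symplectic billiards with a point of zero curvature have no invariant curves

Everything is lifted to the plane. The phase space lifts to the strip `x < y < x*`, the billiard map
to `(x, y) ↦ (y, z)` with `det (γ' y, γ z) = det (γ' y, γ x)`, and an invariant essential curve to
an invariant subset of the strip that is the orbit, under diagonal translations by `2π`, of a path
`c` which stays at bounded distance from the diagonal (`LiftedCurve`, `exists_liftedCurve`). On
`[y* - 2π, y]` the height `det (γ' y, γ ·)` decreases and on `[y, y*]` it increases. So for fixed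
`y` the next bounce `z` is a decreasing function of `x` (`Table.next_lt_next`), which is the twist
condition; and the substitution of the height in both variables shows that the area form
`det (γ' x, γ' y) dx dy` is preserved (`Table.area_image_step`).

*Invariant curves are graphs.* Let `R` be the component of the complement of the lifted curve that
borders the diagonal. For `p` in `R`, the argument `θ p x` of `c x - p` is made single-valued by
asking for values near `π / 4` as `x → ∞` (`LiftedCurve.angle`); its values near `-∞` are then near
`5π / 4`. By the twist condition the billiard map can cross the vertical directions only clockwise:
if `θ p x ≤ π / 2 + j π` then the angle of the images is strictly less than `π / 2 + j π`
(`LiftedCurve.angle_step_lt`). Hence the points of `R` that see some point of the curve at an angle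
`≤ -π / 2` are mapped to points with an angle `< -π / 2`. The open set of points all of whose angles
are `> -π / 2` is therefore contained in its image, which has the same area; so the image does not
meet the open set of points with an angle `< -π / 2`. These two sets cover the connected set `R`,
and the second one must be empty (`LiftedCurve.region_subset_of_area`). The same argument for the
inverse map excludes angles `≥ 3π / 2`. Therefore no point of the curve lies vertically below a
point of `R` (`LiftedCurve.not_mem_carrier_of_lt`), and `R` is the set `x < y < g x` below a graph.

*Points of zero curvature.* Invariance of `R` says that `g` is increasing and that its conjugate
`g⁻`, given by `det (γ' y, γ (g⁻ y)) = det (γ' y, γ (g y))`, satisfies `y < g x ↔ g⁻ y < x`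
(`LiftedCurve.lt_upper_iff`). If the curvature vanishes at `t₀`, then `γ'' t₀` is parallel to
`γ' t₀`, so that `det (γ' t, γ (g t₀) - γ (g⁻ t₀))` vanishes at `t₀` to first order. Monotonicity of
`g⁻` turns this into `g t - g t₀ = o(t - t₀)` as `t ↓ t₀`. The same comparison one bounce later
gives `t - t₀ = O(g t - g t₀)`, a contradiction (`LiftedCurve.false_of_parallel`).

Without invariant curves, the instability region is the whole phase space, which is open, bounded
and connected, and contains the zero section.
-/

noncomputable section

namespace SymplecticBilliard

/-! ### Continuous arguments along a path -/

/-- A continuous function on the line with values in `2πℤ` is constant. -/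
lemma eq_of_forall_exists_int {f : ℝ → ℝ} (hf : Continuous f)
    (hk : ∀ x, ∃ n : ℤ, f x = n * (2 * π)) (x y : ℝ) : f x = f y := by
  by_contra hne
  obtain ⟨n, hn⟩ := hk x
  obtain ⟨m, hm⟩ := hk y
  have hcont : Continuous fun x => f x / (2 * π) := by fun_prop
  have hx : f x / (2 * π) = n := by rw [hn]; field_simp
  have hy : f y / (2 * π) = m := by rw [hm]; field_simp
  have hnm : n ≠ m := fun e => hne (by rw [hn, hm, e])
  have hmin : (min n m : ℝ) + 1 / 2 ∈ uIcc (f x / (2 * π)) (f y / (2 * π)) := by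
    rw [hx, hy, mem_uIcc]
    rcases lt_or_gt_of_ne hnm with hlt | hlt
    · have : (n : ℝ) + 1 ≤ m := by exact_mod_cast hlt
      rw [min_eq_left (by linarith)]
      left; constructor <;> linarith
    · have : (m : ℝ) + 1 ≤ n := by exact_mod_cast hlt
      rw [min_eq_right (by linarith)]
      right; constructor <;> linarith
  obtain ⟨w, -, hw⟩ := intermediate_value_uIcc (a := x) (b := y) hcont.continuousOn hmin
  obtain ⟨j, hj⟩ := hk w
  simp only at hw
  rw [hj, mul_div_cancel_right₀ _ Real.two_pi_pos.ne'] at hw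
  have h2 : (2 * j : ℤ) = 2 * min n m + 1 := by
    have : (2 * j : ℝ) = 2 * ((min n m : ℤ) : ℝ) + 1 := by push_cast; linarith
    exact_mod_cast this
  omega

/-- Two continuous arguments of the same path agree if they differ by less than `2π` at one point.
-/
lemma eq_of_exp_eq {a b : ℝ → ℝ} (ha : Continuous a) (hb : Continuous b)
    (h : ∀ x, Complex.exp (a x * Complex.I) = Complex.exp (b x * Complex.I))
    {x₀ : ℝ} (h₀ : |a x₀ - b x₀| < 2 * π) (x : ℝ) : a x = b x := by
  have hk : ∀ x, ∃ n : ℤ, a x - b x = n * (2 * π) := by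
    intro x
    obtain ⟨n, hn⟩ := Complex.exp_eq_exp_iff_exists_int.1 (h x)
    refine ⟨n, ?_⟩
    have := congrArg Complex.im hn
    simp at this
    linarith
  obtain ⟨n, hn⟩ := hk x₀
  have hn0 : n = 0 := by
    rw [hn, abs_mul, abs_of_pos Real.two_pi_pos] at h₀
    have : |(n : ℝ)| < 1 := by
      by_contra hc
      nlinarith [Real.two_pi_pos, not_lt.1 hc]
    have : |n| < 1 := by exact_mod_cast this
    exact Int.abs_lt_one_iff.1 this
  have := eq_of_forall_exists_int (ha.sub hb) hk x x₀
  simp only [Pi.sub_apply] at this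
  rw [hn, hn0, Int.cast_zero, zero_mul] at this
  linarith

/-- The weighted difference `(1 - |u|) (c (u / (1 - |u|)) - z)` for `|u| < 1`, rewritten so that its
value at `u = ±1` is its limit `u (1 + i)` when `c x - x (1 + i)` is bounded. The junk value of
`u / 0` is multiplied by zero. -/
def compactified (c : ℝ → ℂ) (u : ℝ) (z : ℂ) : ℂ :=
  u * (1 + Complex.I) +
    (1 - |u| : ℝ) * (c (u / (1 - |u|)) - (u / (1 - |u|) : ℝ) * (1 + Complex.I) - z)

lemma compactified_eq (c : ℝ → ℂ) {u : ℝ} (hu : |u| < 1) (z : ℂ) :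
    compactified c u z = (1 - |u| : ℝ) * (c (u / (1 - |u|)) - z) := by
  unfold compactified
  have h : ((1 - |u| : ℝ) : ℂ) * ((u / (1 - |u|) : ℝ) : ℂ) = (u : ℂ) := by
    rw [← Complex.ofReal_mul]
    congr 1
    have : 1 - |u| ≠ 0 := by linarith
    field_simp
  linear_combination (-(1 + Complex.I)) * h

open Filter Topology in
lemma continuousOn_compactified {c : ℝ → ℂ} (hc : Continuous c) {C : ℝ}
    (hC : ∀ x : ℝ, ‖c x - x * (1 + Complex.I)‖ ≤ C) :
    ContinuousOn (fun p : ℝ × ℂ => compactified c p.1 p.2) ({u | |u| ≤ 1} ×ˢ univ) := by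
  rintro ⟨u, z⟩ ⟨hu, -⟩
  simp only [mem_ofPred_eq] at hu
  apply ContinuousAt.continuousWithinAt
  rcases hu.lt_or_eq with hlt | heq
  · have hne : (1 - |u|) ≠ 0 := by linarith
    unfold compactified
    have h1 : ContinuousAt (fun p : ℝ × ℂ => p.1 / (1 - |p.1|)) (u, z) := by
      refine ContinuousAt.div ?_ ?_ hne <;> fun_prop
    have h2 : ContinuousAt (fun p : ℝ × ℂ => c (p.1 / (1 - |p.1|))) (u, z) :=
      ContinuousAt.comp (f := fun p : ℝ × ℂ => p.1 / (1 - |p.1|)) hc.continuousAt h1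
    have h3 : ContinuousAt (fun p : ℝ × ℂ => ((p.1 / (1 - |p.1|) : ℝ) : ℂ)) (u, z) :=
      ContinuousAt.comp (f := fun p : ℝ × ℂ => p.1 / (1 - |p.1|))
        Complex.continuous_ofReal.continuousAt h1
    fun_prop
  · unfold compactified
    refine ContinuousAt.add (by fun_prop) ?_
    have hz : Tendsto (fun p : ℝ × ℂ => ((1 - |p.1| : ℝ) : ℂ) * (c (p.1 / (1 - |p.1|)) -
        (p.1 / (1 - |p.1|) : ℝ) * (1 + Complex.I) - p.2)) (𝓝 (u, z)) (𝓝 0) := by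
      have hb : Tendsto (fun p : ℝ × ℂ => abs (1 - |p.1|) * (C + ‖p.2‖)) (𝓝 (u, z)) (𝓝 0) := by
        have : ContinuousAt (fun p : ℝ × ℂ => abs (1 - |p.1|) * (C + ‖p.2‖)) (u, z) := by fun_prop
        have h := this.tendsto
        simpa [heq] using h
      refine squeeze_zero_norm (fun p => ?_) hb
      rw [norm_mul, Complex.norm_real, Real.norm_eq_abs]
      refine mul_le_mul_of_nonneg_left ?_ (abs_nonneg _)
      exact (norm_sub_le _ _).trans (add_le_add (hC _) le_rfl)
    unfold ContinuousAt
    convert hz using 2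
    simp [heq]

lemma polar_ne_zero {v : ℂ} {L : ℂ} (h : Complex.exp L = v) :
    v = ‖v‖ * Complex.exp (L.im * Complex.I) := by
  subst h
  rw [Complex.norm_exp, Complex.ofReal_exp, ← Complex.exp_add, Complex.re_add_im]

open unitInterval in
/-- The argument of `c x - z` can be chosen continuously in `x` and `z`, including the ends
`x = ±∞`: the compactified difference is a homotopy, run from `u = 1` to `u = -1`, with values in
the punctured plane, and it lifts through the exponential. -/
lemma exists_lift_compactified {c : ℝ → ℂ} (hc : Continuous c) {C : ℝ}
    (hC : ∀ x : ℝ, ‖c x - x * (1 + Complex.I)‖ ≤ C) :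
    ∃ θ : C(I × ((range c)ᶜ : Set ℂ), ℝ), (∀ z, θ (0, z) = π / 4) ∧
      ∀ (s : I) (z : ((range c)ᶜ : Set ℂ)), compactified c (1 - 2 * s) z =
        ‖compactified c (1 - 2 * s) z‖ * Complex.exp (θ (s, z) * Complex.I) := by
  have hne : ∀ p : I × ((range c)ᶜ : Set ℂ), compactified c (1 - 2 * p.1) p.2 ≠ 0 := by
    rintro ⟨⟨s, hs0, hs1⟩, z, hz⟩
    simp only
    rcases hs0.eq_or_lt with h0 | h0
    · subst h0
      simp [compactified, Complex.ext_iff]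
    rcases hs1.eq_or_lt with h1 | h1
    · subst h1
      norm_num [compactified, Complex.ext_iff]
    have hlt : |1 - 2 * s| < 1 := by rw [abs_lt]; constructor <;> linarith
    rw [compactified_eq c hlt]
    refine mul_ne_zero (by exact_mod_cast (by linarith : 1 - |1 - 2 * s| ≠ 0)) ?_
    rw [sub_ne_zero]
    exact fun e => hz ⟨_, e⟩
  have hcont : Continuous fun p : I × ((range c)ᶜ : Set ℂ) =>
      compactified c (1 - 2 * (p.1 : ℝ)) p.2 := by
    have h := continuousOn_compactified hc hC
    refine h.comp_continuous (f := fun p : I × ((range c)ᶜ : Set ℂ) =>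
      ((1 - 2 * (p.1 : ℝ), (p.2 : ℂ)) : ℝ × ℂ)) (by fun_prop) ?_
    rintro ⟨⟨s, hs0, hs1⟩, z⟩
    refine ⟨?_, trivial⟩
    simp only [mem_ofPred_eq]
    rw [abs_le]; constructor <;> linarith
  have he : Complex.exp (Complex.log (1 + Complex.I)) = 1 + Complex.I :=
    Complex.exp_log (by simp [Complex.ext_iff])
  have h0 : ∀ z, compactified c 1 z = 1 + Complex.I := by
    intro z; simp [compactified]
  let H : C(I × ((range c)ᶜ : Set ℂ), {z : ℂ // z ≠ 0}) :=
    ⟨fun p => ⟨_, hne p⟩, hcont.subtype_mk hne⟩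
  let f : C(((range c)ᶜ : Set ℂ), ℂ) := ContinuousMap.const _ (Complex.log (1 + Complex.I))
  have H0 : ∀ a, H (0, a) = (fun z : ℂ ↦ (⟨_, z.exp_ne_zero⟩ : {z : ℂ // z ≠ 0})) (f a) := by
    intro a
    apply Subtype.ext
    simp [H, f, he, h0]
  let Λ := Complex.isCoveringMap_exp.liftHomotopy H f H0
  have hΛ : ∀ p, Complex.exp (Λ p) = compactified c (1 - 2 * (p.1 : ℝ)) p.2 := by
    intro p
    have := congrFun (Complex.isCoveringMap_exp.liftHomotopy_lifts H f H0) p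
    exact congrArg Subtype.val this
  refine ⟨⟨fun p => (Λ p).im, by fun_prop⟩, ?_, ?_⟩
  · intro z
    have : Λ (0, z) = Complex.log (1 + Complex.I) :=
      Complex.isCoveringMap_exp.liftHomotopy_zero H f H0 z
    simp only [ContinuousMap.coe_mk, this, Complex.log_im]
    have h2 : (1 + Complex.I : ℂ) = (√2 : ℝ) * (Complex.cos (π / 4 : ℝ) +
        Complex.sin (π / 4 : ℝ) * Complex.I) := by
      rw [← Complex.ofReal_cos, ← Complex.ofReal_sin, Real.cos_pi_div_four, Real.sin_pi_div_four]
      apply Complex.ext <;> simp <;> ring_nf <;> norm_num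
    rw [h2, Complex.arg_mul_cos_add_sin_mul_I (by positivity)
      ⟨by linarith [Real.pi_pos], by linarith [Real.pi_pos]⟩]
  · intro s z
    exact polar_ne_zero (hΛ (s, z))

/-- An argument `f` of a path in the open first and third quadrants stays within `π / 4` of a value
on the bisector, as the path cannot leave its quadrant. -/
lemma abs_sub_lt_of_sin_pos {f : ℝ → ℝ} {S : Set ℝ} (hS : IsPreconnected S)
    (hf : ContinuousOn f S) (hpos : ∀ s ∈ S, 0 < Real.sin (2 * f s)) {s₀ : ℝ} (hs₀ : s₀ ∈ S)
    (h₀ : Real.sin (2 * f s₀) = 1) {s : ℝ} (hs : s ∈ S) : |f s - f s₀| < π / 4 := by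
  by_contra hcon
  have hg : ContinuousOn (fun s => |f s - f s₀|) S := (hf.sub continuousOn_const).abs
  obtain ⟨w, hw, hwe⟩ := hS.intermediate_value hs₀ hs hg
    (show π / 4 ∈ Icc _ _ from ⟨by simp; positivity, not_lt.1 hcon⟩)
  simp only at hwe
  have h1 := hpos w hw
  have hcos : Real.cos (2 * f s₀) = 0 := by
    have := Real.sin_sq_add_cos_sq (2 * f s₀)
    rw [h₀] at this
    have h2 : Real.cos (2 * f s₀) ^ 2 = 0 := by linarith
    exact pow_eq_zero_iff (two_ne_zero) |>.1 h2
  have h2 : Real.cos (2 * (f w - f s₀)) = 0 := by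
    rcases abs_eq (by positivity : (0 : ℝ) ≤ π / 4) |>.1 hwe with e | e <;> rw [e]
    · rw [show 2 * (π / 4) = π / 2 by ring, Real.cos_pi_div_two]
    · rw [show 2 * (-(π / 4)) = -(π / 2) by ring, Real.cos_neg, Real.cos_pi_div_two]
  rw [show 2 * f w = 2 * (f w - f s₀) + 2 * f s₀ by ring, Real.sin_add, h2, hcos] at h1
  simp at h1

lemma re_im_of_polar {v : ℂ} {t : ℝ} (h : v = ‖v‖ * Complex.exp (t * Complex.I)) :
    v.re = ‖v‖ * Real.cos t ∧ v.im = ‖v‖ * Real.sin t := by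
  constructor
  · conv_lhs => rw [h]
    rw [Complex.re_ofReal_mul, Complex.exp_ofReal_mul_I_re]
  · conv_lhs => rw [h]
    rw [Complex.im_ofReal_mul, Complex.exp_ofReal_mul_I_im]

lemma sin_two_mul_pos_of_polar {v : ℂ} {t : ℝ} (h : v = ‖v‖ * Complex.exp (t * Complex.I))
    (hv : 0 < v.re * v.im) : 0 < Real.sin (2 * t) := by
  obtain ⟨h1, h2⟩ := re_im_of_polar h
  rw [h1, h2] at hv
  rw [Real.sin_two_mul]
  have h3 : ‖v‖ * Real.cos t * (‖v‖ * Real.sin t) = ‖v‖ ^ 2 * (Real.cos t * Real.sin t) := by ring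
  rw [h3] at hv
  have := pos_of_mul_pos_right hv (by positivity)
  linarith

/-- Near the ends the compactified difference lies in the open first or third quadrant. -/
lemma compactified_re_im_pos {c : ℝ → ℂ} {C R : ℝ}
    (hC : ∀ x : ℝ, ‖c x - x * (1 + Complex.I)‖ ≤ C) {z : ℂ} (hz : ‖z‖ ≤ R) {u : ℝ}
    (hu : |u| ≤ 1) (hR : (1 - |u|) * (C + R) < |u|) :
    0 < (compactified c u z).re * (compactified c u z).im := by
  set e := c (u / (1 - |u|)) - (u / (1 - |u|) : ℝ) * (1 + Complex.I) - z with he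
  have hn : ‖e‖ ≤ C + R := (norm_sub_le _ _).trans (add_le_add (hC _) hz)
  have hre : (compactified c u z).re = u + (1 - |u|) * e.re := by
    unfold compactified; rw [← he]; simp
  have him : (compactified c u z).im = u + (1 - |u|) * e.im := by
    unfold compactified; rw [← he]; simp
  have h1 : |(1 - |u|) * e.re| < |u| := by
    rw [abs_mul, abs_of_nonneg (by linarith : 0 ≤ 1 - |u|)]
    exact (mul_le_mul_of_nonneg_left ((Complex.abs_re_le_norm e).trans hn)
      (by linarith)).trans_lt hR
  have h2 : |(1 - |u|) * e.im| < |u| := by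
    rw [abs_mul, abs_of_nonneg (by linarith : 0 ≤ 1 - |u|)]
    exact (mul_le_mul_of_nonneg_left ((Complex.abs_im_le_norm e).trans hn)
      (by linarith)).trans_lt hR
  rw [hre, him]
  rw [abs_lt] at h1 h2
  rcases abs_cases u with ⟨h, h'⟩ | ⟨h, h'⟩
  · rw [h] at h1 h2 ⊢
    exact mul_pos (by linarith) (by linarith)
  · rw [h] at h1 h2 ⊢
    exact mul_pos_of_neg_of_neg (by linarith) (by linarith)

lemma abs_div_one_add_abs_lt (x : ℝ) : |x / (1 + |x|)| < 1 := by
  have : 0 < 1 + |x| := by positivity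
  rw [abs_div, abs_of_pos this, div_lt_one this]; linarith

lemma one_sub_abs_div_one_add_abs (x : ℝ) : 1 - |x / (1 + |x|)| = 1 / (1 + |x|) := by
  have : 0 < 1 + |x| := by positivity
  rw [abs_div, abs_of_pos this]; field_simp; ring

open unitInterval in
/-- For a path `c` at bounded distance from the diagonal `x ↦ x (1 + i)` there is a continuous
argument `θ z x` of `c x - z`, for `z` off the path, which is near `π / 4` for large `x` and near
the locally constant value `θe z ≡ 5π / 4` modulo `2π` for large `-x`, uniformly for bounded `z`.
-/
theorem exists_continuous_angle {c : ℝ → ℂ} (hc : Continuous c) {C : ℝ}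
    (hC : ∀ x : ℝ, ‖c x - x * (1 + Complex.I)‖ ≤ C) :
    ∃ (θ : ℂ → ℝ → ℝ) (θe : ℂ → ℝ),
      ContinuousOn (fun p : ℂ × ℝ => θ p.1 p.2) ((range c)ᶜ ×ˢ univ) ∧
      ContinuousOn θe (range c)ᶜ ∧
      (∀ z ∉ range c, ∀ x, c x - z = ‖c x - z‖ * Complex.exp (θ z x * Complex.I)) ∧
      (∀ z ∉ range c, ∃ k : ℤ, θe z = 5 * π / 4 + k * (2 * π)) ∧
      ∀ R, ∃ M, ∀ z ∉ range c, ‖z‖ ≤ R → (∀ x ≥ M, |θ z x - π / 4| < π / 4) ∧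
        ∀ x ≤ -M, |θ z x - θe z| < π / 4 := by
  classical
  obtain ⟨Θ, hΘ0, hΘ⟩ := exists_lift_compactified hc hC
  let ρ : ℝ → I := fun x => ⟨(1 - x / (1 + |x|)) / 2, by
    have := abs_lt.1 (abs_div_one_add_abs_lt x)
    constructor <;> linarith⟩
  have hρc : Continuous ρ := by
    refine Continuous.subtype_mk ?_ _
    have : Continuous fun x : ℝ => x / (1 + |x|) :=
      continuous_id.div (by fun_prop) (fun x => by positivity)
    fun_prop
  have hρv : ∀ x, 1 - 2 * (ρ x : ℝ) = x / (1 + |x|) := fun x => by simp only [ρ]; ring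
  let θ : ℂ → ℝ → ℝ := fun z x => if h : z ∉ range c then Θ (ρ x, ⟨z, h⟩) else 0
  let θe : ℂ → ℝ := fun z => if h : z ∉ range c then Θ (1, ⟨z, h⟩) else 0
  have hθ : ∀ z (h : z ∉ range c) x, θ z x = Θ (ρ x, ⟨z, h⟩) := fun z h x => dif_pos h
  have hθe : ∀ z (h : z ∉ range c), θe z = Θ (1, ⟨z, h⟩) := fun z h => dif_pos h
  have hend : ∀ (z : ((range c)ᶜ : Set ℂ)), ∃ k : ℤ, Θ (1, z) = 5 * π / 4 + k * (2 * π) := by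
    intro z
    have h := hΘ 1 z
    have h1 : compactified c (1 - 2 * ((1 : I) : ℝ)) z = -(1 + Complex.I) := by
      norm_num [compactified]
    rw [h1] at h
    obtain ⟨hr, hi⟩ := re_im_of_polar h
    have hnorm : 0 < ‖-(1 + Complex.I)‖ := by
      rw [norm_pos_iff]; norm_num [Complex.ext_iff]
    set r := ‖-(1 + Complex.I)‖
    simp at hr hi
    have hcs : Real.cos (Θ (1, z) - 5 * π / 4) = 1 := by
      have e1 : 5 * π / 4 = π / 4 + π := by ring
      have hcs : Real.cos (Θ (1, z)) = Real.sin (Θ (1, z)) := by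
        have : r * Real.cos (Θ (1, z)) = r * Real.sin (Θ (1, z)) := by linarith
        exact mul_left_cancel₀ hnorm.ne' this
      have hneg : Real.sin (Θ (1, z)) < 0 := by
        by_contra hcon
        nlinarith [mul_nonneg hnorm.le (not_lt.1 hcon)]
      have hsq := Real.sin_sq_add_cos_sq (Θ (1, z))
      rw [hcs] at hsq
      rw [e1, Real.cos_sub, Real.cos_add_pi, Real.sin_add_pi, Real.cos_pi_div_four,
        Real.sin_pi_div_four, hcs]
      have h2 : √2 * √2 = 2 := Real.mul_self_sqrt (by norm_num)
      have h3 : (√2 * Real.sin (Θ (1, z)) + 1) * (√2 * Real.sin (Θ (1, z)) - 1) = 0 := by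
        linear_combination hsq + (Real.sin (Θ (1, z)))^2 * h2
      have h5 : √2 * Real.sin (Θ (1, z)) < 0 := mul_neg_of_pos_of_neg (by positivity) hneg
      rcases mul_eq_zero.1 h3 with h4 | h4
      · linarith
      · linarith
    obtain ⟨k, hk⟩ := (Real.cos_eq_one_iff _).1 hcs
    exact ⟨k, by linarith⟩
  refine ⟨θ, θe, ?_, ?_, ?_, ?_, ?_⟩
  · rw [continuousOn_iff_continuous_domRestrict]
    have : Continuous fun p : ((range c)ᶜ ×ˢ (univ : Set ℝ) : Set (ℂ × ℝ)) =>
        Θ (ρ p.1.2, ⟨p.1.1, p.2.1⟩) := by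
      refine Θ.continuous.comp ?_
      refine Continuous.prodMk (hρc.comp (by fun_prop)) ?_
      exact Continuous.subtype_mk (by fun_prop) _
    refine this.congr fun p => ?_
    exact (hθ p.1.1 p.2.1 p.1.2).symm
  · rw [continuousOn_iff_continuous_domRestrict]
    have : Continuous fun p : ((range c)ᶜ : Set ℂ) => Θ (1, p) := by fun_prop
    exact this.congr fun p => (hθe p.1 p.2).symm
  · intro z hz x
    have h := hΘ (ρ x) ⟨z, hz⟩
    rw [hρv, compactified_eq c (abs_div_one_add_abs_lt x), one_sub_abs_div_one_add_abs] at h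
    have e : x / (1 + |x|) / (1 / (1 + |x|)) = x := by
      have : 0 < 1 + |x| := by positivity
      field_simp
    rw [e, norm_mul, Complex.norm_real, Real.norm_eq_abs,
      abs_of_pos (by positivity : 0 < 1 / (1 + |x|)), ← hθ z hz] at h
    have h1 : ((1 / (1 + |x|) : ℝ) : ℂ) ≠ 0 := by
      exact_mod_cast (by positivity : 0 < 1 / (1 + |x|)).ne'
    apply mul_left_cancel₀ h1
    rw [h]; push_cast; ring
  · intro z hz
    rw [hθe z hz]; exact hend _
  · intro R
    have hC0 : 0 ≤ C := (norm_nonneg _).trans (hC 0)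
    set K := C + |R| with hK
    have hK0 : 0 ≤ K := by positivity
    refine ⟨K + 1, fun z hz hzR => ?_⟩
    have hzR' := hzR.trans (le_abs_self R)
    set zz : ((range c)ᶜ : Set ℂ) := ⟨z, hz⟩
    let f : ℝ → ℝ := fun s => Θ (projIcc 0 1 zero_le_one s, zz)
    have hf : Continuous f := by
      refine Θ.continuous.comp ?_
      exact Continuous.prodMk continuous_projIcc continuous_const
    have hpos : ∀ s ∈ Icc (0 : ℝ) 1, (1 - |1 - 2 * s|) * K < |1 - 2 * s| →
        0 < Real.sin (2 * f s) := by
      intro s hs hlt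
      have h := hΘ (projIcc 0 1 zero_le_one s) zz
      rw [projIcc_of_mem zero_le_one hs] at h
      have h2 : |1 - 2 * s| ≤ 1 := by rw [abs_le]; constructor <;> linarith [hs.1, hs.2]
      have := sin_two_mul_pos_of_polar h (compactified_re_im_pos hC hzR' h2 hlt)
      simpa [f, projIcc_of_mem zero_le_one hs] using this
    have hfθ : ∀ x, f (ρ x) = θ z x := by
      intro x
      rw [hθ z hz]; simp only [f, projIcc_val]; rfl
    constructor
    · intro x hx
      have hx0 : 0 < x := by linarith
      have hf0 : f 0 = π / 4 := by
        have : projIcc (0 : ℝ) 1 zero_le_one 0 = 0 := projIcc_left _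
        simp only [f, this]; exact hΘ0 _
      have h := abs_sub_lt_of_sin_pos (S := Icc 0 (ρ x : ℝ)) isPreconnected_Icc hf.continuousOn
        (fun s hs => ?_) (s₀ := 0) ⟨le_rfl, (ρ x).2.1⟩ ?_ (s := ρ x) ⟨(ρ x).2.1, le_rfl⟩
      · rwa [hf0, hfθ] at h
      · refine hpos s ⟨hs.1, hs.2.trans (ρ x).2.2⟩ ?_
        have h1 := hρv x
        rw [abs_of_pos hx0] at h1
        have h2 : (1 - x / (1 + x)) * (K + 1) < 1 := by
          have : 1 - x / (1 + x) = 1 / (1 + x) := by field_simp; ring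
          rw [this, one_div, inv_mul_lt_iff₀ (by linarith)]; linarith
        have h3 : 0 < x / (1 + x) := by positivity
        have h4 : x / (1 + x) ≤ 1 - 2 * s := by linarith [hs.2]
        rw [abs_of_pos (by linarith)]
        nlinarith
      · rw [hf0, show 2 * (π / 4) = π / 2 by ring, Real.sin_pi_div_two]
    · intro x hx
      have hx0 : x < 0 := by linarith
      have hf1 : f 1 = θe z := by
        have : projIcc (0 : ℝ) 1 zero_le_one 1 = 1 := projIcc_right _
        simp only [f, this]; exact (hθe z hz).symm
      have h := abs_sub_lt_of_sin_pos (S := Icc (ρ x : ℝ) 1) isPreconnected_Icc hf.continuousOn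
        (fun s hs => ?_) (s₀ := 1) ⟨(ρ x).2.2, le_rfl⟩ ?_ (s := ρ x) ⟨le_rfl, (ρ x).2.2⟩
      · rwa [hf1, hfθ] at h
      · refine hpos s ⟨(ρ x).2.1.trans hs.1, hs.2⟩ ?_
        have h1 := hρv x
        rw [abs_of_neg hx0] at h1
        have h2 : (1 + x / (1 + -x)) * (K + 1) < 1 := by
          have : 1 + x / (1 + -x) = 1 / (1 + -x) := by
            have : 1 + -x ≠ 0 := by linarith
            field_simp; ring
          rw [this, one_div, inv_mul_lt_iff₀ (by linarith)]; linarith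
        have h3 : x / (1 + -x) < 0 := div_neg_of_neg_of_pos hx0 (by linarith)
        have h4 : 1 - 2 * s ≤ x / (1 + -x) := by linarith [hs.1]
        rw [abs_of_neg (by linarith)]
        nlinarith
      · obtain ⟨k, hk⟩ := hend zz
        rw [hf1, hθe z hz, hk, show 2 * (5 * π / 4 + k * (2 * π)) =
          π / 2 + ((2 * k + 1 : ℤ) : ℝ) * (2 * π) by push_cast; ring, Real.sin_add_int_mul_two_pi,
          Real.sin_pi_div_two]

/-! ### The lifted billiard map -/

lemma det2_swap (u v : Plane) : det2 u v = -det2 v u := by simp only [det2]; ring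

lemma det2_smul_left (r : ℝ) (u v : Plane) : det2 (r • u) v = r * det2 u v := by
  simp only [det2, PiLp.smul_apply, smul_eq_mul]; ring

lemma coe_two_pi : ((2 * π : ℝ) : Circ) = 0 := AddCircle.coe_period _

lemma coe_add_two_pi (x : ℝ) : ((x + 2 * π : ℝ) : Circ) = (x : Circ) := by
  rw [AddCircle.coe_add, coe_two_pi, add_zero]

namespace Table

variable (B : Table)

/-- The boundary parametrization lifted to the line. -/
def pos (x : ℝ) : Plane := B.γ (x : Circ)

/-- The velocity of the boundary parametrization lifted to the line. -/
def vel (x : ℝ) : Plane := velocity B.γ (x : Circ)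

/-- The height `det (γ' y, γ u)` of the boundary point `γ u` over the tangent direction at `γ y`. -/
def height (y u : ℝ) : ℝ := det2 (B.vel y) (B.pos u)

/-- The density `det (γ' x, γ' y)` of the invariant area form in the coordinates `(x, y)`. -/
def density (x y : ℝ) : ℝ := det2 (B.vel x) (B.vel y)

/-- The phase space lifted to the plane: the pairs `(x, y)` with `x < y < x*`. -/
def strip : Set (ℝ × ℝ) := {p | p.1 < p.2 ∧ p.2 < p.1 + 2 * π ∧ 0 < B.density p.1 p.2}

lemma pos_add_two_pi (x : ℝ) : B.pos (x + 2 * π) = B.pos x := by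
  simp only [pos, coe_add_two_pi]

lemma vel_add_two_pi (x : ℝ) : B.vel (x + 2 * π) = B.vel x := by
  simp only [vel, coe_add_two_pi]

lemma contDiff_vel : ContDiff ℝ 1 B.vel := by
  have h : B.vel = deriv (fun y : ℝ => B.γ (y : Circ)) := by
    funext x; exact velocity_coe _ _
  rw [h]
  exact (contDiff_succ_iff_deriv (n := 1)).1 (by simpa [one_add_one_eq_two] using B.contDiff) |>.2.2

lemma continuous_vel : Continuous B.vel := B.contDiff_vel.continuous

lemma continuous_pos : Continuous B.pos := B.contDiff.continuous

lemma continuous_height : Continuous fun p : ℝ × ℝ => B.height p.1 p.2 := by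
  have h1 := B.continuous_vel
  have h2 := B.continuous_pos
  unfold height det2; fun_prop

lemma continuous_density : Continuous fun p : ℝ × ℝ => B.density p.1 p.2 := by
  have h1 := B.continuous_vel
  unfold density det2; fun_prop

lemma density_swap (x y : ℝ) : B.density x y = -B.density y x := det2_swap _ _

lemma height_add_two_pi (y u : ℝ) : B.height y (u + 2 * π) = B.height y u := by
  simp only [height, pos_add_two_pi]

lemma height_sub_two_pi (y u : ℝ) : B.height y (u - 2 * π) = B.height y u := by
  have := B.height_add_two_pi y (u - 2 * π)
  rwa [sub_add_cancel, eq_comm] at this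

lemma density_add_two_pi (x y : ℝ) : B.density x (y + 2 * π) = B.density x y := by
  simp only [density, vel_add_two_pi]

lemma density_add_two_pi_left (x y : ℝ) : B.density (x + 2 * π) y = B.density x y := by
  simp only [density, vel_add_two_pi]

lemma hasDerivAt_height (y u : ℝ) : HasDerivAt (B.height y) (B.density y u) u :=
  B.hasDerivAt_det2 (B.vel y) u

lemma continuous_height_right (y : ℝ) : Continuous (B.height y) :=
  continuous_iff_continuousAt.2 fun u => (B.hasDerivAt_height y u).continuousAt

lemma exists_opp (x : ℝ) :
    ∃ S : ℝ, B.IsOpposite (x : Circ) (S : Circ) ∧ x < S ∧ S < x + 2 * π := by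
  obtain ⟨u, hu⟩ := B.exists_opposite (x : Circ)
  obtain ⟨S, rfl, h⟩ := exists_lift x hu.1
  exact ⟨S, hu, h⟩

/-- The lift in `(x, x + 2π)` of the parameter opposite to `x`. -/
def opp (x : ℝ) : ℝ := (B.exists_opp x).choose

lemma isOpposite_opp (x : ℝ) : B.IsOpposite (x : Circ) (B.opp x : Circ) :=
  (B.exists_opp x).choose_spec.1

lemma lt_opp (x : ℝ) : x < B.opp x := (B.exists_opp x).choose_spec.2.1

lemma opp_lt (x : ℝ) : B.opp x < x + 2 * π := (B.exists_opp x).choose_spec.2.2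

lemma density_opp (x : ℝ) : B.density x (B.opp x) = 0 := (B.isOpposite_opp x).2

lemma density_pos {x y : ℝ} (h1 : x < y) (h2 : y < B.opp x) : 0 < B.density x y :=
  B.det2_velocity_pos (B.isOpposite_opp x) (B.lt_opp x) (B.opp_lt x) ⟨h1, h2⟩

/-- Beyond the opposite parameter the tangent has turned by more than a half-turn. -/
lemma density_neg {x y : ℝ} (h1 : B.opp x < y) (h2 : y < x + 2 * π) : B.density x y < 0 := by
  have ho := B.isOpposite_opp x
  obtain ⟨c, hc, hcv⟩ := B.opposite_smul ho
  have ho' : B.IsOpposite (B.opp x : Circ) ((x + 2 * π : ℝ) : Circ) := by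
    rw [coe_add_two_pi]
    exact ⟨ho.1.symm, by rw [det2_swap, ho.2, neg_zero]⟩
  have h := B.det2_velocity_pos ho' (B.opp_lt x) (by linarith [B.lt_opp x]) ⟨h1, h2⟩
  rw [hcv, det2_smul_left] at h
  exact neg_of_mul_pos_right h hc.le

lemma mem_strip {x y : ℝ} : (x, y) ∈ B.strip ↔ x < y ∧ y < B.opp x := by
  constructor
  · rintro ⟨h1, h2, h3⟩
    refine ⟨h1, ?_⟩
    by_contra hcon
    rcases (not_lt.1 hcon).eq_or_lt with h | h
    · simp only [← h, density_opp, lt_self_iff_false] at h3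
    · have := B.density_neg h h2
      simp only at h3; linarith
  · rintro ⟨h1, h2⟩
    exact ⟨h1, h2.trans (B.opp_lt x), B.density_pos h1 h2⟩

/-- The strip described by the second coordinate; `opp y - 2 * π` is the lift of `y*` below `y`. -/
lemma mem_strip' {x y : ℝ} : (x, y) ∈ B.strip ↔ B.opp y - 2 * π < x ∧ x < y := by
  constructor
  · rintro ⟨h1, h2, h3⟩
    simp only at h1 h2 h3
    refine ⟨?_, h1⟩
    by_contra hcon
    have h4 : B.density y (x + 2 * π) < 0 := by
      rw [density_add_two_pi, density_swap]; linarith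
    rcases (show x + 2 * π ≤ B.opp y by linarith).eq_or_lt with h | h
    · rw [h, density_opp] at h4; linarith
    · linarith [B.density_pos h2 h]
  · rintro ⟨h1, h2⟩
    have h3 := B.density_neg (x := y) (y := x + 2 * π) (by linarith) (by linarith)
    rw [density_add_two_pi, density_swap] at h3
    exact ⟨h2, by linarith [B.lt_opp y], by simp only; linarith⟩

lemma isOpen_strip : IsOpen B.strip := by
  have h := B.continuous_density
  exact (isOpen_lt continuous_fst continuous_snd).inter
    ((isOpen_lt continuous_snd (by fun_prop)).inter (isOpen_lt continuous_const h))

lemma continuous_opp : Continuous B.opp := by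
  have hd := B.continuous_density
  refine continuous_iff_continuousAt.2 fun x₀ => ?_
  rw [ContinuousAt, tendsto_order]
  have h0 := B.lt_opp x₀
  have h1 := B.opp_lt x₀
  constructor
  · intro a ha
    obtain ⟨b, hb, hb'⟩ := exists_between (max_lt ha h0)
    have hb1 := (le_max_left _ _).trans_lt hb
    have hb2 := (le_max_right _ _).trans_lt hb
    have hpos := B.density_pos hb2 hb'
    have e1 : ∀ᶠ x in nhds x₀, 0 < B.density x b :=
      (hd.comp (by fun_prop : Continuous fun x : ℝ => (x, b))).continuousAt.eventually
        (lt_mem_nhds hpos)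
    filter_upwards [e1, gt_mem_nhds hb2, lt_mem_nhds (show b - 2 * π < x₀ by linarith)]
      with x hx1 hx2 hx3
    have : (x, b) ∈ B.strip := ⟨hx2, by linarith, hx1⟩
    exact hb1.trans (B.mem_strip.1 this).2
  · intro a ha
    obtain ⟨b, hb, hb'⟩ := exists_between (lt_min ha h1)
    have hb1 := hb'.trans_le (min_le_left _ _)
    have hb2 := hb'.trans_le (min_le_right _ _)
    have hneg := B.density_neg hb hb2
    have e1 : ∀ᶠ x in nhds x₀, B.density x b < 0 :=
      (hd.comp (by fun_prop : Continuous fun x : ℝ => (x, b))).continuousAt.eventually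
        (gt_mem_nhds hneg)
    filter_upwards [e1, gt_mem_nhds (h0.trans hb)] with x hx1 hx2
    refine lt_of_le_of_lt ?_ hb1
    by_contra hcon
    have := B.density_pos hx2 (not_le.1 hcon)
    linarith

lemma strictMonoOn_height (y : ℝ) : StrictMonoOn (B.height y) (Icc y (B.opp y)) := by
  refine strictMonoOn_of_deriv_pos (convex_Icc _ _) (B.continuous_height_right y).continuousOn
    fun u hu => ?_
  rw [interior_Icc] at hu
  rw [(B.hasDerivAt_height y u).deriv]
  exact B.density_pos hu.1 hu.2

lemma strictAntiOn_height (y : ℝ) : StrictAntiOn (B.height y) (Icc (B.opp y - 2 * π) y) := by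
  refine strictAntiOn_of_deriv_neg (convex_Icc _ _) (B.continuous_height_right y).continuousOn
    fun u hu => ?_
  rw [interior_Icc] at hu
  rw [(B.hasDerivAt_height y u).deriv, ← density_add_two_pi]
  exact B.density_neg (by linarith [hu.1]) (by linarith [hu.2])

lemma height_lt_of_lt {y u v : ℝ} (hu : (y, u) ∈ B.strip) (hv : (y, v) ∈ B.strip) :
    B.height y u < B.height y v ↔ u < v := by
  rw [mem_strip] at hu hv
  exact (B.strictMonoOn_height y).lt_iff_lt ⟨hu.1.le, hu.2.le⟩ ⟨hv.1.le, hv.2.le⟩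

lemma height_lt_of_gt {y u v : ℝ} (hu : (u, y) ∈ B.strip) (hv : (v, y) ∈ B.strip) :
    B.height y u < B.height y v ↔ v < u := by
  rw [mem_strip'] at hu hv
  exact (B.strictAntiOn_height y).lt_iff_gt ⟨hu.1.le, hu.2.le⟩ ⟨hv.1.le, hv.2.le⟩

lemma exists_next {x y : ℝ} (h : (x, y) ∈ B.strip) :
    ∃ z, (y, z) ∈ B.strip ∧ B.height y z = B.height y x := by
  rw [mem_strip'] at h
  have ho := B.opp_lt y
  have hl := B.lt_opp y
  have h1 : B.height y y < B.height y x :=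
    B.strictAntiOn_height y ⟨h.1.le, h.2.le⟩ ⟨by linarith, le_rfl⟩ h.2
  have h2 : B.height y x < B.height y (B.opp y) := by
    rw [← B.height_sub_two_pi y (B.opp y)]
    exact B.strictAntiOn_height y ⟨le_rfl, by linarith⟩ ⟨h.1.le, h.2.le⟩ h.1
  obtain ⟨z, hz, hze⟩ := intermediate_value_Ioo hl.le
    (B.continuous_height_right y).continuousOn ⟨h1, h2⟩
  exact ⟨z, B.mem_strip.2 hz, hze⟩

lemma exists_prev {y z : ℝ} (h : (y, z) ∈ B.strip) :
    ∃ x, (x, y) ∈ B.strip ∧ B.height y x = B.height y z := by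
  rw [mem_strip] at h
  have ho := B.opp_lt y
  have hl := B.lt_opp y
  have h1 : B.height y y < B.height y z :=
    B.strictMonoOn_height y ⟨le_rfl, hl.le⟩ ⟨h.1.le, h.2.le⟩ h.1
  have h2 : B.height y z < B.height y (B.opp y - 2 * π) := by
    rw [height_sub_two_pi]
    exact B.strictMonoOn_height y ⟨h.1.le, h.2.le⟩ ⟨hl.le, le_rfl⟩ h.2
  obtain ⟨x, hx, hxe⟩ := intermediate_value_Ioo' (by linarith)
    (B.continuous_height_right y).continuousOn ⟨h1, h2⟩
  exact ⟨x, B.mem_strip'.2 hx, hxe⟩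

open Classical in
/-- The parameter of the bounce after `(x, y)`; a junk value off the strip. -/
def next (p : ℝ × ℝ) : ℝ := if h : (p.1, p.2) ∈ B.strip then (B.exists_next h).choose else 0

open Classical in
/-- The parameter of the bounce before `(y, z)`; a junk value off the strip. -/
def prev (p : ℝ × ℝ) : ℝ := if h : (p.1, p.2) ∈ B.strip then (B.exists_prev h).choose else 0

lemma next_mem {p : ℝ × ℝ} (h : p ∈ B.strip) : (p.2, B.next p) ∈ B.strip := by
  rw [next, dif_pos h]; exact (B.exists_next h).choose_spec.1

lemma height_next {p : ℝ × ℝ} (h : p ∈ B.strip) :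
    B.height p.2 (B.next p) = B.height p.2 p.1 := by
  rw [next, dif_pos h]; exact (B.exists_next h).choose_spec.2

lemma prev_mem {p : ℝ × ℝ} (h : p ∈ B.strip) : (B.prev p, p.1) ∈ B.strip := by
  rw [prev, dif_pos h]; exact (B.exists_prev h).choose_spec.1

lemma height_prev {p : ℝ × ℝ} (h : p ∈ B.strip) :
    B.height p.1 (B.prev p) = B.height p.1 p.2 := by
  rw [prev, dif_pos h]; exact (B.exists_prev h).choose_spec.2

lemma eq_of_height_eq {y u v : ℝ} (hu : (y, u) ∈ B.strip) (hv : (y, v) ∈ B.strip)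
    (h : B.height y u = B.height y v) : u = v := by
  have h1 := B.height_lt_of_lt hu hv
  have h2 := B.height_lt_of_lt hv hu
  by_contra hne
  rcases lt_or_gt_of_ne hne with hlt | hlt
  · linarith [h1.2 hlt]
  · linarith [h2.2 hlt]

lemma eq_of_height_eq' {y u v : ℝ} (hu : (u, y) ∈ B.strip) (hv : (v, y) ∈ B.strip)
    (h : B.height y u = B.height y v) : u = v := by
  have h1 := B.height_lt_of_gt hu hv
  have h2 := B.height_lt_of_gt hv hu
  by_contra hne
  rcases lt_or_gt_of_ne hne with hlt | hlt
  · linarith [h2.2 hlt]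
  · linarith [h1.2 hlt]

/-- The billiard map on the strip. -/
def step (p : ℝ × ℝ) : ℝ × ℝ := (p.2, B.next p)

/-- The inverse of the billiard map on the strip. -/
def stepInv (p : ℝ × ℝ) : ℝ × ℝ := (B.prev p, p.1)

lemma step_mem {p : ℝ × ℝ} (h : p ∈ B.strip) : B.step p ∈ B.strip := B.next_mem h

lemma stepInv_mem {p : ℝ × ℝ} (h : p ∈ B.strip) : B.stepInv p ∈ B.strip := B.prev_mem h

lemma stepInv_step {p : ℝ × ℝ} (h : p ∈ B.strip) : B.stepInv (B.step p) = p := by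
  refine Prod.ext ?_ rfl
  refine B.eq_of_height_eq' (y := p.2) (B.stepInv_mem (B.step_mem h)) h ?_
  have := B.height_prev (B.step_mem h)
  simp only [step] at this
  rw [B.height_next h] at this
  exact this

lemma step_stepInv {p : ℝ × ℝ} (h : p ∈ B.strip) : B.step (B.stepInv p) = p := by
  refine Prod.ext rfl ?_
  refine B.eq_of_height_eq (y := p.1) (B.step_mem (B.stepInv_mem h)) h ?_
  have := B.height_next (B.stepInv_mem h)
  simp only [stepInv] at this
  rw [B.height_prev h] at this
  exact this

/-- The second coordinate of a point of the strip depends continuously on the first one and on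
the height. -/
lemma tendsto_of_height {ι : Type*} {l : Filter ι} {a Y : ι → ℝ} {y₀ Y₀ : ℝ}
    (ha : Filter.Tendsto a l (nhds y₀)) (hY : ∀ᶠ i in l, (a i, Y i) ∈ B.strip)
    (h₀ : (y₀, Y₀) ∈ B.strip)
    (hh : Filter.Tendsto (fun i => B.height (a i) (Y i)) l (nhds (B.height y₀ Y₀))) :
    Filter.Tendsto Y l (nhds Y₀) := by
  rw [tendsto_order]
  have hopen := B.isOpen_strip
  have hcy : Continuous fun b : ℝ => (y₀, b) := by fun_prop
  have hnear : ∀ᶠ b in nhds Y₀, (y₀, b) ∈ B.strip :=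
    hcy.continuousAt.eventually (hopen.mem_nhds h₀)
  have hstr : ∀ b, (y₀, b) ∈ B.strip → ∀ᶠ i in l, (a i, b) ∈ B.strip := by
    intro b hb
    have hc : Continuous fun y : ℝ => (y, b) := by fun_prop
    exact ha.eventually (hc.continuousAt.eventually (hopen.mem_nhds hb))
  have hc1 : ∀ b, Filter.Tendsto (fun i => B.height (a i) b) l (nhds (B.height y₀ b)) := fun b =>
    ((B.continuous_height.comp (by fun_prop : Continuous fun y : ℝ => (y, b))).tendsto y₀).comp ha
  constructor
  · intro r hr
    obtain ⟨b, hb, hb'⟩ := ((hnear.filter_mono nhdsWithin_le_nhds).and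
      (Ioo_mem_nhdsLT hr)).exists (f := nhdsWithin Y₀ (Iio Y₀))
    have hlt := (B.height_lt_of_lt hb h₀).2 hb'.2
    filter_upwards [hstr b hb, (hc1 b).eventually_lt hh hlt, hY] with i h1 h2 h3
    exact hb'.1.trans ((B.height_lt_of_lt h1 h3).1 h2)
  · intro r hr
    obtain ⟨b, hb, hb'⟩ := ((hnear.filter_mono nhdsWithin_le_nhds).and
      (Ioo_mem_nhdsGT hr)).exists (f := nhdsWithin Y₀ (Ioi Y₀))
    have hlt := (B.height_lt_of_lt h₀ hb).2 hb'.1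
    filter_upwards [hstr b hb, hh.eventually_lt (hc1 b) hlt, hY] with i h1 h2 h3
    exact ((B.height_lt_of_lt h3 h1).1 h2).trans hb'.2

lemma continuousOn_next : ContinuousOn B.next B.strip := by
  intro p₀ hp₀
  have hs : ∀ᶠ p in nhdsWithin p₀ B.strip, p ∈ B.strip := self_mem_nhdsWithin
  refine B.tendsto_of_height (a := fun p => p.2)
    (continuous_snd.continuousAt.mono_left nhdsWithin_le_nhds)
    (hs.mono fun p hp => B.next_mem hp) (B.next_mem hp₀) ?_
  rw [B.height_next hp₀]
  have hc2 : Continuous fun p : ℝ × ℝ => B.height p.2 p.1 :=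
    B.continuous_height.comp (by fun_prop : Continuous fun p : ℝ × ℝ => (p.2, p.1))
  exact ((hc2.tendsto p₀).mono_left nhdsWithin_le_nhds).congr'
    (hs.mono fun p hp => (B.height_next hp).symm)

lemma continuousOn_prev : ContinuousOn B.prev B.strip := by
  intro p₀ hp₀
  have hq := B.continuous_height
  rw [ContinuousWithinAt, tendsto_order]
  have hz := B.prev_mem hp₀
  have hopen := B.isOpen_strip
  have hcy : Continuous fun b : ℝ => (b, p₀.1) := by fun_prop
  have hnear : ∀ᶠ b in nhds (B.prev p₀), (b, p₀.1) ∈ B.strip :=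
    hcy.continuousAt.eventually (hopen.mem_nhds hz)
  have hstr : ∀ b, (b, p₀.1) ∈ B.strip → ∀ᶠ p in nhdsWithin p₀ B.strip, (b, p.1) ∈ B.strip := by
    intro b hb
    have hc : Continuous fun p : ℝ × ℝ => (b, p.1) := by fun_prop
    exact (hc.continuousAt.eventually (hopen.mem_nhds hb)).filter_mono nhdsWithin_le_nhds
  have hc1 : ∀ b, Continuous fun p : ℝ × ℝ => B.height p.1 b := fun b =>
    hq.comp (by fun_prop : Continuous fun p : ℝ × ℝ => (p.1, b))
  constructor
  · intro a ha
    obtain ⟨b, hb, hb'⟩ := ((hnear.filter_mono nhdsWithin_le_nhds).and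
      (Ioo_mem_nhdsLT ha)).exists (f := nhdsWithin (B.prev p₀) (Iio (B.prev p₀)))
    have hlt := (B.height_lt_of_gt hz hb).2 hb'.2
    rw [B.height_prev hp₀] at hlt
    have hev := ((isOpen_lt hq (hc1 b)).mem_nhds hlt)
    filter_upwards [hstr b hb, mem_nhdsWithin_of_mem_nhds hev, self_mem_nhdsWithin]
      with p h1 h2 h3
    change B.height p.1 p.2 < B.height p.1 b at h2
    rw [← B.height_prev h3, B.height_lt_of_gt (B.prev_mem h3) h1] at h2
    exact hb'.1.trans h2
  · intro a ha
    obtain ⟨b, hb, hb'⟩ := ((hnear.filter_mono nhdsWithin_le_nhds).and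
      (Ioo_mem_nhdsGT ha)).exists (f := nhdsWithin (B.prev p₀) (Ioi (B.prev p₀)))
    have hlt := (B.height_lt_of_gt hb hz).2 hb'.1
    rw [B.height_prev hp₀] at hlt
    have hev := ((isOpen_lt (hc1 b) hq).mem_nhds hlt)
    filter_upwards [hstr b hb, mem_nhdsWithin_of_mem_nhds hev, self_mem_nhdsWithin]
      with p h1 h2 h3
    change B.height p.1 b < B.height p.1 p.2 at h2
    rw [← B.height_prev h3, B.height_lt_of_gt h1 (B.prev_mem h3)] at h2
    exact h2.trans hb'.2

lemma continuousOn_step : ContinuousOn B.step B.strip :=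
  continuous_snd.continuousOn.prodMk B.continuousOn_next

lemma continuousOn_stepInv : ContinuousOn B.stepInv B.strip :=
  B.continuousOn_prev.prodMk continuous_fst.continuousOn

open MeasureTheory

/-! ### Preservation of area -/

/-- The area density as a nonnegative extended real. -/
def areaDensity (p : ℝ × ℝ) : ENNReal := ENNReal.ofReal (B.density p.1 p.2)

lemma measurable_areaDensity : Measurable B.areaDensity :=
  B.continuous_density.measurable.ennreal_ofReal

lemma isOpen_image_step {E : Set (ℝ × ℝ)} (hE : IsOpen E) (hs : E ⊆ B.strip) :
    IsOpen (B.step '' E) := by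
  have : B.step '' E = B.strip ∩ B.stepInv ⁻¹' E := by
    ext p
    constructor
    · rintro ⟨p, hp, rfl⟩
      exact ⟨B.step_mem (hs hp), by rwa [mem_preimage, B.stepInv_step (hs hp)]⟩
    · rintro ⟨h1, h2⟩
      exact ⟨_, h2, B.step_stepInv h1⟩
  rw [this]
  exact B.continuousOn_stepInv.isOpen_inter_preimage B.isOpen_strip hE

lemma isOpen_image_stepInv {E : Set (ℝ × ℝ)} (hE : IsOpen E) (hs : E ⊆ B.strip) :
    IsOpen (B.stepInv '' E) := by
  have : B.stepInv '' E = B.strip ∩ B.step ⁻¹' E := by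
    ext p
    constructor
    · rintro ⟨p, hp, rfl⟩
      exact ⟨B.stepInv_mem (hs hp), by rwa [mem_preimage, B.step_stepInv (hs hp)]⟩
    · rintro ⟨h1, h2⟩
      exact ⟨_, h2, B.stepInv_step h1⟩
  rw [this]
  exact B.continuousOn_step.isOpen_inter_preimage B.isOpen_strip hE

/-- The billiard map takes the points with second coordinate `y` to those with first coordinate `y`
and preserves the mass on these fibers: both sides are the length of the common image
under the height `det (γ' y, γ ·)`, whose derivative is the density up to sign. -/
lemma lintegral_fiber_step {E : Set (ℝ × ℝ)} (hE : IsOpen E) (hs : E ⊆ B.strip) (y : ℝ) :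
    ∫⁻ z in {z | (y, z) ∈ B.step '' E}, B.areaDensity (y, z) =
      ∫⁻ x in {x | (x, y) ∈ E}, B.areaDensity (x, y) := by
  have hs' : B.step '' E ⊆ B.strip := by
    rintro _ ⟨p, hp, rfl⟩; exact B.step_mem (hs hp)
  have hm1 : MeasurableSet {z | (y, z) ∈ B.step '' E} :=
    ((B.isOpen_image_step hE hs).preimage
      (by fun_prop : Continuous fun z : ℝ => (y, z))).measurableSet
  have hm2 : MeasurableSet {x | (x, y) ∈ E} :=
    (hE.preimage (by fun_prop : Continuous fun x : ℝ => (x, y))).measurableSet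
  have h1 := lintegral_image_eq_lintegral_abs_deriv_mul (f := B.height y) (f' := B.density y) hm1
    (fun z _ => (B.hasDerivAt_height y z).hasDerivWithinAt)
    (fun u hu v hv h => B.eq_of_height_eq (hs' hu) (hs' hv) h) 1
  have h2 := lintegral_image_eq_lintegral_abs_deriv_mul (f := B.height y) (f' := B.density y) hm2
    (fun z _ => (B.hasDerivAt_height y z).hasDerivWithinAt)
    (fun u hu v hv h => B.eq_of_height_eq' (hs hu) (hs hv) h) 1
  have himg : B.height y '' {z | (y, z) ∈ B.step '' E} = B.height y '' {x | (x, y) ∈ E} := by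
    ext r
    constructor
    · rintro ⟨z, ⟨⟨x, y'⟩, hp, hpe⟩, rfl⟩
      obtain ⟨rfl, rfl⟩ := Prod.mk.inj hpe
      exact ⟨x, hp, (B.height_next (hs hp)).symm⟩
    · rintro ⟨x, hp, rfl⟩
      exact ⟨B.next (x, y), ⟨_, hp, rfl⟩, B.height_next (hs hp)⟩
  rw [himg] at h1
  rw [h1] at h2
  calc _ = ∫⁻ z in {z | (y, z) ∈ B.step '' E}, ENNReal.ofReal |B.density y z| *
        (1 : ℝ → ENNReal) (B.height y z) := by
        refine setLIntegral_congr_fun hm1 fun z hz => ?_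
        have := (hs' hz).2.2
        simp only at this
        simp [areaDensity, abs_of_pos this]
    _ = _ := h2
    _ = _ := by
        refine setLIntegral_congr_fun hm2 fun z hz => ?_
        have := (hs hz).2.2
        simp only at this
        simp [areaDensity, B.density_swap y z, abs_of_pos this]

/-- The area of the part of `E` with first coordinate in `[0, P)`. -/
def area (P : ℝ) (E : Set (ℝ × ℝ)) : ENNReal :=
  ∫⁻ p in E ∩ {p | p.1 ∈ Ico 0 P}, B.areaDensity p

/-- The area can be computed with the second coordinate in the fundamental interval. -/
lemma area_eq_snd {P : ℝ} (hP : 2 * π ≤ P) {E : Set (ℝ × ℝ)}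
    (hs : E ⊆ B.strip) (hper : ∀ x y, (x + P, y + P) ∈ E ↔ (x, y) ∈ E)
    (hd : ∀ x y, B.density (x + P) (y + P) = B.density x y) (hE : IsOpen E) :
    B.area P E = ∫⁻ p in E ∩ {p | p.2 ∈ Ico 0 P}, B.areaDensity p := by
  have hm1 : MeasurableSet {p : ℝ × ℝ | p.2 < P} := measurableSet_lt measurable_snd measurable_const
  have hm2 : MeasurableSet {p : ℝ × ℝ | 0 ≤ p.1} := measurableSet_le measurable_const measurable_fst
  unfold area
  rw [← lintegral_inter_add_sdiff _ _ hm1,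
    ← lintegral_inter_add_sdiff _ (E ∩ {p | p.2 ∈ Ico 0 P}) hm2]
  have hb : ∀ {x y}, (x, y) ∈ E → x < y ∧ y < x + P := fun h =>
    ⟨(hs h).1, (hs h).2.1.trans_le (by simpa using hP)⟩
  congr 1
  · congr 2
    ext ⟨x, y⟩
    simp only [mem_inter_iff, mem_ofPred_eq, mem_Ico]
    constructor
    · rintro ⟨⟨h, h1, h2⟩, h3⟩
      exact ⟨⟨h, by linarith [hb h], h3⟩, h1⟩
    · rintro ⟨⟨h, h1, h2⟩, h3⟩
      exact ⟨⟨h, h3, by linarith [hb h]⟩, h2⟩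
  · rw [← lintegral_indicator, ← lintegral_indicator,
      ← lintegral_add_right_eq_self _ ((P, P) : ℝ × ℝ)]
    · congr 1
      ext ⟨x, y⟩
      have hiff : (x, y) + (P, P) ∈ (E ∩ {p | p.1 ∈ Ico 0 P}) \ {p : ℝ × ℝ | p.2 < P} ↔
          (x, y) ∈ (E ∩ {p | p.2 ∈ Ico 0 P}) \ {p : ℝ × ℝ | 0 ≤ p.1} := by
        simp only [mem_sdiff, mem_inter_iff, mem_ofPred_eq, mem_Ico, Prod.mk_add_mk, hper,
          not_lt, not_le]
        constructor
        · rintro ⟨⟨h, h1, h2⟩, h3⟩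
          exact ⟨⟨h, by linarith, by linarith [hb h]⟩, by linarith⟩
        · rintro ⟨⟨h, h1, h2⟩, h3⟩
          exact ⟨⟨h, by linarith [hb h], by linarith⟩, by linarith⟩
      by_cases h : (x, y) ∈ (E ∩ {p | p.2 ∈ Ico 0 P}) \ {p : ℝ × ℝ | 0 ≤ p.1}
      · rw [indicator_of_mem h, indicator_of_mem (hiff.2 h)]
        simp [areaDensity, hd]
      · rw [indicator_of_notMem h, indicator_of_notMem (fun h' => h (hiff.1 h'))]
    · exact (hE.measurableSet.inter (measurable_snd measurableSet_Ico)).diff hm2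
    · exact (hE.measurableSet.inter (measurable_fst measurableSet_Ico)).diff hm1

/-- The billiard map preserves the area, by Fubini and the preservation of mass on the fibers. -/
theorem area_image_step {P : ℝ} (hP : 2 * π ≤ P) {E : Set (ℝ × ℝ)}
    (hs : E ⊆ B.strip) (hper : ∀ x y, (x + P, y + P) ∈ E ↔ (x, y) ∈ E)
    (hd : ∀ x y, B.density (x + P) (y + P) = B.density x y) (hE : IsOpen E) :
    B.area P (B.step '' E) = B.area P E := by
  have hE' := B.isOpen_image_step hE hs
  have hm1 : MeasurableSet (B.step '' E ∩ {p | p.1 ∈ Ico 0 P}) :=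
    hE'.measurableSet.inter (measurable_fst measurableSet_Ico)
  have hm2 : MeasurableSet (E ∩ {p | p.2 ∈ Ico 0 P}) :=
    hE.measurableSet.inter (measurable_snd measurableSet_Ico)
  rw [B.area_eq_snd hP hs hper hd hE]
  unfold area
  rw [← lintegral_indicator hm1, ← lintegral_indicator hm2, Measure.volume_eq_prod,
    lintegral_prod _ ((B.measurable_areaDensity.indicator hm1).aemeasurable),
    lintegral_prod_symm _ ((B.measurable_areaDensity.indicator hm2).aemeasurable)]
  congr 1
  ext y
  have hind : ∀ (p : ℝ × ℝ) (S D : Set (ℝ × ℝ)), p ∈ D →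
      (S ∩ D).indicator B.areaDensity p = S.indicator B.areaDensity p := by
    intro p S D hp
    by_cases h : p ∈ S
    · rw [indicator_of_mem h, indicator_of_mem (show p ∈ S ∩ D from ⟨h, hp⟩)]
    · rw [indicator_of_notMem h, indicator_of_notMem fun h' => h h'.1]
  by_cases hy : y ∈ Ico 0 P
  · have h := B.lintegral_fiber_step hE hs y
    rw [← lintegral_indicator, ← lintegral_indicator] at h
    · refine (lintegral_congr fun z => ?_).trans (h.trans (lintegral_congr fun x => ?_))
      · exact hind _ _ _ hy
      · exact (hind _ _ _ hy).symm
    · exact (hE.preimage (by fun_prop : Continuous fun x : ℝ => (x, y))).measurableSet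
    · exact (hE'.preimage (by fun_prop : Continuous fun z : ℝ => (y, z))).measurableSet
  · have e1 : ∀ z, (B.step '' E ∩ {p | p.1 ∈ Ico 0 P}).indicator B.areaDensity (y, z) = 0 :=
      fun z => indicator_of_notMem (fun h => hy h.2) _
    have e2 : ∀ z, (E ∩ {p | p.2 ∈ Ico 0 P}).indicator B.areaDensity (z, y) = 0 :=
      fun z => indicator_of_notMem (fun h => hy h.2) _
    simp only [e1, e2]

lemma area_lt_top {P : ℝ} (hP : 2 * π ≤ P) {E : Set (ℝ × ℝ)} (hs : E ⊆ B.strip) :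
    B.area P E < ⊤ := by
  have hsub : E ∩ {p | p.1 ∈ Ico 0 P} ⊆ Icc 0 P ×ˢ Icc 0 (2 * P) := by
    rintro ⟨x, y⟩ ⟨h, h1, h2⟩
    have := hs h
    obtain ⟨h3, h4, -⟩ := this
    simp only at h1 h2 h3 h4
    exact ⟨⟨h1, h2.le⟩, by linarith, by linarith⟩
  have hint : IntegrableOn (fun p : ℝ × ℝ => B.density p.1 p.2) (Icc 0 P ×ˢ Icc 0 (2 * P)) :=
    B.continuous_density.continuousOn.integrableOn_compact (isCompact_Icc.prod isCompact_Icc)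
  exact (lintegral_mono_set hsub).trans_lt hint.lintegral_lt_top

/-- An open subset of `E` disjoint from a subset of the same finite area is empty. -/
lemma eq_empty_of_area_eq {P : ℝ} (hP : 2 * π ≤ P) {A E W : Set (ℝ × ℝ)} (hAE : A ⊆ E)
    (hs : E ⊆ B.strip) (hperA : ∀ x y, (x + P, y + P) ∈ A ↔ (x, y) ∈ A)
    (hperE : ∀ x y, (x + P, y + P) ∈ E ↔ (x, y) ∈ E)
    (hA : IsOpen A) (hW : IsOpen W) (hWE : W ⊆ E) (hWA : Disjoint W A)
    (harea : B.area P A = B.area P E) : W = ∅ := by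
  have hP0 : 0 < P := by linarith [Real.two_pi_pos]
  have hshift : ∀ {S : Set (ℝ × ℝ)}, (∀ x y, (x + P, y + P) ∈ S ↔ (x, y) ∈ S) → ∀ (n : ℤ) x y,
      (x + n * P, y + n * P) ∈ S ↔ (x, y) ∈ S := by
    intro S hS n
    induction n using Int.induction_on with
    | zero => simp
    | succ n ih =>
      intro x y
      have e : ∀ t : ℝ, t + ((n + 1 : ℤ) : ℝ) * P = t + (n : ℤ) * P + P := fun t => by
        push_cast; ring
      rw [e, e, hS, ih]
    | pred n ih =>
      intro x y
      have e : ∀ t : ℝ, t + ((-n - 1 : ℤ) : ℝ) * P + P = t + (-n : ℤ) * P := fun t => by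
        push_cast; ring
      rw [← hS, e, e, ih]
  by_contra hne
  obtain ⟨⟨x, y⟩, hp⟩ := nonempty_iff_ne_empty.2 hne
  obtain ⟨n, hn, -⟩ := existsUnique_sub_zsmul_mem_Ico hP0 x 0
  rw [zsmul_eq_mul, zero_add] at hn
  set W' : Set (ℝ × ℝ) := {p | (p.1 + n * P, p.2 + n * P) ∈ W}
  have hW' : IsOpen W' := hW.preimage (by fun_prop :
    Continuous fun p : ℝ × ℝ => (p.1 + n * P, p.2 + n * P))
  have hmem : (x - n * P, y - n * P) ∈ W' := by simpa [W'] using hp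
  have hcont : Continuous fun r : ℝ => (r, y - n * P) := by fun_prop
  have hnear := (hcont.tendsto (x - n * P)).eventually (hW'.mem_nhds hmem)
  have hnear' := (hnear.filter_mono (nhdsWithin_le_nhds (s := Ioi (x - n * P)))).and
    (Ioo_mem_nhdsGT hn.2)
  obtain ⟨r, hr, hr'⟩ := hnear'.exists
  set D : Set (ℝ × ℝ) := {p | p.1 ∈ Ioo 0 P}
  have hD : IsOpen D := isOpen_Ioo.preimage continuous_fst
  have hpos : 0 < volume (W' ∩ D) :=
    (hW'.inter hD).measure_pos _ ⟨_, hr, hn.1.trans_lt hr'.1, hr'.2⟩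
  have hzero : ∫⁻ p in (E ∩ {p | p.1 ∈ Ico 0 P}) \ A, B.areaDensity p = 0 := by
    have h := lintegral_inter_add_sdiff (μ := volume) B.areaDensity (E ∩ {p | p.1 ∈ Ico 0 P})
      hA.measurableSet
    have he : E ∩ {p : ℝ × ℝ | p.1 ∈ Ico 0 P} ∩ A = A ∩ {p | p.1 ∈ Ico 0 P} := by
      ext p; exact ⟨fun h => ⟨h.2, h.1.2⟩, fun h => ⟨⟨hAE h.1, h.2⟩, h.1⟩⟩
    rw [he] at h
    change B.area P A + _ = B.area P E at h
    rw [harea] at h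
    have hfin := (B.area_lt_top hP hs).ne
    exact (ENNReal.add_right_inj hfin).1 (by rw [h, add_zero])
  have hsub : W' ∩ D ⊆ (E ∩ {p | p.1 ∈ Ico 0 P}) \ A := by
    rintro ⟨a, b⟩ ⟨h1, h2⟩
    refine ⟨⟨(hshift hperE n a b).1 (hWE h1), h2.1.le, h2.2⟩, fun hA' => ?_⟩
    exact hWA.le_bot ⟨h1, (hshift hperA n a b).2 hA'⟩
  have hzero' : ∫⁻ p in W' ∩ D, B.areaDensity p = 0 :=
    le_antisymm ((lintegral_mono_set hsub).trans hzero.le) zero_le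
  have := (setLIntegral_pos_iff (μ := volume) B.measurable_areaDensity (s := W' ∩ D)).2 (by
    refine hpos.trans_le (measure_mono fun p hp => ⟨?_, hp⟩)
    have := (hs (hsub hp).1.1).2.2
    simp only [Function.mem_support, areaDensity]
    exact (ENNReal.ofReal_pos.2 this).ne')
  exact this.ne' hzero'

end Table

/-! ### The twist condition and angles -/

/-- If two paths `v = a + i b` and `v' = b + i d` of nonzero vectors are such that `a` and `d` have
opposite strict signs wherever `b` vanishes, then the argument of `v'` is less than `π / 2 + j π`
where that of `v` is at most `π / 2 + j π`. Indeed `v'` is never a negative multiple of `-i v`, so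
the argument of `v'` is that of `v` minus `π / 2` plus a number in `(-π, π)`, and the common sign
of `Re v'` and `Im v` excludes the remaining cases. -/
theorem angle_lt_of_twist {v v' : ℝ → ℂ} (hv : Continuous v) (hv' : Continuous v')
    (hv0 : ∀ x, v x ≠ 0) (hv0' : ∀ x, v' x ≠ 0) (hre : ∀ x, (v' x).re = (v x).im)
    (htw : ∀ x, (v x).im = 0 → (v x).re * (v' x).im < 0) {θ θ' : ℝ → ℝ} (hθ : Continuous θ)
    (hθ' : Continuous θ') (hp : ∀ x, v x = ‖v x‖ * Complex.exp (θ x * Complex.I))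
    (hp' : ∀ x, v' x = ‖v' x‖ * Complex.exp (θ' x * Complex.I)) {x₀ : ℝ}
    (h0 : |θ x₀ - π / 4| < π / 4) (h0' : |θ' x₀ - π / 4| < π / 4) (x : ℝ) (j : ℤ)
    (hx : θ x ≤ π / 2 + j * π) : θ' x < π / 2 + j * π := by
  set u : ℝ → ℂ := fun x => ⟨(v x).im, -(v x).re⟩ with hu
  set w : ℝ → ℂ := fun x => v' x * (starRingEnd ℂ) (u x) with hw
  have hwre : ∀ x, (w x).re = (v x).im ^ 2 - (v x).re * (v' x).im := by
    intro x; simp only [hw, hu, Complex.mul_re, Complex.conj_re, Complex.conj_im, hre]; ring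
  have hwim : ∀ x, (w x).im = (v x).im * ((v x).re + (v' x).im) := by
    intro x; simp only [hw, hu, Complex.mul_im, Complex.conj_re, Complex.conj_im, hre]; ring
  -- `w` compares `v'` with `u = -i v`; it avoids the closed negative half-axis
  have hslit : ∀ x, w x ∈ Complex.slitPlane := by
    intro x
    rw [Complex.mem_slitPlane_iff, hwre, hwim]
    by_cases hb : (v x).im = 0
    · left; rw [hb]; linarith [htw x hb]
    · by_cases hs : (v x).re + (v' x).im = 0
      · left
        have : (v' x).im = -(v x).re := by linarith
        rw [this]
        have := sq_pos_of_ne_zero hb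
        nlinarith [sq_nonneg (v x).re]
      · right; exact mul_ne_zero hb hs
  have huv : ∀ x, u x = -Complex.I * v x := by
    intro x; apply Complex.ext <;> simp [hu]
  have huc : Continuous u := by
    have : u = fun x => -Complex.I * v x := funext huv
    rw [this]; fun_prop
  have hwc : Continuous w := hv'.mul (Complex.continuous_conj.comp huc)
  have hA : Continuous fun x => (w x).arg :=
    continuous_iff_continuousAt.2 fun x =>
      ContinuousAt.comp (f := w) (Complex.continuousAt_arg (hslit x)) hwc.continuousAt
  have hnu : ∀ x, ‖u x‖ = ‖v x‖ := by intro x; rw [huv]; simp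
  have hI : Complex.exp ((-(π / 2) : ℝ) * Complex.I) = -Complex.I := by
    rw [Complex.exp_mul_I, ← Complex.ofReal_cos, ← Complex.ofReal_sin]; simp
  have hexp : ∀ x, Complex.exp (θ' x * Complex.I) =
      Complex.exp (((θ x - π / 2 + (w x).arg : ℝ) : ℂ) * Complex.I) := by
    intro x
    have hn : (‖v x‖ : ℂ) ≠ 0 := by exact_mod_cast norm_ne_zero_iff.2 (hv0 x)
    have hn' : (‖v' x‖ : ℂ) ≠ 0 := by exact_mod_cast norm_ne_zero_iff.2 (hv0' x)
    have hwu : w x * u x = v' x * ‖v x‖ ^ 2 := by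
      simp only [hw]
      rw [mul_assoc, mul_comm ((starRingEnd ℂ) (u x)), Complex.mul_conj, Complex.normSq_eq_norm_sq,
        hnu]
      push_cast; ring
    have hwn : ‖w x‖ = ‖v' x‖ * ‖v x‖ := by
      simp only [hw]; rw [norm_mul, RCLike.norm_conj, hnu]
    have hwp := Complex.norm_mul_exp_arg_mul_I (w x)
    rw [← hwp, huv, hwn] at hwu
    apply mul_left_cancel₀ hn'
    apply mul_left_cancel₀ (pow_ne_zero 2 hn)
    calc (‖v x‖ : ℂ) ^ 2 * (‖v' x‖ * Complex.exp (θ' x * Complex.I))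
        = v' x * ‖v x‖ ^ 2 := by rw [← hp' x]; ring
      _ = (‖v' x‖ * ‖v x‖ : ℝ) * Complex.exp ((w x).arg * Complex.I) *
            (-Complex.I * (‖v x‖ * Complex.exp (θ x * Complex.I))) := by rw [← hp x]; exact hwu.symm
      _ = _ := by
        rw [← hI]
        have : ((θ x - π / 2 + (w x).arg : ℝ) : ℂ) * Complex.I =
            (w x).arg * Complex.I + (((-(π / 2) : ℝ) : ℂ) * Complex.I + θ x * Complex.I) := by
          push_cast; ring
        rw [this, Complex.exp_add, Complex.exp_add]
        push_cast; ring
  have hA1 : ∀ x, -π < (w x).arg := fun x => Complex.neg_pi_lt_arg _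
  have hA2 : ∀ x, (w x).arg < π := fun x =>
    lt_of_le_of_ne (Complex.arg_le_pi _) (Complex.slitPlane_arg_ne_pi (hslit x))
  have heq : θ' x = θ x - π / 2 + (w x).arg := by
    refine eq_of_exp_eq hθ' (by fun_prop) hexp (x₀ := x₀) ?_ x
    have := hA1 x₀
    have := hA2 x₀
    rw [abs_lt] at h0 h0' ⊢
    constructor <;> linarith
  by_contra hcon
  have h1 := hA1 x
  have h2 := hA2 x
  have hc1 : 0 < Real.cos (θ x - π / 2 - j * π) :=
    Real.cos_pos_of_mem_Ioo ⟨by linarith, by linarith⟩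
  have hc2 : Real.cos (θ' x - j * π) ≤ 0 :=
    Real.cos_nonpos_of_pi_div_two_le_of_le (by linarith) (by linarith)
  obtain ⟨-, hi⟩ := re_im_of_polar (hp x)
  obtain ⟨hr, -⟩ := re_im_of_polar (hp' x)
  have e := hre x
  rw [hr, hi] at e
  rw [Real.cos_sub_int_mul_pi] at hc1 hc2
  rw [Real.cos_sub_pi_div_two] at hc1
  have hn := norm_pos_iff.2 (hv0 x)
  have hn' := norm_pos_iff.2 (hv0' x)
  have e1 : ‖v' x‖ * ((-1) ^ j * Real.cos (θ' x)) = ‖v x‖ * ((-1) ^ j * Real.sin (θ x)) := by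
    linear_combination ((-1 : ℝ) ^ j) * e
  have e2 := mul_pos hn hc1
  have e3 := mul_nonpos_of_nonneg_of_nonpos hn'.le hc2
  linarith

/-- The point `(x, y)` of the plane as a complex number. -/
def toC (p : ℝ × ℝ) : ℂ := ⟨p.1, p.2⟩

lemma continuous_toC : Continuous toC :=
  Complex.equivRealProdCLM.symm.continuous

lemma toC_injective : Function.Injective toC := fun _ _ h =>
  Prod.ext (congrArg Complex.re h) (congrArg Complex.im h)

namespace Table

variable (B : Table)

lemma strip_add {x y : ℝ} : (x + 2 * π, y + 2 * π) ∈ B.strip ↔ (x, y) ∈ B.strip := by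
  simp only [strip, mem_ofPred_eq, density_add_two_pi, density_add_two_pi_left]
  constructor <;> rintro ⟨h1, h2, h3⟩ <;> exact ⟨by linarith, by linarith, h3⟩

/-- The diagonal translation by `2π j`. -/
def shift (j : ℤ) (p : ℝ × ℝ) : ℝ × ℝ := (p.1 + j * (2 * π), p.2 + j * (2 * π))

lemma shift_zero (p : ℝ × ℝ) : shift 0 p = p := by simp [shift]

lemma shift_shift (i j : ℤ) (p : ℝ × ℝ) : shift i (shift j p) = shift (i + j) p := by
  simp only [shift]; push_cast; ext <;> simp <;> ring

lemma continuous_shift (j : ℤ) : Continuous (shift j) := by unfold shift; fun_prop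

lemma shift_mem_iff {S : Set (ℝ × ℝ)} (hS : ∀ x y, (x + 2 * π, y + 2 * π) ∈ S ↔ (x, y) ∈ S)
    (j : ℤ) (p : ℝ × ℝ) : shift j p ∈ S ↔ p ∈ S := by
  have h1 : ∀ p, shift 1 p ∈ S ↔ p ∈ S := by
    rintro ⟨x, y⟩; simpa [shift] using hS x y
  induction j using Int.induction_on with
  | zero => rw [shift_zero]
  | succ n ih =>
    rw [add_comm, ← shift_shift, h1]
    exact ih
  | pred n ih =>
    rw [← h1, shift_shift, add_sub_cancel]
    exact ih

lemma shift_mem_strip (j : ℤ) (p : ℝ × ℝ) : shift j p ∈ B.strip ↔ p ∈ B.strip :=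
  shift_mem_iff (fun _ _ => B.strip_add) j p

lemma height_shift_right (j : ℤ) (y u : ℝ) : B.height y (u + j * (2 * π)) = B.height y u := by
  simp only [height, pos, AddCircle.coe_add]
  congr 2
  have : ((j * (2 * π) : ℝ) : Circ) = 0 := by
    rw [← zsmul_eq_mul, AddCircle.coe_zsmul, coe_two_pi, smul_zero]
  rw [this, add_zero]

lemma height_shift_left (j : ℤ) (y u : ℝ) : B.height (y + j * (2 * π)) u = B.height y u := by
  have : ((j * (2 * π) : ℝ) : Circ) = 0 := by
    rw [← zsmul_eq_mul, AddCircle.coe_zsmul, coe_two_pi, smul_zero]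
  simp only [height, vel, AddCircle.coe_add, this, add_zero]

lemma step_shift (j : ℤ) {p : ℝ × ℝ} (hp : p ∈ B.strip) :
    B.step (shift j p) = shift j (B.step p) := by
  have hp' := (B.shift_mem_strip j p).2 hp
  refine Prod.ext rfl ?_
  refine B.eq_of_height_eq (y := p.2 + j * (2 * π)) (B.step_mem hp')
    ((B.shift_mem_strip j _).2 (B.step_mem hp)) ?_
  have h1 := B.height_next hp'
  have h2 := B.height_next hp
  simp only [shift, step] at h1 h2 ⊢
  rw [h1, height_shift_left, height_shift_left, height_shift_right, height_shift_right, h2]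

lemma stepInv_shift (j : ℤ) {p : ℝ × ℝ} (hp : p ∈ B.strip) :
    B.stepInv (shift j p) = shift j (B.stepInv p) := by
  have h := B.step_shift j (B.stepInv_mem hp)
  rw [B.step_stepInv hp] at h
  rw [← h, B.stepInv_step ((B.shift_mem_strip j _).2 (B.stepInv_mem hp))]

/-- The twist condition: for fixed second bounce, the third decreases with the first. -/
lemma next_lt_next {p q : ℝ × ℝ} (hp : p ∈ B.strip) (hq : q ∈ B.strip) (h : p.2 = q.2)
    (hlt : p.1 < q.1) : B.next q < B.next p := by
  have h1 : (p.1, q.2) ∈ B.strip := h ▸ hp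
  have h2 := (B.height_lt_of_gt (y := q.2) hq h1).2 hlt
  have h3 := B.height_next hp
  rw [h] at h3
  rw [← h3, ← B.height_next hq] at h2
  have h4 : (q.2, B.next p) ∈ B.strip := h ▸ B.next_mem hp
  exact (B.height_lt_of_lt (B.next_mem hq) h4).1 h2

end Table

/-! ### Lifted invariant curves -/

/-- An invariant essential curve lifted to the strip: a relatively closed subset `carrier` of the
strip, invariant under the billiard map and under the diagonal translation by `2π`, which is the
orbit of a path `c` under these translations. The path is parametrized with unit average speed, so
that a curve winding `±n` times is translated by `2π n` when its parameter increases by `2π n`. -/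
structure LiftedCurve (B : Table) where
  carrier : Set (ℝ × ℝ)
  sub_strip : carrier ⊆ B.strip
  isOpen_compl : IsOpen (B.strip \ carrier)
  add_mem : ∀ x y, (x + 2 * π, y + 2 * π) ∈ carrier ↔ (x, y) ∈ carrier
  step_mem : ∀ p ∈ B.strip, B.step p ∈ carrier ↔ p ∈ carrier
  /-- The parametrization of one lift. -/
  c : ℝ → ℝ × ℝ
  continuous_c : Continuous c
  /-- The absolute value of the winding number. -/
  n : ℕ
  n_pos : 0 < n
  c_add : ∀ x, c (x + n * (2 * π)) = Table.shift n (c x)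
  c_mem : ∀ x, c x ∈ carrier
  exists_eq : ∀ p ∈ carrier, ∃ x, ∃ j : ℤ, p = Table.shift j (c x)
  /-- The billiard map in the parameter of the curve. -/
  h : ℝ → ℝ
  continuous_h : Continuous h
  /-- The translation between the lift `c` and its image under the billiard map. -/
  k : ℤ
  step_c : ∀ x, B.step (c x) = Table.shift k (c (h x))

namespace LiftedCurve

open Table

variable {B : Table} (Γ : LiftedCurve B)

lemma exists_bound_of_periodic {f : ℝ → ℝ} (hf : Continuous f) {P : ℝ} (hP : 0 < P)
    (hper : Function.Periodic f P) : ∃ C, ∀ x, |f x| ≤ C := by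
  obtain ⟨C, hC⟩ := (isCompact_Icc (a := (0 : ℝ)) (b := P)).exists_bound_of_continuousOn
    hf.continuousOn
  refine ⟨C, fun x => ?_⟩
  obtain ⟨y, hy, e⟩ := hper.exists_mem_Ico₀ hP x
  rw [e]
  exact hC y ⟨hy.1, hy.2.le⟩

lemma period_pos : 0 < Γ.n * (2 * π) := by
  have := Γ.n_pos
  positivity

lemma exists_bound : ∃ C, ∀ x, |(Γ.c x).1 - x| ≤ C ∧ |(Γ.c x).2 - x| ≤ C := by
  have hc := Γ.continuous_c
  obtain ⟨C₁, h₁⟩ := exists_bound_of_periodic (f := fun x => (Γ.c x).1 - x) (by fun_prop)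
    Γ.period_pos (by intro x; simp only [Γ.c_add, shift]; push_cast; ring)
  obtain ⟨C₂, h₂⟩ := exists_bound_of_periodic (f := fun x => (Γ.c x).2 - x) (by fun_prop)
    Γ.period_pos (by intro x; simp only [Γ.c_add, shift]; push_cast; ring)
  exact ⟨max C₁ C₂, fun x => ⟨(h₁ x).trans (le_max_left _ _), (h₂ x).trans (le_max_right _ _)⟩⟩

lemma surjective_of_bound {f : ℝ → ℝ} (hf : Continuous f) {C : ℝ} (h : ∀ x, |f x - x| ≤ C) :
    Function.Surjective f := by
  intro y
  have h1 := abs_le.1 (h (y - C))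
  have h2 := abs_le.1 (h (y + C))
  obtain ⟨x, -, hx⟩ := intermediate_value_uIcc (a := y - C) (b := y + C) hf.continuousOn
    (show y ∈ uIcc _ _ from mem_uIcc.2 (Or.inl ⟨by linarith, by linarith⟩))
  exact ⟨x, hx⟩

lemma exists_bound_h : ∃ C, ∀ x, |Γ.h x - x| ≤ C := by
  obtain ⟨C, hC⟩ := Γ.exists_bound
  refine ⟨2 * C + |Γ.k * (2 * π)|, fun x => ?_⟩
  have h1 := (hC (Γ.h x)).1
  have h2 := (hC x).2
  have h3 := congrArg Prod.fst (Γ.step_c x)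
  simp only [step, shift] at h3
  have h4 := abs_le.1 (le_refl |Γ.k * (2 * π)|)
  rw [abs_le] at h1 h2 ⊢
  constructor <;> linarith

lemma surjective_h : Function.Surjective Γ.h := by
  obtain ⟨C, hC⟩ := Γ.exists_bound_h
  exact surjective_of_bound Γ.continuous_h hC

lemma exists_mem_fiber (x : ℝ) : ∃ y, (x, y) ∈ Γ.carrier := by
  obtain ⟨C, hC⟩ := Γ.exists_bound
  obtain ⟨s, hs⟩ := surjective_of_bound (f := fun s => (Γ.c s).1)
    (continuous_fst.comp Γ.continuous_c) (fun x => (hC x).1) x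
  exact ⟨(Γ.c s).2, by rw [← hs]; exact Γ.c_mem s⟩

lemma exists_gap : ∃ δ > 0, ∀ p ∈ Γ.carrier, p.1 + δ ≤ p.2 := by
  have hc := Γ.continuous_c
  obtain ⟨s, hs, hmin⟩ := (isCompact_Icc (a := (0 : ℝ)) (b := Γ.n * (2 * π))).exists_isMinOn
    (nonempty_Icc.2 Γ.period_pos.le)
    (show ContinuousOn (fun s => (Γ.c s).2 - (Γ.c s).1) _ from
      Continuous.continuousOn (by fun_prop))
  refine ⟨(Γ.c s).2 - (Γ.c s).1, ?_, ?_⟩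
  · have := (Γ.sub_strip (Γ.c_mem s)).1; linarith
  · intro p hp
    obtain ⟨x, j, rfl⟩ := Γ.exists_eq p hp
    have hper : Function.Periodic (fun s => (Γ.c s).2 - (Γ.c s).1) (Γ.n * (2 * π)) := by
      intro x; simp only [Γ.c_add, shift]; push_cast; ring
    obtain ⟨y, hy, e⟩ := hper.exists_mem_Ico₀ Γ.period_pos x
    have := hmin ⟨hy.1, hy.2.le⟩
    simp only [mem_ofPred_eq] at this e
    simp only [shift]
    linarith

/-- The width of a collar of the diagonal that avoids the curve. -/
def gap : ℝ := Γ.exists_gap.choose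

lemma gap_pos : 0 < Γ.gap := Γ.exists_gap.choose_spec.1

lemma gap_le {p : ℝ × ℝ} (hp : p ∈ Γ.carrier) : p.1 + Γ.gap ≤ p.2 :=
  Γ.exists_gap.choose_spec.2 p hp

/-- A collar of the diagonal inside the strip that avoids the curve. -/
def collar : Set (ℝ × ℝ) := {p | p.1 < p.2 ∧ p.2 < p.1 + Γ.gap}

lemma collar_subset : Γ.collar ⊆ B.strip \ Γ.carrier := by
  rintro ⟨x, y⟩ ⟨h1, h2⟩
  refine ⟨?_, fun h => ?_⟩
  · obtain ⟨y', hy'⟩ := Γ.exists_mem_fiber x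
    have h3 := Γ.gap_le hy'
    have h4 := (B.mem_strip.1 (Γ.sub_strip hy')).2
    simp only at h1 h2 h3
    exact B.mem_strip.2 ⟨h1, by linarith⟩
  · have := Γ.gap_le h; simp only at this h2; linarith

lemma isPreconnected_collar : IsPreconnected Γ.collar := by
  have : Convex ℝ Γ.collar := by
    rintro ⟨x, y⟩ ⟨h1, h2⟩ ⟨x', y'⟩ ⟨h1', h2'⟩ a b ha hb hab
    simp only [collar, mem_ofPred_eq, Prod.smul_mk, Prod.mk_add_mk, smul_eq_mul] at *
    constructor
    · rcases ha.eq_or_lt with rfl | ha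
      · obtain rfl : b = 1 := by linarith
        linarith
      · nlinarith
    · rcases ha.eq_or_lt with rfl | ha
      · obtain rfl : b = 1 := by linarith
        linarith
      · obtain rfl : b = 1 - a := by linarith
        nlinarith
  exact this.isPreconnected

/-- The component of the complement of the curve in the strip that borders the diagonal. -/
def region : Set (ℝ × ℝ) := connectedComponentIn (B.strip \ Γ.carrier) (0, Γ.gap / 2)

lemma base_mem : ((0 : ℝ), Γ.gap / 2) ∈ Γ.collar := by
  have := Γ.gap_pos
  constructor <;> simp <;> linarith

lemma collar_subset_region : Γ.collar ⊆ Γ.region :=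
  Γ.isPreconnected_collar.subset_connectedComponentIn Γ.base_mem Γ.collar_subset

lemma region_subset : Γ.region ⊆ B.strip \ Γ.carrier := connectedComponentIn_subset _ _

lemma isOpen_region : IsOpen Γ.region := Γ.isOpen_compl.connectedComponentIn

lemma isPreconnected_region : IsPreconnected Γ.region := isPreconnected_connectedComponentIn

lemma subset_region {S : Set (ℝ × ℝ)} (hS : IsPreconnected S) (hsub : S ⊆ B.strip \ Γ.carrier)
    {p : ℝ × ℝ} (hp : p ∈ S) (hp' : p ∈ Γ.region) : S ⊆ Γ.region := by
  have h := hS.subset_connectedComponentIn hp hsub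
  rwa [← connectedComponentIn_eq hp'] at h

lemma image_region_subset {f : ℝ × ℝ → ℝ × ℝ} (hf : ContinuousOn f B.strip)
    (hmaps : ∀ p ∈ B.strip \ Γ.carrier, f p ∈ B.strip \ Γ.carrier) {p : ℝ × ℝ}
    (hp : p ∈ Γ.collar) (hfp : f p ∈ Γ.collar) : f '' Γ.region ⊆ Γ.region := by
  refine Γ.subset_region (Γ.isPreconnected_region.image f
    (hf.mono fun q hq => (Γ.region_subset hq).1)) ?_
    (mem_image_of_mem f (Γ.collar_subset_region hp)) (Γ.collar_subset_region hfp)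
  rintro _ ⟨q, hq, rfl⟩
  exact hmaps q (Γ.region_subset hq)

/-- Near the diagonal there are orbits with two consecutive points in the collar; this pins the
component to which the region is mapped. -/
lemma exists_collar_step : ∃ p ∈ Γ.collar, B.step p ∈ Γ.collar := by
  have hδ := Γ.gap_pos
  have hb : ((-(Γ.gap / 2) : ℝ), (0 : ℝ)) ∈ Γ.collar := by
    constructor <;> simp <;> linarith
  have hbs := (Γ.collar_subset hb).1
  have h0 : B.height 0 0 < B.height 0 (-(Γ.gap / 2)) := by
    have h := B.mem_strip'.1 hbs
    exact B.strictAntiOn_height 0 ⟨h.1.le, h.2.le⟩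
      ⟨by have := B.opp_lt 0; linarith, le_rfl⟩ h.2
  have hev := ((B.continuous_height_right 0).tendsto 0).eventually (gt_mem_nhds h0)
  obtain ⟨z, hz, hz'⟩ := ((hev.filter_mono (nhdsWithin_le_nhds (s := Ioi 0))).and
    (Ioo_mem_nhdsGT hδ)).exists
  have hzc : ((0 : ℝ), z) ∈ Γ.collar := ⟨hz'.1, by simpa using hz'.2⟩
  have hzs := (Γ.collar_subset hzc).1
  have hx := B.prev_mem hzs
  have hh := B.height_prev hzs
  simp only at hx hh
  rw [← hh, B.height_lt_of_gt hx hbs] at hz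
  refine ⟨B.stepInv (0, z), ⟨(B.stepInv_mem hzs).1, ?_⟩, ?_⟩
  · simp only [stepInv]; linarith
  · rwa [B.step_stepInv hzs]

lemma step_region : B.step '' Γ.region = Γ.region := by
  obtain ⟨p, hp, hp'⟩ := Γ.exists_collar_step
  have h1 : B.step '' Γ.region ⊆ Γ.region := by
    refine Γ.image_region_subset B.continuousOn_step (fun q hq => ?_) hp hp'
    exact ⟨B.step_mem hq.1, fun h => hq.2 ((Γ.step_mem q hq.1).1 h)⟩
  have h2 : B.stepInv '' Γ.region ⊆ Γ.region := by
    refine Γ.image_region_subset B.continuousOn_stepInv (fun q hq => ?_) hp' ?_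
    · refine ⟨B.stepInv_mem hq.1, fun h => hq.2 ?_⟩
      rw [← Γ.step_mem _ (B.stepInv_mem hq.1), B.step_stepInv hq.1] at h
      exact h
    · rwa [B.stepInv_step (Γ.collar_subset hp).1]
  refine h1.antisymm fun q hq => ?_
  exact ⟨B.stepInv q, h2 ⟨q, hq, rfl⟩, B.step_stepInv (Γ.region_subset hq).1⟩

lemma stepInv_region : B.stepInv '' Γ.region = Γ.region := by
  conv_lhs => rw [← Γ.step_region, image_image]
  rw [image_congr (fun q hq => B.stepInv_step (Γ.region_subset hq).1), image_id']

lemma shift_mem_region (j : ℤ) (p : ℝ × ℝ) : shift j p ∈ Γ.region ↔ p ∈ Γ.region := by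
  have h : ∀ j : ℤ, shift j '' Γ.region ⊆ Γ.region := by
    intro j
    refine Γ.image_region_subset (continuous_shift j).continuousOn (fun q hq => ?_) Γ.base_mem ?_
    · exact ⟨(B.shift_mem_strip j q).2 hq.1, fun h => hq.2 ((shift_mem_iff Γ.add_mem j q).1 h)⟩
    · have := Γ.base_mem
      simp only [collar, shift, mem_ofPred_eq] at this ⊢
      constructor <;> linarith [this.1, this.2]
  refine ⟨fun hp => ?_, fun hp => h j ⟨p, hp, rfl⟩⟩
  have := h (-j) ⟨_, hp, rfl⟩
  rwa [shift_shift, neg_add_cancel, shift_zero] at this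

/-- Let `f` map the region onto itself and preserve the area of the open set `E`, and let it map
the complement of `E` into an open set `Q` disjoint from `E`. Then `E` is the whole region:
`f '' E` contains `E` and has the same area, so it does not meet `Q`, while both cover the
connected region. -/
lemma region_subset_of_area {f : ℝ × ℝ → ℝ × ℝ} (hf : f '' Γ.region = Γ.region)
    {E Q : Set (ℝ × ℝ)} (hE : IsOpen E) (hQ : IsOpen Q) (hER : E ⊆ Γ.region)
    (hEne : E.Nonempty)
    (hEQ : Disjoint E Q) (hfQ : ∀ p ∈ Γ.region, p ∉ E → f p ∈ Q) (hfE : IsOpen (f '' E))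
    (hEper : ∀ x y, (x + 2 * π, y + 2 * π) ∈ E ↔ (x, y) ∈ E)
    (hfEper : ∀ x y, (x + 2 * π, y + 2 * π) ∈ f '' E ↔ (x, y) ∈ f '' E)
    (harea : B.area (2 * π) (f '' E) = B.area (2 * π) E) : Γ.region ⊆ E := by
  have hcover : ∀ p ∈ Γ.region, p ∈ f '' E ∨ p ∈ Q := by
    intro p hp
    rw [← hf] at hp
    obtain ⟨q, hq, rfl⟩ := hp
    by_cases hqE : q ∈ E
    · exact Or.inl ⟨q, hqE, rfl⟩
    · exact Or.inr (hfQ q hq hqE)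
  have hsub : E ⊆ f '' E := fun p hp =>
    (hcover p (hER hp)).resolve_right fun h => hEQ.le_bot ⟨hp, h⟩
  have hfER : f '' E ⊆ Γ.region := (image_mono hER).trans hf.le
  have hW : f '' E ∩ Q = ∅ := by
    refine B.eq_empty_of_area_eq le_rfl hsub (fun p hp => (Γ.region_subset (hfER hp)).1) hEper
      hfEper hE (hfE.inter hQ) inter_subset_left ?_ harea.symm
    exact (hEQ.mono_right inter_subset_right).symm
  have hall : Γ.region ⊆ f '' E := by
    obtain ⟨p, hp⟩ := hEne
    exact Γ.isPreconnected_region.subset_left_of_subset_union hfE hQ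
      (disjoint_iff_inter_eq_empty.2 hW) (fun p hp => hcover p hp) ⟨p, hER hp, hsub hp⟩
  intro p hp
  by_contra hpE
  have h1 := hfQ p hp hpE
  have h2 : f p ∈ Γ.region := by rw [← hf]; exact ⟨p, hp, rfl⟩
  have h3 : f p ∈ f '' E ∩ Q := ⟨hall h2, h1⟩
  rw [hW] at h3
  exact h3

/-! ### The angle at which the region sees the curve -/

lemma toC_notMem_range {z : ℝ × ℝ} (hz : z ∉ Γ.carrier) : toC z ∉ range fun x => toC (Γ.c x) := by
  rintro ⟨x, hx⟩
  exact hz (toC_injective hx ▸ Γ.c_mem x)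

lemma norm_toC_le (z : ℝ × ℝ) : ‖toC z‖ ≤ 2 * ‖z‖ := by
  have h1 := Complex.norm_le_abs_re_add_abs_im (toC z)
  have h2 := norm_fst_le z
  have h3 := norm_snd_le z
  simp only [Real.norm_eq_abs] at h2 h3
  simp only [toC] at h1 ⊢
  linarith

/-- Seen from the collar, the curve lies on the upper left side of the diagonal direction. -/
lemma mem_Ioo_of_collar {z : ℝ × ℝ} (hz : z ∈ Γ.collar) {θ : ℝ → ℝ} (hθ : Continuous θ)
    (hp : ∀ x, toC (Γ.c x) - toC z = ‖toC (Γ.c x) - toC z‖ * Complex.exp (θ x * Complex.I))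
    {x₀ : ℝ} (h0 : |θ x₀ - π / 4| < π / 4) (x : ℝ) : θ x ∈ Ioo (π / 4) (5 * π / 4) := by
  have hlt : ∀ x, 0 < Real.sin (θ x - π / 4) := by
    intro x
    obtain ⟨hr, hi⟩ := re_im_of_polar (hp x)
    have h1 := Γ.gap_le (Γ.c_mem x)
    have h2 := hz.2
    simp only [Complex.sub_re, Complex.sub_im] at hr hi
    have h3 : 0 < ‖toC (Γ.c x) - toC z‖ * (Real.sin (θ x) - Real.cos (θ x)) := by
      rw [mul_sub, ← hr, ← hi]; simp only [toC]; linarith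
    have h4 := pos_of_mul_pos_right h3 (norm_nonneg _)
    rw [Real.sin_sub, Real.cos_pi_div_four, Real.sin_pi_div_four, ← sub_mul]
    positivity
  have hpi := Real.pi_pos
  rw [abs_lt] at h0
  have hx₀ : π / 4 < θ x₀ := by
    by_contra hcon
    have := Real.sin_nonpos_of_nonpos_of_neg_pi_le (x := θ x₀ - π / 4) (by linarith) (by linarith)
    linarith [hlt x₀]
  constructor
  · by_contra hcon
    obtain ⟨w, -, hw⟩ := intermediate_value_uIcc (a := x) (b := x₀) hθ.continuousOn
      (show π / 4 ∈ uIcc _ _ from mem_uIcc.2 (Or.inl ⟨not_lt.1 hcon, hx₀.le⟩))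
    have := hlt w
    rw [hw] at this
    simp at this
  · by_contra hcon
    obtain ⟨w, -, hw⟩ := intermediate_value_uIcc (a := x₀) (b := x) hθ.continuousOn
      (show 5 * π / 4 ∈ uIcc _ _ from mem_uIcc.2 (Or.inl ⟨by linarith, not_lt.1 hcon⟩))
    have := hlt w
    rw [hw, show 5 * π / 4 - π / 4 = π by ring, Real.sin_pi] at this
    exact lt_irrefl _ this

/-- On the region the limit of the angle at `-∞` is locally constant, and it equals `5π / 4` on the
collar. -/
theorem exists_angle_on_region : ∃ θ : ℝ × ℝ → ℝ → ℝ,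
    ContinuousOn (fun p : (ℝ × ℝ) × ℝ => θ p.1 p.2) (Γ.region ×ˢ univ) ∧
    (∀ z ∈ Γ.region, ∀ x,
      toC (Γ.c x) - toC z = ‖toC (Γ.c x) - toC z‖ * Complex.exp (θ z x * Complex.I)) ∧
    (∀ R, ∃ M, ∀ z ∈ Γ.region, ‖z‖ ≤ R → (∀ x ≥ M, |θ z x - π / 4| < π / 4) ∧
        ∀ x ≤ -M, |θ z x - 5 * π / 4| < π / 4) ∧
    ∀ z ∈ Γ.collar, ∀ x, θ z x ∈ Ioo (π / 4) (5 * π / 4) := by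
  obtain ⟨C, hC⟩ := Γ.exists_bound
  have hcc : Continuous fun x => toC (Γ.c x) := continuous_toC.comp Γ.continuous_c
  obtain ⟨θ, θe, hθ, hθe, hp, hk, hM⟩ := exists_continuous_angle hcc (C := 2 * C) (by
    intro x
    refine (Complex.norm_le_abs_re_add_abs_im _).trans ?_
    have := hC x
    simp [toC]
    linarith)
  have hreg : ∀ z ∈ Γ.region, toC z ∉ range fun x => toC (Γ.c x) := fun z hz =>
    Γ.toC_notMem_range (Γ.region_subset hz).2
  have hcont : ∀ z ∈ Γ.region, Continuous (θ (toC z)) := by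
    intro z hz
    exact hθ.comp_continuous (f := fun x : ℝ => (toC z, x)) (by fun_prop)
      fun x => ⟨hreg z hz, trivial⟩
  have hcol : ∀ z ∈ Γ.collar, ∀ x, θ (toC z) x ∈ Ioo (π / 4) (5 * π / 4) := by
    intro z hz
    obtain ⟨M, hM⟩ := hM ‖toC z‖
    have hz' := Γ.collar_subset_region hz
    exact Γ.mem_Ioo_of_collar hz (hcont z hz') (hp _ (hreg z hz'))
      ((hM _ (hreg z hz') le_rfl).1 M le_rfl)
  have hend : ∀ z ∈ Γ.region, θe (toC z) = 5 * π / 4 := by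
    have hbase : θe (toC (0, Γ.gap / 2)) = 5 * π / 4 := by
      have hb := Γ.base_mem
      have hb' := hreg _ (Γ.collar_subset_region hb)
      obtain ⟨k, hk⟩ := hk _ hb'
      obtain ⟨M, hM⟩ := hM ‖toC (0, Γ.gap / 2)‖
      have h1 := (hM _ hb' le_rfl).2 (-M) le_rfl
      have h2 := hcol _ hb (-M)
      rw [hk, abs_lt] at h1
      have hpi := Real.pi_pos
      have h3 : (k : ℝ) < 1 := by
        by_contra hcon
        nlinarith [not_lt.1 hcon, h2.2]
      have h4 : (-1 : ℝ) < k := by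
        by_contra hcon
        nlinarith [not_lt.1 hcon, h2.1]
      have h5 : k < 1 := by exact_mod_cast h3
      have h6 : -1 < k := by exact_mod_cast h4
      have : k = 0 := by omega
      rw [hk, this]; simp
    intro z hz
    have hc : ContinuousOn (fun z => θe (toC z)) Γ.region :=
      hθe.comp continuous_toC.continuousOn fun z hz => hreg z hz
    obtain ⟨k, hkz⟩ := hk _ (hreg z hz)
    have hpi := Real.pi_pos
    rcases lt_trichotomy k 0 with h | h | h
    · exfalso
      have h' : (k : ℝ) ≤ -1 := by exact_mod_cast (by omega : k ≤ -1)
      obtain ⟨w, hw, hwe⟩ := Γ.isPreconnected_region.intermediate_value hz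
        (Γ.collar_subset_region Γ.base_mem) hc
        (show π / 4 ∈ Icc _ _ from ⟨by simp only [hkz]; nlinarith, by rw [hbase]; linarith⟩)
      obtain ⟨m, hm⟩ := hk _ (hreg w hw)
      simp only at hwe
      rw [hm] at hwe
      have : (m : ℝ) * 2 = -1 := by
        have : π * (m * 2 + 1) = 0 := by linarith
        rcases mul_eq_zero.1 this with h | h <;> linarith
      have : m * 2 = -1 := by exact_mod_cast this
      omega
    · rw [hkz, h]; simp
    · exfalso
      have h' : (1 : ℝ) ≤ k := by exact_mod_cast (by omega : 1 ≤ k)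
      obtain ⟨w, hw, hwe⟩ := Γ.isPreconnected_region.intermediate_value
        (Γ.collar_subset_region Γ.base_mem) hz hc
        (show 9 * π / 4 ∈ Icc _ _ from ⟨by rw [hbase]; linarith, by simp only [hkz]; nlinarith⟩)
      obtain ⟨m, hm⟩ := hk _ (hreg w hw)
      simp only at hwe
      rw [hm] at hwe
      have : (m : ℝ) * 2 = 1 := by
        have : π * (m * 2 - 1) = 0 := by linarith
        rcases mul_eq_zero.1 this with h | h <;> linarith
      have : m * 2 = 1 := by exact_mod_cast this
      omega
  refine ⟨fun z => θ (toC z), ?_, fun z hz => hp _ (hreg z hz), ?_, hcol⟩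
  · refine hθ.comp (f := fun p : (ℝ × ℝ) × ℝ => (toC p.1, p.2)) ?_
      fun p hp => ⟨hreg _ hp.1, trivial⟩
    exact (Continuous.prodMk (continuous_toC.comp continuous_fst) continuous_snd).continuousOn
  · intro R
    obtain ⟨M, hM⟩ := hM (2 * R)
    refine ⟨M, fun z hz hzR => ?_⟩
    have h := hM _ (hreg z hz) ((norm_toC_le z).trans (by linarith))
    rwa [hend z hz] at h

/-- `angle z x` is the argument of `c x - z`, for `z` in the region, continuous in both variables
and normalized by its limit `π / 4` as `x` tends to infinity. -/
def angle : ℝ × ℝ → ℝ → ℝ := Γ.exists_angle_on_region.choose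

lemma continuousOn_angle :
    ContinuousOn (fun p : (ℝ × ℝ) × ℝ => Γ.angle p.1 p.2) (Γ.region ×ˢ univ) :=
  Γ.exists_angle_on_region.choose_spec.1

lemma angle_polar {z : ℝ × ℝ} (hz : z ∈ Γ.region) (x : ℝ) :
    toC (Γ.c x) - toC z = ‖toC (Γ.c x) - toC z‖ * Complex.exp (Γ.angle z x * Complex.I) :=
  Γ.exists_angle_on_region.choose_spec.2.1 z hz x

lemma angle_bound (R : ℝ) : ∃ M, ∀ z ∈ Γ.region, ‖z‖ ≤ R →
    (∀ x ≥ M, |Γ.angle z x - π / 4| < π / 4) ∧ ∀ x ≤ -M, |Γ.angle z x - 5 * π / 4| < π / 4 :=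
  Γ.exists_angle_on_region.choose_spec.2.2.1 R

lemma angle_collar {z : ℝ × ℝ} (hz : z ∈ Γ.collar) (x : ℝ) :
    Γ.angle z x ∈ Ioo (π / 4) (5 * π / 4) :=
  Γ.exists_angle_on_region.choose_spec.2.2.2 z hz x

lemma continuous_angle {z : ℝ × ℝ} (hz : z ∈ Γ.region) : Continuous (Γ.angle z) :=
  Γ.continuousOn_angle.comp_continuous (f := fun x : ℝ => (z, x)) (by fun_prop)
    fun _ => ⟨hz, trivial⟩

lemma toC_sub_ne_zero {z : ℝ × ℝ} (hz : z ∈ Γ.region) (x : ℝ) : toC (Γ.c x) - toC z ≠ 0 :=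
  fun h => (Γ.region_subset hz).2 (toC_injective (sub_eq_zero.1 h) ▸ Γ.c_mem x)

lemma angle_shift {z : ℝ × ℝ} (hz : z ∈ Γ.region) (x : ℝ) :
    Γ.angle (shift Γ.n z) (x + Γ.n * (2 * π)) = Γ.angle z x := by
  have hz' := (Γ.shift_mem_region Γ.n z).2 hz
  obtain ⟨M, hM⟩ := Γ.angle_bound (max ‖z‖ ‖shift Γ.n z‖)
  refine eq_of_exp_eq (a := fun x => Γ.angle (shift Γ.n z) (x + Γ.n * (2 * π)))
    ((Γ.continuous_angle hz').comp (by fun_prop)) (Γ.continuous_angle hz) (fun x => ?_)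
    (x₀ := M) ?_ x
  · have h1 := Γ.angle_polar hz' (x + Γ.n * (2 * π))
    have h2 := Γ.angle_polar hz x
    have e : toC (Γ.c (x + Γ.n * (2 * π))) - toC (shift Γ.n z) = toC (Γ.c x) - toC z := by
      rw [Γ.c_add]; apply Complex.ext <;> simp [toC, shift]
    rw [e] at h1
    have h0 := Γ.toC_sub_ne_zero hz x
    rw [h2] at h1
    simp only [norm_mul, Complex.norm_real, norm_norm, Complex.norm_exp_ofReal_mul_I, mul_one] at h1
    exact (mul_left_cancel₀ (by exact_mod_cast norm_ne_zero_iff.2 h0) h1).symm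
  · have h1 := (hM _ hz (le_max_left _ _)).1 M le_rfl
    have h2 := (hM _ hz' (le_max_right _ _)).1 (M + Γ.n * (2 * π))
      (by have := Γ.period_pos; linarith)
    rw [abs_lt] at h1 h2 ⊢
    have := Real.pi_pos
    constructor <;> linarith

/-- The billiard map, composed with the translation that returns the image of `c` to `c`, moves
angles across the vertical directions only clockwise. -/
theorem angle_step_lt {z : ℝ × ℝ} (hz : z ∈ Γ.region) (x : ℝ) (j : ℤ)
    (hx : Γ.angle z x ≤ π / 2 + j * π) :
    Γ.angle (shift (-Γ.k) (B.step z)) (Γ.h x) < π / 2 + j * π := by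
  have hz' : shift (-Γ.k) (B.step z) ∈ Γ.region := by
    rw [Γ.shift_mem_region, ← Γ.step_region]; exact ⟨z, hz, rfl⟩
  have hzs := (Γ.region_subset hz).1
  have hcs := fun x => Γ.sub_strip (Γ.c_mem x)
  obtain ⟨M, hM⟩ := Γ.angle_bound (max ‖z‖ ‖shift (-Γ.k) (B.step z)‖)
  obtain ⟨C, hC⟩ := Γ.exists_bound_h
  have hC0 : 0 ≤ C := (abs_nonneg _).trans (hC 0)
  have hch : ∀ x, Γ.c (Γ.h x) = shift (-Γ.k) (B.step (Γ.c x)) := by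
    intro x; rw [Γ.step_c, shift_shift, neg_add_cancel, shift_zero]
  refine angle_lt_of_twist (v := fun x => toC (Γ.c x) - toC z)
    (v' := fun x => toC (Γ.c (Γ.h x)) - toC (shift (-Γ.k) (B.step z)))
    (θ' := fun x => Γ.angle (shift (-Γ.k) (B.step z)) (Γ.h x))
    ((continuous_toC.comp Γ.continuous_c).sub continuous_const)
    ((continuous_toC.comp (Γ.continuous_c.comp Γ.continuous_h)).sub continuous_const)
    (Γ.toC_sub_ne_zero hz) (fun x => Γ.toC_sub_ne_zero hz' _) (fun x => ?_) (fun x hx => ?_)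
    (Γ.continuous_angle hz) ((Γ.continuous_angle hz').comp Γ.continuous_h)
    (Γ.angle_polar hz) (fun x => Γ.angle_polar hz' _) (x₀ := M + C)
    ((hM _ hz (le_max_left _ _)).1 _ (by linarith))
    ((hM _ hz' (le_max_right _ _)).1 _ (by linarith [(abs_le.1 (hC (M + C))).1])) x j hx
  · rw [hch]; simp [toC, shift, step]
  · have h2 : (Γ.c x).2 = z.2 := by simpa [toC, sub_eq_zero] using hx
    have e1 : (toC (Γ.c x) - toC z).re = (Γ.c x).1 - z.1 := by simp [toC]
    have e2 : (toC (Γ.c (Γ.h x)) - toC (shift (-Γ.k) (B.step z))).im =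
        B.next (Γ.c x) - B.next z := by rw [hch]; simp [toC, shift, step]
    simp only [e1, e2]
    have hne : (Γ.c x).1 ≠ z.1 := fun h1 =>
      (Γ.region_subset hz).2 (Prod.ext h1 h2 ▸ Γ.c_mem x)
    rcases lt_or_gt_of_ne hne with hlt | hlt
    · have := B.next_lt_next (hcs x) hzs h2 hlt
      exact mul_neg_of_neg_of_pos (by linarith) (by linarith)
    · have := B.next_lt_next hzs (hcs x) h2.symm hlt
      exact mul_neg_of_pos_of_neg (by linarith) (by linarith)

lemma isOpen_exists_angle {V : Set ℝ} (hV : IsOpen V) :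
    IsOpen {z | z ∈ Γ.region ∧ ∃ x, Γ.angle z x ∈ V} := by
  rw [isOpen_iff_mem_nhds]
  rintro z ⟨hz, x, hx⟩
  have hc : ContinuousOn (fun z => Γ.angle z x) Γ.region :=
    Γ.continuousOn_angle.comp (f := fun z : ℝ × ℝ => (z, x)) (by fun_prop) fun z hz => ⟨hz, trivial⟩
  have := (hc.isOpen_inter_preimage Γ.isOpen_region hV).mem_nhds ⟨hz, hx⟩
  filter_upwards [this] with w hw
  exact ⟨hw.1, x, hw.2⟩

lemma isOpen_forall_angle {U : Set ℝ} (hU : IsOpen U) (h1 : ∀ a, |a - π / 4| < π / 4 → a ∈ U)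
    (h2 : ∀ a, |a - 5 * π / 4| < π / 4 → a ∈ U) :
    IsOpen {z | z ∈ Γ.region ∧ ∀ x, Γ.angle z x ∈ U} := by
  rw [isOpen_iff_mem_nhds]
  rintro z ⟨hz, hzU⟩
  obtain ⟨M, hM⟩ := Γ.angle_bound (‖z‖ + 1)
  have hopen := Γ.continuousOn_angle.isOpen_inter_preimage (Γ.isOpen_region.prod isOpen_univ) hU
  have hloc : ∀ᶠ w in nhds z, ∀ x ∈ Icc (-M) M, Γ.angle w x ∈ U := by
    refine isCompact_Icc.eventually_forall_of_forall_eventually fun x _ => ?_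
    have := hopen.mem_nhds (show (z, x) ∈ _ from ⟨⟨hz, trivial⟩, hzU x⟩)
    filter_upwards [this] with p hp
    exact hp.2
  have hball : ∀ᶠ w in nhds z, ‖w‖ < ‖z‖ + 1 :=
    (isOpen_lt continuous_norm continuous_const).mem_nhds (by simp)
  filter_upwards [hloc, hball, Γ.isOpen_region.mem_nhds hz] with w hw1 hw2 hw3
  refine ⟨hw3, fun x => ?_⟩
  by_cases hx1 : x < -M
  · exact h2 _ ((hM w hw3 hw2.le).2 x hx1.le)
  by_cases hx2 : M < x
  · exact h1 _ ((hM w hw3 hw2.le).1 x hx2.le)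
  · exact hw1 x ⟨not_lt.1 hx1, not_lt.1 hx2⟩

/-- The points of the region all of whose translates see every point of the curve at an angle
in `U`. -/
def allAngles (U : Set ℝ) : Set (ℝ × ℝ) :=
  {z | z ∈ Γ.region ∧ ∀ (j : ℤ) x, Γ.angle (shift j z) x ∈ U}

/-- The points of the region with a translate that sees some point of the curve at an angle in `V`.
-/
def someAngle (V : Set ℝ) : Set (ℝ × ℝ) :=
  {z | z ∈ Γ.region ∧ ∃ (j : ℤ) (x : ℝ), Γ.angle (shift j z) x ∈ V}

lemma isOpen_someAngle {V : Set ℝ} (hV : IsOpen V) : IsOpen (Γ.someAngle V) := by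
  have : Γ.someAngle V = ⋃ j : ℤ, shift j ⁻¹' {z | z ∈ Γ.region ∧ ∃ x, Γ.angle z x ∈ V} := by
    ext z
    simp [someAngle, shift_mem_region]
  rw [this]
  exact isOpen_iUnion fun j => (Γ.isOpen_exists_angle hV).preimage (continuous_shift j)

/-- By periodicity, only the translates by `2π i` with `0 ≤ i < n` need to be tested, and for each
of them only a compact interval of parameters. -/
lemma isOpen_allAngles {U : Set ℝ} (hU : IsOpen U) (h1 : ∀ a, |a - π / 4| < π / 4 → a ∈ U)
    (h2 : ∀ a, |a - 5 * π / 4| < π / 4 → a ∈ U) : IsOpen (Γ.allAngles U) := by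
  set S := {z | z ∈ Γ.region ∧ ∀ x, Γ.angle z x ∈ U} with hS
  have hper : ∀ (z : ℝ × ℝ) (m : ℤ), shift (m * Γ.n) z ∈ S ↔ z ∈ S := by
    have h1 : ∀ z, shift Γ.n z ∈ S ↔ z ∈ S := by
      intro z
      simp only [hS, mem_ofPred_eq, shift_mem_region]
      refine and_congr_right fun hz => ⟨fun h x => ?_, fun h x => ?_⟩
      · rw [← Γ.angle_shift hz]; exact h _
      · have := Γ.angle_shift hz (x - Γ.n * (2 * π))
        rw [sub_add_cancel] at this
        rw [this]; exact h _
    intro z m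
    induction m using Int.induction_on with
    | zero => rw [zero_mul, shift_zero]
    | succ m ih =>
      rw [add_mul, one_mul, add_comm, ← shift_shift, h1]
      exact ih
    | pred m ih =>
      rw [← h1, shift_shift, sub_mul, one_mul, add_sub_cancel]
      exact ih
  have hn : (0 : ℤ) < Γ.n := by exact_mod_cast Γ.n_pos
  have : Γ.allAngles U = ⋂ i ∈ Finset.range Γ.n, shift (i : ℤ) ⁻¹' S := by
    ext z
    simp only [allAngles, mem_ofPred_eq, mem_iInter, Finset.mem_range, mem_preimage]
    constructor
    · rintro ⟨hz, h⟩ i -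
      exact ⟨(Γ.shift_mem_region _ _).2 hz, h i⟩
    · intro h
      refine ⟨(Γ.shift_mem_region _ _).1 (h 0 Γ.n_pos).1, fun j => ?_⟩
      have hm := Int.emod_nonneg j hn.ne'
      have hl := Int.emod_lt_of_pos j hn
      have h3 := h (j % Γ.n).toNat (by omega)
      rw [Int.toNat_of_nonneg hm, ← hper _ (j / Γ.n), shift_shift] at h3
      rw [mul_comm, Int.mul_ediv_add_emod] at h3
      exact h3.2
  rw [this]
  exact isOpen_biInter_finset fun i _ =>
    (Γ.isOpen_forall_angle hU h1 h2).preimage (continuous_shift _)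

lemma allAngles_periodic (U : Set ℝ) (x y : ℝ) :
    (x + 2 * π, y + 2 * π) ∈ Γ.allAngles U ↔ (x, y) ∈ Γ.allAngles U := by
  have e : ((x + 2 * π, y + 2 * π) : ℝ × ℝ) = shift 1 (x, y) := by simp [shift]
  rw [e]
  simp only [allAngles, mem_ofPred_eq, shift_mem_region, shift_shift]
  refine and_congr_right fun _ => ⟨fun h j => ?_, fun h j => h _⟩
  simpa using h (j - 1)

lemma image_periodic {f : ℝ × ℝ → ℝ × ℝ} {E : Set (ℝ × ℝ)}
    (hE : ∀ x y, (x + 2 * π, y + 2 * π) ∈ E ↔ (x, y) ∈ E)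
    (hf : ∀ (j : ℤ), ∀ p ∈ E, f (shift j p) = shift j (f p)) (x y : ℝ) :
    (x + 2 * π, y + 2 * π) ∈ f '' E ↔ (x, y) ∈ f '' E := by
  have e : ((x + 2 * π, y + 2 * π) : ℝ × ℝ) = shift 1 (x, y) := by simp [shift]
  rw [e]
  constructor
  · rintro ⟨p, hp, hpe⟩
    refine ⟨shift (-1) p, (shift_mem_iff hE _ _).2 hp, ?_⟩
    rw [hf _ p hp, hpe, shift_shift, neg_add_cancel, shift_zero]
  · rintro ⟨p, hp, hpe⟩
    exact ⟨shift 1 p, (shift_mem_iff hE _ _).2 hp, by rw [hf _ p hp, hpe]⟩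

lemma density_add_add (x y : ℝ) : B.density (x + 2 * π) (y + 2 * π) = B.density x y := by
  rw [density_add_two_pi, density_add_two_pi_left]

lemma collar_mem_allAngles {U : Set ℝ} (hU : Ioo (π / 4) (5 * π / 4) ⊆ U) :
    ((0 : ℝ), Γ.gap / 2) ∈ Γ.allAngles U := by
  refine ⟨Γ.collar_subset_region Γ.base_mem, fun j x => hU (Γ.angle_collar ?_ x)⟩
  have := Γ.base_mem
  simp only [collar, shift, mem_ofPred_eq] at this ⊢
  constructor <;> linarith [this.1, this.2]

/-- No point of the region sees the curve at an angle `≤ -π / 2`. -/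
theorem region_subset_allAngles_Ioi : Γ.region ⊆ Γ.allAngles (Ioi (-(π / 2))) := by
  have hpi := Real.pi_pos
  have hE : IsOpen (Γ.allAngles (Ioi (-(π / 2)))) := by
    refine Γ.isOpen_allAngles isOpen_Ioi (fun a ha => ?_) (fun a ha => ?_) <;>
    · rw [abs_lt] at ha
      exact mem_Ioi.2 (by linarith [ha.1])
  have hs : Γ.allAngles (Ioi (-(π / 2))) ⊆ B.strip := fun p hp => (Γ.region_subset hp.1).1
  refine Γ.region_subset_of_area Γ.step_region hE
    (Γ.isOpen_someAngle (V := Iio (-(π / 2))) isOpen_Iio)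
    (fun p hp => hp.1) ⟨_, Γ.collar_mem_allAngles fun a ha => mem_Ioi.2 (by linarith [ha.1])⟩ ?_ ?_
    (B.isOpen_image_step hE hs) (Γ.allAngles_periodic _)
    (image_periodic (Γ.allAngles_periodic _) fun j p hp => B.step_shift j (hs hp))
    (B.area_image_step le_rfl hs (Γ.allAngles_periodic _) density_add_add hE)
  · rw [Set.disjoint_left]
    rintro z ⟨hz, h⟩ ⟨-, j, x, hjx⟩
    exact lt_asymm (mem_Ioi.1 (h j x)) hjx
  · intro p hp hpE
    have : ∃ (j : ℤ) (x : ℝ), Γ.angle (shift j p) x ≤ -(π / 2) := by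
      by_contra! hcon
      exact hpE ⟨hp, hcon⟩
    obtain ⟨j, x, hjx⟩ := this
    refine ⟨by rw [← Γ.step_region]; exact ⟨p, hp, rfl⟩, -Γ.k + j, Γ.h x, ?_⟩
    have h := Γ.angle_step_lt ((Γ.shift_mem_region j p).2 hp) x (-1)
      (by push_cast; linarith)
    rw [B.step_shift j (Γ.region_subset hp).1, shift_shift] at h
    push_cast at h
    exact mem_Iio.2 (by linarith)

/-- No point of the region sees the curve at an angle `≥ 3π / 2`, by the argument for the inverse
map. -/
theorem region_subset_allAngles_Iio : Γ.region ⊆ Γ.allAngles (Iio (3 * π / 2)) := by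
  have hpi := Real.pi_pos
  have hE : IsOpen (Γ.allAngles (Iio (3 * π / 2))) := by
    refine Γ.isOpen_allAngles isOpen_Iio (fun a ha => ?_) (fun a ha => ?_) <;>
    · rw [abs_lt] at ha
      exact mem_Iio.2 (by linarith [ha.2])
  have hs : Γ.allAngles (Iio (3 * π / 2)) ⊆ B.strip := fun p hp => (Γ.region_subset hp.1).1
  have hper := image_periodic (Γ.allAngles_periodic (Iio (3 * π / 2)))
    fun j p hp => B.stepInv_shift j (hs hp)
  have hop := B.isOpen_image_stepInv hE hs
  have hs' : B.stepInv '' Γ.allAngles (Iio (3 * π / 2)) ⊆ B.strip := by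
    rintro _ ⟨p, hp, rfl⟩; exact B.stepInv_mem (hs hp)
  refine Γ.region_subset_of_area Γ.stepInv_region hE
    (Γ.isOpen_someAngle (V := Ioi (3 * π / 2)) isOpen_Ioi)
    (fun p hp => hp.1) ⟨_, Γ.collar_mem_allAngles fun a ha => mem_Iio.2 (by linarith [ha.2])⟩ ?_ ?_
    hop (Γ.allAngles_periodic _) hper ?_
  · rw [Set.disjoint_left]
    rintro z ⟨hz, h⟩ ⟨-, j, x, hjx⟩
    exact lt_asymm (mem_Iio.1 (h j x)) hjx
  · intro p hp hpE
    have : ∃ (j : ℤ) (x : ℝ), 3 * π / 2 ≤ Γ.angle (shift j p) x := by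
      by_contra! hcon
      exact hpE ⟨hp, hcon⟩
    obtain ⟨j, x', hjx⟩ := this
    obtain ⟨x, rfl⟩ := Γ.surjective_h x'
    have hps := (Γ.region_subset hp).1
    have hq : B.stepInv p ∈ Γ.region := by rw [← Γ.stepInv_region]; exact ⟨p, hp, rfl⟩
    refine ⟨hq, Γ.k + j, x, ?_⟩
    by_contra hcon
    have h := Γ.angle_step_lt ((Γ.shift_mem_region (Γ.k + j) _).2 hq) x 1
      (by push_cast; linarith [not_lt.1 (mt mem_Ioi.2 hcon)])
    rw [B.step_shift _ (B.stepInv_mem hps), B.step_stepInv hps, shift_shift,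
      neg_add_cancel_left] at h
    push_cast at h
    linarith
  · have h := B.area_image_step le_rfl hs' hper density_add_add hop
    rw [← h, image_image, image_congr (fun q hq => B.step_stepInv (hs hq)), image_id']

/-- No point of the curve lies vertically below a point of the region: it would be seen in the
direction `-π / 2`, which has no argument in `(-π / 2, 3π / 2)`. -/
theorem not_mem_carrier_of_lt {x y y' : ℝ} (h : (x, y) ∈ Γ.region) (hy : y' < y) :
    (x, y') ∉ Γ.carrier := by
  intro hc
  have hpi := Real.pi_pos
  obtain ⟨s, j, he⟩ := Γ.exists_eq _ hc
  have h1 := (Γ.region_subset_allAngles_Ioi h).2 (-j) s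
  have h2 := (Γ.region_subset_allAngles_Iio h).2 (-j) s
  obtain ⟨hr, hi⟩ := re_im_of_polar (Γ.angle_polar ((Γ.shift_mem_region (-j) _).2 h) s)
  have hn := norm_pos_iff.2 (Γ.toC_sub_ne_zero ((Γ.shift_mem_region (-j) _).2 h) s)
  obtain ⟨e1, e2⟩ := Prod.mk.inj he
  have hre : (toC (Γ.c s) - toC (shift (-j) (x, y))).re = 0 := by
    simp only [toC, shift, Complex.sub_re]; push_cast; linarith
  have him : (toC (Γ.c s) - toC (shift (-j) (x, y))).im < 0 := by
    simp only [toC, shift, Complex.sub_im]; push_cast; linarith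
  rw [hre] at hr
  rw [hi] at him
  simp only [mem_Ioi, mem_Iio] at h1 h2
  generalize Γ.angle (shift (-j) (x, y)) s = a at *
  have hcos : Real.cos a = 0 := (mul_eq_zero.1 hr.symm).resolve_left hn.ne'
  have hsin : Real.sin a < 0 := neg_of_mul_neg_right him hn.le
  rcases lt_trichotomy a (π / 2) with hlt | heq | hgt
  · have := Real.cos_pos_of_mem_Ioo ⟨h1, hlt⟩; linarith
  · rw [heq, Real.sin_pi_div_two] at hsin; linarith
  · have := Real.cos_neg_of_pi_div_two_lt_of_lt hgt (by linarith); linarith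

theorem region_downward {x y y' : ℝ} (h : (x, y) ∈ Γ.region) (h1 : x < y') (h2 : y' < y) :
    (x, y') ∈ Γ.region := by
  have hs := B.mem_strip.1 (Γ.region_subset h).1
  refine Γ.subset_region (S := (fun t => (x, t)) '' Ioc x y) (isPreconnected_Ioc.image _
    (by fun_prop)) ?_ (p := (x, y)) ⟨y, ⟨hs.1, le_rfl⟩, rfl⟩ h ⟨y', ⟨h1, h2.le⟩, rfl⟩
  rintro _ ⟨t, ht, rfl⟩
  refine ⟨B.mem_strip.2 ⟨ht.1, ht.2.trans_lt hs.2⟩, ?_⟩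
  rcases ht.2.eq_or_lt with rfl | hlt
  · exact (Γ.region_subset h).2
  · exact Γ.not_mem_carrier_of_lt h hlt

end LiftedCurve

/-! ### The boundary graph and points of zero curvature -/

lemma det2_eq_zero_of_parallel {a b c : Plane} (ha : a ≠ 0) (hb : det2 a b = 0)
    (hc : det2 a c = 0) : det2 b c = 0 := by
  simp only [det2] at *
  have h : a 0 ≠ 0 ∨ a 1 ≠ 0 := by
    by_contra! h
    apply ha
    ext i; fin_cases i
    · simpa using h.1
    · simpa using h.2
  rcases h with h | h
  · apply mul_left_cancel₀ h
    linear_combination b 0 * hc - c 0 * hb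
  · apply mul_left_cancel₀ h
    linear_combination b 1 * hc - c 1 * hb

namespace Table

variable (B : Table)

lemma mul_sub_le_height {y u v m : ℝ} (huv : u ≤ v) (h : ∀ w ∈ Icc u v, m ≤ B.density y w) :
    m * (v - u) ≤ B.height y v - B.height y u := by
  refine (convex_Icc u v).mul_sub_le_image_sub_of_le_deriv
    (B.continuous_height_right y).continuousOn
    (fun w _ => (B.hasDerivAt_height y w).differentiableAt.differentiableWithinAt)
    (fun w hw => ?_) u (left_mem_Icc.2 huv) v (right_mem_Icc.2 huv) huv
  rw [(B.hasDerivAt_height y w).deriv]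
  exact h w (interior_subset hw)

lemma hasDerivAt_height_left (x u v : ℝ) :
    HasDerivAt (fun t => B.height t u - B.height t v)
      (det2 (deriv B.vel x) (B.pos u - B.pos v)) x := by
  have hd : HasDerivAt B.vel (deriv B.vel x) x :=
    (B.contDiff_vel.differentiable (by norm_num) x).hasDerivAt
  have hc : ∀ i, HasDerivAt (fun y : ℝ => B.vel y i) (deriv B.vel x i) x :=
    fun i => (EuclideanSpace.proj (𝕜 := ℝ) i).hasFDerivAt.comp_hasDerivAt x hd
  have := ((hc 0).mul_const ((B.pos u - B.pos v) 1)).sub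
    ((hc 1).mul_const ((B.pos u - B.pos v) 0))
  refine this.congr_of_eventuallyEq (Filter.Eventually.of_forall fun t => ?_)
  simp only [height, det2, PiLp.sub_apply, Pi.sub_apply]; ring

end Table

namespace LiftedCurve

open Table Filter Topology

variable {B : Table} (Γ : LiftedCurve B)

/-- The function whose graph bounds the region from above. -/
def upper (x : ℝ) : ℝ := sSup {y | (x, y) ∈ Γ.region}

/-- The points of the region over `x` lie below a point of the strip, namely any point of the
curve. -/
lemma exists_fiber_bound (x : ℝ) :
    ∃ Y, (x, Y) ∈ B.strip ∧ ∀ y, (x, y) ∈ Γ.region → y < Y := by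
  obtain ⟨Y, hY⟩ := Γ.exists_mem_fiber x
  refine ⟨Y, Γ.sub_strip hY, fun y hy => ?_⟩
  by_contra hcon
  rcases (not_lt.1 hcon).eq_or_lt with rfl | hlt
  · exact (Γ.region_subset hy).2 hY
  · exact Γ.not_mem_carrier_of_lt hy hlt hY

lemma bddAbove_fiber (x : ℝ) : BddAbove {y | (x, y) ∈ Γ.region} := by
  obtain ⟨Y, -, h⟩ := Γ.exists_fiber_bound x
  exact ⟨Y, fun y hy => (h y hy).le⟩

lemma collar_fiber (x : ℝ) : (x, x + Γ.gap / 2) ∈ Γ.region := by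
  have := Γ.gap_pos
  exact Γ.collar_subset_region ⟨by simp only; linarith, by simp only; linarith⟩

lemma lt_upper (x : ℝ) : x < Γ.upper x := by
  have := Γ.gap_pos
  have := le_csSup (Γ.bddAbove_fiber x) (Γ.collar_fiber x)
  unfold upper
  linarith

lemma upper_mem (x : ℝ) : (x, Γ.upper x) ∈ B.strip := by
  obtain ⟨Y, hY, h⟩ := Γ.exists_fiber_bound x
  have : Γ.upper x ≤ Y := csSup_le ⟨_, Γ.collar_fiber x⟩ fun y hy => (h y hy).le
  exact B.mem_strip.2 ⟨Γ.lt_upper x, this.trans_lt (B.mem_strip.1 hY).2⟩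

lemma mem_region_iff {x y : ℝ} : (x, y) ∈ Γ.region ↔ x < y ∧ y < Γ.upper x := by
  constructor
  · intro h
    refine ⟨(Γ.region_subset h).1.1, ?_⟩
    have hc : Continuous fun t : ℝ => (x, t) := by fun_prop
    have hev := (hc.tendsto y).eventually (Γ.isOpen_region.mem_nhds h)
    obtain ⟨t, ht, hlt⟩ := ((hev.filter_mono (nhdsWithin_le_nhds (s := Ioi y))).and
      self_mem_nhdsWithin).exists
    exact (mem_Ioi.1 hlt).trans_le (le_csSup (Γ.bddAbove_fiber x) ht)
  · rintro ⟨h1, h2⟩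
    obtain ⟨t, ht, hlt⟩ := exists_lt_of_lt_csSup (s := {y | (x, y) ∈ Γ.region})
      ⟨_, Γ.collar_fiber x⟩ h2
    exact Γ.region_downward ht h1 hlt

/-- The parameter of the bounce before `(y, upper y)`. -/
def lower (y : ℝ) : ℝ := B.prev (y, Γ.upper y)

lemma lower_mem (y : ℝ) : (Γ.lower y, y) ∈ B.strip := B.prev_mem (Γ.upper_mem y)

lemma height_lower (y : ℝ) : B.height y (Γ.lower y) = B.height y (Γ.upper y) :=
  B.height_prev (Γ.upper_mem y)

lemma step_mem_region {p : ℝ × ℝ} (hp : p ∈ B.strip) : B.step p ∈ Γ.region ↔ p ∈ Γ.region := by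
  constructor
  · intro h
    rw [← Γ.stepInv_region]
    exact ⟨_, h, B.stepInv_step hp⟩
  · intro h
    rw [← Γ.step_region]
    exact ⟨_, h, rfl⟩

/-- The functions `upper` and `lower` form a Galois connection; this is the invariance of the
region. -/
lemma lt_upper_iff {x y : ℝ} (h : (x, y) ∈ B.strip) : y < Γ.upper x ↔ Γ.lower y < x := by
  have hn := B.next_mem h
  have hh := B.height_next h
  simp only at hn hh
  have h1 : y < Γ.upper x ↔ (x, y) ∈ Γ.region := by
    rw [mem_region_iff]; exact ⟨fun h' => ⟨h.1, h'⟩, fun h' => h'.2⟩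
  have h2 : B.step (x, y) ∈ Γ.region ↔ B.next (x, y) < Γ.upper y := by
    change (y, B.next (x, y)) ∈ Γ.region ↔ _
    rw [mem_region_iff]; exact ⟨fun h' => h'.2, fun h' => ⟨hn.1, h'⟩⟩
  rw [h1, ← Γ.step_mem_region h, h2, ← B.height_lt_of_lt hn (Γ.upper_mem y), hh,
    ← Γ.height_lower, B.height_lt_of_gt h (Γ.lower_mem y)]

lemma monotone_upper : Monotone Γ.upper := by
  intro x x' hxx
  rcases hxx.eq_or_lt with rfl | hlt
  · exact le_rfl
  by_contra hcon
  have hcon := not_le.1 hcon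
  have h1 := Γ.upper_mem x'
  have h2 : (x, Γ.upper x') ∈ B.strip :=
    B.mem_strip.2 ⟨hlt.trans (Γ.lt_upper x'), hcon.trans (B.mem_strip.1 (Γ.upper_mem x)).2⟩
  have h3 := (Γ.lt_upper_iff h2).1 hcon
  exact lt_irrefl _ ((Γ.lt_upper_iff h1).2 (h3.trans hlt))

lemma monotone_lower : Monotone Γ.lower := by
  intro y y' hyy
  rcases hyy.eq_or_lt with rfl | hlt
  · exact le_rfl
  by_contra hcon
  have hcon := not_le.1 hcon
  have h1 := Γ.lower_mem y
  have h2 : (Γ.lower y, y') ∈ B.strip :=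
    B.mem_strip'.2 ⟨(B.mem_strip'.1 (Γ.lower_mem y')).1.trans hcon,
      (B.mem_strip'.1 h1).2.trans hlt⟩
  have h3 := (Γ.lt_upper_iff h2).2 hcon
  exact lt_irrefl _ ((Γ.lt_upper_iff h1).1 (hlt.trans h3))

lemma eventually_mem_strip {x y : ℝ} (h : (x, y) ∈ B.strip) :
    (∀ᶠ t in 𝓝 x, (t, y) ∈ B.strip) ∧ ∀ᶠ t in 𝓝 y, (x, t) ∈ B.strip := by
  have hc : Continuous fun t : ℝ => (x, t) := by fun_prop
  have hc' : Continuous fun t : ℝ => (t, y) := by fun_prop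
  exact ⟨(hc'.tendsto x).eventually (B.isOpen_strip.mem_nhds h),
    (hc.tendsto y).eventually (B.isOpen_strip.mem_nhds h)⟩

lemma continuous_height_left (u : ℝ) : Continuous fun t => B.height t u :=
  B.continuous_height.comp (by fun_prop : Continuous fun t : ℝ => (t, u))

/-- Right continuity of `upper`, from the monotonicity of `lower`. -/
lemma tendsto_upper (t : ℝ) : Tendsto Γ.upper (𝓝[>] t) (𝓝 (Γ.upper t)) := by
  rw [tendsto_order]
  constructor
  · intro a ha
    filter_upwards [self_mem_nhdsWithin] with t' ht'
    exact ha.trans_le (Γ.monotone_upper (mem_Ioi.1 ht').le)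
  · intro a ha
    have hg := Γ.upper_mem t
    obtain ⟨b, hb, hb'⟩ := (((eventually_mem_strip hg).2.filter_mono
      (nhdsWithin_le_nhds (s := Ioi _))).and (Ioo_mem_nhdsGT ha)).exists
    have hlt := (B.height_lt_of_lt hg hb).2 hb'.1
    rw [← Γ.height_lower] at hlt
    have hev : ∀ᶠ s in 𝓝 t, B.height s (Γ.lower t) < B.height s b :=
      (isOpen_lt (continuous_height_left (B := B) (Γ.lower t))
      (continuous_height_left (B := B) b)).mem_nhds hlt
    have hall := (hev.and ((eventually_mem_strip hb).1.and
      (eventually_mem_strip (Γ.lower_mem t)).2)).filter_mono (nhdsWithin_le_nhds (s := Ioi t))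
    filter_upwards [hall, self_mem_nhdsWithin] with t' ⟨h1, h2, h3⟩ ht'
    have h4 := Γ.monotone_lower (mem_Ioi.1 ht').le
    have h5 : B.height t' (Γ.lower t') ≤ B.height t' (Γ.lower t) := by
      rw [← not_lt, B.height_lt_of_gt h3 (Γ.lower_mem t')]; exact h4.not_gt
    rw [Γ.height_lower] at h5
    exact ((B.height_lt_of_lt (Γ.upper_mem t') h2).1 (h5.trans_lt h1)).trans hb'.2

/-- By the Galois connection `lower (upper t) < t` is impossible, and `lower s < t` for
`s < upper t`; the latter passes to the limit, in terms of heights. -/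
lemma lower_upper (t : ℝ) : Γ.lower (Γ.upper t) = t := by
  set y := Γ.upper t with hy
  have hty : (t, y) ∈ B.strip := Γ.upper_mem t
  refine le_antisymm ?_ (not_lt.1 fun h => lt_irrefl _ ((Γ.lt_upper_iff hty).2 h))
  by_contra hcon
  have hlt : B.height y (Γ.upper y) < B.height y t := by
    rw [← Γ.height_lower, B.height_lt_of_gt (Γ.lower_mem y) hty]; exact not_le.1 hcon
  have hev : ∀ᶠ s in 𝓝 y, B.height s (Γ.upper y) < B.height s t :=
    (isOpen_lt (continuous_height_left (B := B) (Γ.upper y))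
    (continuous_height_left (B := B) t)).mem_nhds hlt
  have hall := (hev.and ((eventually_mem_strip hty).2.and
    (eventually_mem_strip (Γ.upper_mem y)).1)).filter_mono (nhdsWithin_le_nhds (s := Iio y))
  obtain ⟨s, ⟨h1, h2, h3⟩, hs⟩ := (hall.and self_mem_nhdsWithin).exists
  have h4 := (Γ.lt_upper_iff h2).1 (mem_Iio.1 hs)
  have h5 := (B.height_lt_of_gt h2 (Γ.lower_mem s)).2 h4
  rw [Γ.height_lower] at h5
  have h6 : B.height s (Γ.upper s) ≤ B.height s (Γ.upper y) := by
    rw [← not_lt, B.height_lt_of_lt h3 (Γ.upper_mem s)]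
    exact (Γ.monotone_upper (mem_Iio.1 hs).le).not_gt
  change B.height s (Γ.upper y) < B.height s t at h1
  linarith

/-- A lifted invariant curve excludes points where `γ''` is parallel to `γ'`: there `upper` would
have right derivative zero, whereas `upper t - upper t₀` is bounded below by a positive multiple of
`t - t₀` for `t` slightly larger than `t₀`. -/
theorem false_of_parallel (Γ : LiftedCurve B) {t₀ : ℝ}
    (h0 : det2 (B.vel t₀) (deriv B.vel t₀) = 0) : False := by
  set y₀ := Γ.upper t₀ with hy₀
  have hst : (t₀, y₀) ∈ B.strip := Γ.upper_mem t₀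
  have hdpos : 0 < B.density t₀ y₀ := hst.2.2
  set m := B.density t₀ y₀ / 2 with hm
  have hm0 : 0 < m := by positivity
  have hnear : ∀ᶠ p in 𝓝 (t₀, y₀), m < B.density p.1 p.2 :=
    (isOpen_lt continuous_const B.continuous_density).mem_nhds
      (by change m < B.density t₀ y₀; linarith)
  rw [nhds_prod_eq, eventually_prod_iff] at hnear
  obtain ⟨p₁, hp₁, p₂, hp₂, hp⟩ := hnear
  obtain ⟨e₁, he₁, hI₁⟩ := Metric.eventually_nhds_iff.1 hp₁
  obtain ⟨e₂, he₂, hI₂⟩ := Metric.eventually_nhds_iff.1 hp₂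
  -- the chord from `lower t₀` to `upper t₀` is parallel to `γ' t₀`, hence to `γ'' t₀`, so this
  -- difference of heights has vanishing derivative at `t₀`
  have hD := B.hasDerivAt_height_left t₀ y₀ (Γ.lower t₀)
  have hchord : det2 (B.vel t₀) (B.pos y₀ - B.pos (Γ.lower t₀)) = 0 := by
    rw [det2_sub_right]
    have := Γ.height_lower t₀
    simp only [height] at this
    linarith
  rw [det2_eq_zero_of_parallel (B.regular _) h0 hchord] at hD
  have hD0 : B.height t₀ y₀ - B.height t₀ (Γ.lower t₀) = 0 := by rw [Γ.height_lower]; ring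
  have hD' := hD.isLittleO
  simp only [hD0, smul_zero, sub_zero] at hD'
  have hE := B.hasDerivAt_height_left y₀ (Γ.upper y₀) t₀
  have hE0 : B.height y₀ (Γ.upper y₀) - B.height y₀ t₀ = 0 := by
    rw [← Γ.height_lower, Γ.lower_upper]; ring
  have hE' := hE.isBigO_sub
  simp only [hE0, sub_zero] at hE'
  obtain ⟨K, hK0, hK⟩ := hE'.exists_pos
  have hup := Γ.tendsto_upper t₀
  have ev1 := (hD'.def (show 0 < m ^ 2 / (2 * K) by positivity)).filter_mono
    (nhdsWithin_le_nhds (s := Ioi t₀))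
  have ev2 := hup.eventually hK.bound
  have ev4 := hup.eventually (eventually_mem_strip (Γ.upper_mem y₀)).1
  have ev6 : Metric.ball t₀ e₁ ∈ 𝓝[>] t₀ :=
    mem_nhdsWithin_of_mem_nhds (Metric.ball_mem_nhds t₀ he₁)
  have ev7 := hup.eventually (Metric.ball_mem_nhds y₀ he₂)
  have ev8 := (eventually_mem_strip (Γ.lower_mem t₀)).2.filter_mono
    (nhdsWithin_le_nhds (s := Ioi t₀))
  obtain ⟨t, h1, h2, h4, h6, h7, h8, ht⟩ := (ev1.and (ev2.and (ev4.and
    ((eventually_of_mem ev6 fun _ h => h).and (ev7.and (ev8.and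
      (self_mem_nhdsWithin (s := Ioi t₀)))))))).exists
  have ht : t₀ < t := ht
  set y := Γ.upper t with hy
  have hyy : y₀ ≤ y := Γ.monotone_upper ht.le
  have hst' : (t, y) ∈ B.strip := Γ.upper_mem t
  -- `s1` to `s3`: flatness of `upper` at `t₀`
  have s1 : m * (y - y₀) ≤ B.height t y - B.height t y₀ := by
    refine B.mul_sub_le_height hyy fun w hw => (hp (hI₁ h6) (hI₂ ?_)).le
    rw [Real.dist_eq, abs_of_nonneg (by linarith)] at h7
    rw [Real.dist_eq, abs_of_nonneg (by linarith [hw.1])]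
    linarith [hw.2]
  have s2 : B.height t y ≤ B.height t (Γ.lower t₀) := by
    rw [hy, ← Γ.height_lower, ← not_lt, B.height_lt_of_gt h8 (Γ.lower_mem t)]
    exact (Γ.monotone_lower ht.le).not_gt
  have s3 : m * (y - y₀) ≤ m ^ 2 / (2 * K) * (t - t₀) := by
    rw [Real.norm_eq_abs, Real.norm_eq_abs, abs_of_pos (sub_pos.2 ht)] at h1
    have := neg_abs_le (B.height t y₀ - B.height t (Γ.lower t₀))
    linarith
  -- `s4` to `s7`: the linear lower bound, from the comparison at the next bounce
  have s4 : m * (t - t₀) ≤ B.height y t₀ - B.height y t := by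
    have h := B.mul_sub_le_height (y := y) (u := t₀) (v := t) (m := m) ht.le
    have hh : ∀ w ∈ Icc t₀ t, m < B.density w y := by
      intro w hw
      refine hp (hI₁ ?_) (hI₂ h7)
      rw [Metric.mem_ball, Real.dist_eq, abs_of_nonneg (by linarith)] at h6
      rw [Real.dist_eq, abs_of_nonneg (by linarith [hw.1])]
      linarith [hw.2]
    have h' := (convex_Icc t₀ t).image_sub_le_mul_sub_of_deriv_le (f := B.height y) (C := -m)
      (B.continuous_height_right y).continuousOn
      (fun w _ => (B.hasDerivAt_height y w).differentiableAt.differentiableWithinAt)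
      (fun w hw => by
        rw [(B.hasDerivAt_height y w).deriv, density_swap]
        linarith [hh w (interior_subset hw)]) t₀ (left_mem_Icc.2 ht.le) t (right_mem_Icc.2 ht.le)
      ht.le
    linarith
  have s5 : B.height y (Γ.upper y) ≤ B.height y t := by
    rw [← Γ.height_lower, ← not_lt, B.height_lt_of_gt hst' (Γ.lower_mem y), Γ.lower_upper]
    exact lt_irrefl _
  have s6 : B.height y (Γ.upper y₀) ≤ B.height y (Γ.upper y) := by
    rw [← not_lt, B.height_lt_of_lt (Γ.upper_mem y) h4]
    exact (Γ.monotone_upper hyy).not_gt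
  have s7 : m * (t - t₀) ≤ K * (y - y₀) := by
    rw [Real.norm_eq_abs, Real.norm_eq_abs, abs_of_nonneg (sub_nonneg.2 hyy)] at h2
    have := neg_abs_le (B.height y (Γ.upper y₀) - B.height y t₀)
    linarith
  have s8 : m * (m * (t - t₀)) ≤ m ^ 2 / 2 * (t - t₀) := by
    calc m * (m * (t - t₀)) ≤ m * (K * (y - y₀)) := by gcongr
      _ = K * (m * (y - y₀)) := by ring
      _ ≤ K * (m ^ 2 / (2 * K) * (t - t₀)) := by gcongr
      _ = _ := by field_simp
  nlinarith [mul_pos (pow_pos hm0 2) (sub_pos.2 ht)]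

end LiftedCurve

/-! ### The phase space in the cylinder -/

instance : Fact (0 < 2 * π) := ⟨Real.two_pi_pos⟩

lemma coe_eq_coe_iff {x y : ℝ} : (x : Circ) = (y : Circ) ↔ ∃ j : ℤ, y = x + j * (2 * π) := by
  rw [eq_comm, ← sub_eq_zero, ← AddCircle.coe_sub, AddCircle.coe_eq_zero_iff]
  constructor
  · rintro ⟨j, hj⟩
    exact ⟨j, by rw [zsmul_eq_mul] at hj; linarith⟩
  · rintro ⟨j, hj⟩
    exact ⟨j, by rw [zsmul_eq_mul]; linarith⟩

lemma coe_add_int_mul (x : ℝ) (j : ℤ) : ((x + j * (2 * π) : ℝ) : Circ) = (x : Circ) :=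
  (coe_eq_coe_iff.2 ⟨j, rfl⟩).symm

lemma exists_lift_of_continuous {f : ℝ → Circ} (hf : Continuous f) :
    ∃ a : ℝ → ℝ, Continuous a ∧ ∀ s, (a s : Circ) = f s := by
  obtain ⟨e, he⟩ := QuotientAddGroup.mk_surjective (f 0)
  obtain ⟨F, ⟨-, hF⟩, -⟩ := (AddCircle.isCoveringMap_coe (2 * π)).existsUnique_continuousMap_lifts
    ⟨f, hf⟩ 0 e he
  exact ⟨F, F.continuous, fun s => congrFun hF s⟩

namespace Table

variable (B : Table)

/-- The phase space coordinates `(t, s)` of the point `(x, y)` of the strip. -/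
def chart (p : ℝ × ℝ) : Circ × ℝ := B.φ ((p.1 : Circ), (p.2 : Circ))

lemma chart_eq (p : ℝ × ℝ) :
    B.chart p = ((p.1 : Circ), det2 (B.vel p.1) B.O - B.height p.1 p.2) := by
  simp only [chart, φ, det2_sub_right, height, vel, pos, neg_sub]

lemma continuous_chart : Continuous B.chart := by
  have h1 := B.continuous_vel
  have h2 := B.continuous_height
  have h3 : Continuous fun p : ℝ × ℝ => ((p.1 : ℝ) : Circ) :=
    (AddCircle.continuous_mk' _).comp continuous_fst
  rw [show B.chart = _ from funext B.chart_eq]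
  unfold det2
  fun_prop

lemma posAdmissible_of_mem {x y : ℝ} (h : (x, y) ∈ B.strip) :
    B.PosAdmissible (x : Circ) (y : Circ) := by
  rw [mem_strip] at h
  exact ⟨x, B.opp x, y, rfl, rfl, B.isOpposite_opp x, B.lt_opp x, B.opp_lt x, h.1, h.2⟩

lemma exists_mem_of_posAdmissible {x : ℝ} {t : Circ} (h : B.PosAdmissible (x : Circ) t) :
    ∃ y : ℝ, (x, y) ∈ B.strip ∧ (y : Circ) = t := by
  obtain ⟨y, hy, rfl⟩ := PosAdmissible.exists_mem_Ioo B (B.isOpposite_opp x) (B.lt_opp x)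
    (B.opp_lt x) h
  exact ⟨y, B.mem_strip.2 hy, rfl⟩

lemma chart_mem {p : ℝ × ℝ} (hp : p ∈ B.strip) : B.chart p ∈ B.Phase :=
  ⟨_, B.posAdmissible_of_mem hp, rfl⟩

lemma exists_chart {z : Circ × ℝ} (hz : z ∈ B.Phase) {x : ℝ} (hx : (x : Circ) = z.1) :
    ∃ y, (x, y) ∈ B.strip ∧ B.chart (x, y) = z := by
  obtain ⟨⟨t, u⟩, hp, rfl⟩ := hz
  obtain rfl : (x : Circ) = t := hx
  obtain ⟨y, hy, rfl⟩ := B.exists_mem_of_posAdmissible hp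
  exact ⟨y, hy, rfl⟩

lemma chart_shift (j : ℤ) (p : ℝ × ℝ) : B.chart (shift j p) = B.chart p := by
  simp only [chart, shift, coe_add_int_mul]

lemma exists_shift_of_chart_eq {p q : ℝ × ℝ} (hp : p ∈ B.strip) (hq : q ∈ B.strip)
    (h : B.chart p = B.chart q) : ∃ j : ℤ, q = shift j p := by
  have h1 := congrArg Prod.fst h
  obtain ⟨j, hj⟩ := coe_eq_coe_iff.1 h1
  refine ⟨j, Prod.ext hj ?_⟩
  have hp' := (B.shift_mem_strip j p).2 hp
  rw [← B.chart_shift j p, chart_eq, chart_eq, Prod.mk.injEq] at h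
  have e : (shift j p).1 = q.1 := hj.symm
  have h2 := h.2
  rw [e] at h2
  have hp'' : (q.1, (shift j p).2) ∈ B.strip := by rw [← e]; exact hp'
  exact (B.eq_of_height_eq hp'' hq (by linarith)).symm

lemma image_chart : B.chart '' B.strip = B.Phase := by
  apply subset_antisymm
  · rintro _ ⟨p, hp, rfl⟩
    exact B.chart_mem hp
  · intro z hz
    obtain ⟨x, hx⟩ := QuotientAddGroup.mk_surjective z.1
    obtain ⟨y, hy, rfl⟩ := B.exists_chart hz hx
    exact ⟨_, hy, rfl⟩

/-- The map `B.step` is a lift of the billiard map `B.T`. -/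
lemma T_chart {p : ℝ × ℝ} (hp : p ∈ B.strip) :
    (B.T ⟨B.chart p, B.chart_mem hp⟩ : Circ × ℝ) = B.chart (B.step p) := by
  have hadm := B.posAdmissible_of_mem hp
  set w : B.PhaseHat := ⟨((p.1 : Circ), (p.2 : Circ)), hadm⟩ with hw
  have he : B.φEquiv.symm ⟨B.chart p, B.chart_mem hp⟩ = w := by
    rw [Equiv.symm_apply_eq]; rfl
  unfold T
  rw [he]
  have hn : (B.existsUnique_next w.2).choose = (B.next p : Circ) := by
    refine ((B.existsUnique_next w.2).choose_spec.2 _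
      ⟨B.posAdmissible_of_mem (B.next_mem hp), ?_⟩).symm
    have := B.height_next hp
    rw [det2_sub_right]
    simp only [height, vel, pos] at this
    simp only [hw]
    linarith
  change B.φ ((p.2 : Circ), (B.existsUnique_next w.2).choose) = _
  rw [hn]; rfl

lemma height_self_lt (x : ℝ) : B.height x x < det2 (B.vel x) B.O := by
  have := B.orientation (x : Circ) B.O B.origin_mem
  rw [det2_sub_right] at this
  simp only [height, vel, pos]; linarith

lemma lt_height_opp (x : ℝ) : det2 (B.vel x) B.O < B.height x (B.opp x) := by
  obtain ⟨c, hc, hcv⟩ := B.opposite_smul (B.isOpposite_opp x)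
  have := B.orientation (B.opp x : Circ) B.O B.origin_mem
  rw [hcv, det2_smul_left, det2_sub_right] at this
  have := neg_of_mul_pos_right this hc.le
  simp only [height, vel, pos]; linarith

lemma mem_phase_iff (x s : ℝ) : ((x : Circ), s) ∈ B.Phase ↔
    B.height x x < det2 (B.vel x) B.O - s ∧ det2 (B.vel x) B.O - s < B.height x (B.opp x) := by
  have hl := B.lt_opp x
  constructor
  · intro h
    obtain ⟨y, hy, he⟩ := B.exists_chart h (x := x) rfl
    rw [chart_eq, Prod.mk.injEq] at he
    have e : det2 (B.vel x) B.O - s = B.height x y := by linarith [he.2]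
    rw [mem_strip] at hy
    rw [e]
    exact ⟨B.strictMonoOn_height x ⟨le_rfl, hl.le⟩ ⟨hy.1.le, hy.2.le⟩ hy.1,
      B.strictMonoOn_height x ⟨hy.1.le, hy.2.le⟩ ⟨hl.le, le_rfl⟩ hy.2⟩
  · intro h
    obtain ⟨y, hy, he⟩ := intermediate_value_Ioo hl.le
      (B.continuous_height_right x).continuousOn h
    have hm : (x, y) ∈ B.strip := B.mem_strip.2 hy
    have : B.chart (x, y) = ((x : Circ), s) := by
      rw [chart_eq, Prod.mk.injEq]; exact ⟨rfl, by simp only; linarith⟩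
    rw [← this]
    exact B.chart_mem hm

lemma zero_mem_phase (t : Circ) : (t, (0 : ℝ)) ∈ B.Phase := by
  obtain ⟨x, rfl⟩ := QuotientAddGroup.mk_surjective t
  rw [show ((QuotientAddGroup.mk x : Circ), (0 : ℝ)) = ((x : Circ), 0) from rfl, mem_phase_iff,
    sub_zero]
  exact ⟨B.height_self_lt x, B.lt_height_opp x⟩

lemma isOpen_phase : IsOpen B.Phase := by
  have h1 := B.continuous_vel
  have h2 := B.continuous_height
  have h3 := B.continuous_opp
  have hop : IsOpenMap (Prod.map ((↑) : ℝ → Circ) (id : ℝ → ℝ)) :=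
    QuotientAddGroup.isOpenMap_coe.prodMap IsOpenMap.id
  have hc : Continuous fun p : ℝ × ℝ => det2 (B.vel p.1) B.O - p.2 := by
    unfold det2; fun_prop
  set U : Set (ℝ × ℝ) := {p | B.height p.1 p.1 < det2 (B.vel p.1) B.O - p.2} ∩
    {p | det2 (B.vel p.1) B.O - p.2 < B.height p.1 (B.opp p.1)} with hU
  have hUo : IsOpen U :=
    (isOpen_lt (h2.comp (by fun_prop : Continuous fun p : ℝ × ℝ => (p.1, p.1))) hc).inter
      (isOpen_lt hc (h2.comp (by fun_prop : Continuous fun p : ℝ × ℝ => (p.1, B.opp p.1))))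
  have : B.Phase = Prod.map ((↑) : ℝ → Circ) (id : ℝ → ℝ) '' U := by
    ext ⟨t, s⟩
    obtain ⟨x, rfl⟩ := QuotientAddGroup.mk_surjective t
    constructor
    · intro h
      exact ⟨(x, s), (B.mem_phase_iff x s).1 h, rfl⟩
    · rintro ⟨⟨x', s'⟩, h, he⟩
      rw [← he]
      exact (B.mem_phase_iff x' s').2 h
  rw [this]
  exact hop _ hUo

lemma isPreconnected_phase : IsPreconnected B.Phase := by
  have h3 := B.continuous_opp
  have hs : B.strip = (fun p : ℝ × ℝ => (p.1, p.1 + p.2 * (B.opp p.1 - p.1))) ''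
      ((univ : Set ℝ) ×ˢ Ioo (0 : ℝ) 1) := by
    ext ⟨x, y⟩
    rw [mem_strip]
    have hl := B.lt_opp x
    constructor
    · rintro ⟨h1, h2⟩
      refine ⟨(x, (y - x) / (B.opp x - x)), ⟨trivial, div_pos (by linarith) (by linarith),
        (div_lt_one (by linarith)).2 (by linarith)⟩, ?_⟩
      have : B.opp x - x ≠ 0 := by linarith
      simp only [Prod.mk.injEq, true_and]
      field_simp
      ring
    · rintro ⟨⟨x', s⟩, ⟨-, h1, h2⟩, he⟩
      obtain ⟨rfl, rfl⟩ := Prod.mk.inj he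
      simp only at *
      constructor <;> nlinarith
  rw [← image_chart, hs]
  refine IsPreconnected.image (IsPreconnected.image (isPreconnected_univ.prod isPreconnected_Ioo) _
    (Continuous.continuousOn (by fun_prop))) _ B.continuous_chart.continuousOn

lemma isBounded_phase : Bornology.IsBounded B.Phase := by
  have hc : IsCompact (B.chart '' (Icc 0 (2 * π) ×ˢ Icc 0 (2 * π + 2 * π))) :=
    (isCompact_Icc.prod isCompact_Icc).image B.continuous_chart
  refine hc.isBounded.subset fun z hz => ?_
  obtain ⟨x, hx, hxz⟩ : z.1 ∈ ((↑) : ℝ → Circ) '' Ico 0 (0 + 2 * π) := by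
    rw [AddCircle.coe_image_Ico_eq]; trivial
  obtain ⟨y, hy, rfl⟩ := B.exists_chart hz hxz
  obtain ⟨h1, h2, -⟩ := hy
  simp only at h1 h2
  exact ⟨_, ⟨⟨hx.1, by linarith [hx.2]⟩, by linarith [hx.1], by linarith [hx.2]⟩, rfl⟩

end Table

open unitInterval in
/-- The circle is not contractible: along a homotopy from a constant to the identity, the
displacement of a lift over one period would be constant, but it is `0` at one end and `2π` at the
other. -/
theorem not_nullhomotopic_id : ¬ (ContinuousMap.id Circ).Nullhomotopic := by
  rintro ⟨t, ⟨H⟩⟩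
  obtain ⟨y, rfl⟩ := QuotientAddGroup.mk_surjective t
  let F : C(I × ℝ, Circ) := ⟨fun p => H.symm (p.1, (p.2 : Circ)), by
    refine H.symm.continuous.comp ?_
    exact continuous_fst.prodMk ((AddCircle.continuous_mk' _).comp continuous_snd)⟩
  let cov := AddCircle.isCoveringMap_coe (2 * π)
  have h0 : ∀ a, F (0, a) = ((ContinuousMap.const ℝ y a : ℝ) : Circ) := by
    intro a; simp [F]
  let Λ := cov.liftHomotopy F (ContinuousMap.const ℝ y) h0
  have hΛ : ∀ p, (Λ p : Circ) = F p := fun p =>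
    congrFun (cov.liftHomotopy_lifts F (ContinuousMap.const ℝ y) h0) p
  have hΛ0 : ∀ x, Λ (0, x) = y := fun x => cov.liftHomotopy_zero F (ContinuousMap.const ℝ y) h0 x
  have h1 : ∀ x : ℝ, (Λ (1, x) : Circ) = (x : Circ) := by
    intro x; rw [hΛ]; simp [F]
  -- the displacement over one period is constant along the homotopy
  have hc1 := eq_of_forall_exists_int
    (f := fun s => Λ (projIcc 0 1 zero_le_one s, 2 * π) - Λ (projIcc 0 1 zero_le_one s, 0))
    (by
      have h : Continuous fun s : ℝ => projIcc (0 : ℝ) 1 zero_le_one s := continuous_projIcc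
      exact (Λ.continuous.comp (h.prodMk continuous_const)).sub
        (Λ.continuous.comp (h.prodMk continuous_const)))
    (fun s => by
      have : (Λ (projIcc 0 1 zero_le_one s, 0) : Circ) =
          (Λ (projIcc 0 1 zero_le_one s, 2 * π) : Circ) := by
        rw [hΛ, hΛ]; simp [F, coe_two_pi]
      obtain ⟨j, hj⟩ := coe_eq_coe_iff.1 this
      exact ⟨j, by rw [hj]; ring⟩) 0 1
  have hp0 : projIcc (0 : ℝ) 1 zero_le_one 0 = 0 := projIcc_left _
  have hp1 : projIcc (0 : ℝ) 1 zero_le_one 1 = 1 := projIcc_right _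
  simp only [hp0, hp1, hΛ0, sub_self] at hc1
  have hc2 := eq_of_forall_exists_int (f := fun x => Λ (1, x) - x) (by fun_prop)
    (fun x => by
      obtain ⟨j, hj⟩ := coe_eq_coe_iff.1 (h1 x).symm
      exact ⟨j, by rw [hj]; ring⟩) 0 (2 * π)
  linarith [Real.two_pi_pos]

lemma isEssentialCurve_zero : IsEssentialCurve (range fun t : Circ => (t, (0 : ℝ))) := by
  let c : C(Circ, Circ × ℝ) := ⟨fun t => (t, 0), by fun_prop⟩
  refine ⟨c, ?_, fun h => not_nullhomotopic_id ?_, rfl⟩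
  · exact Topology.IsEmbedding.of_comp (g := (Prod.fst : Circ × ℝ → Circ)) c.continuous
      continuous_fst Topology.IsEmbedding.id
  · have := h.comp_right ⟨Prod.fst, continuous_fst⟩
    exact this

/-- A curve in the cylinder with winding number zero factors through the plane. -/
lemma nullhomotopic_of_lift {c : C(Circ, Circ × ℝ)} {a : ℝ → ℝ} (ha : Continuous a)
    (hac : ∀ s : ℝ, (a s : Circ) = (c (s : Circ)).1) (hper : Function.Periodic a (2 * π)) :
    c.Nullhomotopic := by
  let k : C(Circ, ℝ × ℝ) := ⟨fun t => (hper.lift t, (c t).2), by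
    refine Continuous.prodMk ?_ (by fun_prop)
    exact (QuotientAddGroup.isQuotientMap_mk
      (N := AddSubgroup.zmultiples (2 * π))).continuous_iff.2 ha⟩
  let g : C(ℝ × ℝ, Circ × ℝ) := ⟨fun p => ((p.1 : Circ), p.2), by
    exact ((AddCircle.continuous_mk' _).comp continuous_fst).prodMk continuous_snd⟩
  have hgk : c = g.comp ((ContinuousMap.id _).comp k) := by
    ext t
    · obtain ⟨s, rfl⟩ := QuotientAddGroup.mk_surjective t
      exact (hac s).symm
    · rfl
  rw [hgk]
  exact ((id_nullhomotopic (ℝ × ℝ)).comp_left k).comp_right g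

namespace Table

variable (B : Table)

/-! ### Lifting invariant curves -/

lemma T_mem_iff {Γ : Set (Circ × ℝ)} (hsub : Γ ⊆ B.Phase)
    (hinv : B.T '' (Subtype.val ⁻¹' Γ) = (Subtype.val ⁻¹' Γ : Set B.Phase)) {p : ℝ × ℝ}
    (hp : p ∈ B.strip) : B.chart (B.step p) ∈ Γ ↔ B.chart p ∈ Γ := by
  rw [← B.T_chart hp]
  constructor
  · intro h
    have h' : B.T ⟨B.chart p, B.chart_mem hp⟩ ∈ (Subtype.val ⁻¹' Γ : Set B.Phase) := h
    rw [← hinv] at h'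
    obtain ⟨⟨z, hz⟩, hzΓ, hzT⟩ := h'
    obtain ⟨q, hq, rfl⟩ : z ∈ B.chart '' B.strip := B.image_chart ▸ hsub hzΓ
    have e := congrArg Subtype.val hzT
    rw [B.T_chart hp, B.T_chart hq] at e
    obtain ⟨j, hj⟩ := B.exists_shift_of_chart_eq (B.step_mem hq) (B.step_mem hp) e
    have hq' := (B.shift_mem_strip j q).2 hq
    rw [← B.step_shift j hq] at hj
    have := congrArg B.stepInv hj
    rw [B.stepInv_step hp, B.stepInv_step hq'] at this
    rw [this, B.chart_shift]
    exact hzΓ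
  · intro h
    have : B.T ⟨B.chart p, B.chart_mem hp⟩ ∈ (Subtype.val ⁻¹' Γ : Set B.Phase) := by
      rw [← hinv]
      exact mem_image_of_mem _ h
    exact this

lemma exists_forall_eq_shift {f g : ℝ → ℝ × ℝ} (hf : Continuous f) (hg : Continuous g)
    (h : ∀ x, ∃ j : ℤ, f x = shift j (g x)) : ∃ j : ℤ, ∀ x, f x = shift j (g x) := by
  choose k hk using h
  have hk1 : ∀ x, (f x).1 - (g x).1 = k x * (2 * π) := fun x => by
    rw [hk x]; simp [shift]
  refine ⟨k 0, fun x => ?_⟩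
  have := eq_of_forall_exists_int (f := fun x => (f x).1 - (g x).1) (by fun_prop)
    (fun x => ⟨k x, hk1 x⟩) x 0
  simp only [hk1] at this
  have hkx : k x = k 0 := by exact_mod_cast mul_right_cancel₀ Real.two_pi_pos.ne' this
  rw [← hkx]; exact hk x

lemma exists_lift_of_curve {c₀ : C(Circ, Circ × ℝ)} (hsub : range c₀ ⊆ B.Phase) :
    ∃ f : ℝ → ℝ × ℝ, Continuous f ∧ ∀ s, f s ∈ B.strip ∧ B.chart (f s) = c₀ (s : Circ) := by
  have hcoe : Continuous ((↑) : ℝ → Circ) := AddCircle.continuous_mk' _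
  obtain ⟨a, hac, ha⟩ := exists_lift_of_continuous
    (f := fun s : ℝ => (c₀ (s : Circ)).1) (by fun_prop)
  choose Y hY hYc using fun s : ℝ => B.exists_chart (hsub (mem_range_self (s : Circ))) (ha s)
  refine ⟨fun s => (a s, Y s), hac.prodMk ?_, fun s => ⟨hY s, hYc s⟩⟩
  have hh : ∀ s, B.height (a s) (Y s) = det2 (B.vel (a s)) B.O - (c₀ (s : Circ)).2 := fun s => by
    have := congrArg Prod.snd (hYc s)
    rw [chart_eq] at this
    simp only at this; linarith
  have hv := B.continuous_vel
  have hcont : Continuous fun s => det2 (B.vel (a s)) B.O - (c₀ (s : Circ)).2 := by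
    unfold det2; fun_prop
  refine continuous_iff_continuousAt.2 fun s => ?_
  refine B.tendsto_of_height hac.continuousAt (Filter.Eventually.of_forall hY) (hY s) ?_
  simp only [hh]
  exact hcont.continuousAt

end Table

theorem exists_liftedCurve (B : Table) {Γ : Set (Circ × ℝ)} (h : B.IsInvariantEssentialCurve Γ) :
    Nonempty (LiftedCurve B) := by
  obtain ⟨⟨c₀, hemb, hess, rfl⟩, hsub, hinv⟩ := h
  have hcoe : Continuous ((↑) : ℝ → Circ) := AddCircle.continuous_mk' _
  obtain ⟨f, hf, hfc⟩ := B.exists_lift_of_curve hsub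
  obtain ⟨d, hd⟩ : ∃ d : ℤ, ∀ s, f (s + 2 * π) = Table.shift d (f s) := by
    refine Table.exists_forall_eq_shift (by fun_prop) hf fun s => ?_
    refine B.exists_shift_of_chart_eq (hfc s).1 (hfc _).1 ?_
    rw [(hfc s).2, (hfc _).2, coe_add_two_pi]
  have hd0 : d ≠ 0 := by
    rintro rfl
    refine hess (nullhomotopic_of_lift (a := fun s => (f s).1) (by fun_prop) (fun s => ?_)
      fun s => ?_)
    · rw [← (hfc s).2]; rfl
    · simp only [hd, Table.shift_zero]
  have hd0' : (d : ℝ) ≠ 0 := by exact_mod_cast hd0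
  have hdneg : ∀ s, f (s - 2 * π) = Table.shift (-d) (f s) := fun s => by
    have := hd (s - 2 * π)
    rw [sub_add_cancel] at this
    rw [this, Table.shift_shift, neg_add_cancel, Table.shift_zero]
  have hstep : Continuous fun x : ℝ => B.step (f (x / d)) :=
    B.continuousOn_step.comp_continuous (by fun_prop) fun x => (hfc _).1
  have hu : ∀ x : ℝ, ∃ u, c₀ u = B.chart (B.step (f (x / d))) := fun x =>
    (B.T_mem_iff hsub hinv (hfc _).1).2 ((hfc (x / d)).2 ▸ mem_range_self _)
  choose u hu using hu
  have huc : Continuous u := by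
    rw [hemb.continuous_iff]
    exact (B.continuous_chart.comp hstep).congr fun x => (hu x).symm
  obtain ⟨v, hv, hvu⟩ := exists_lift_of_continuous huc
  obtain ⟨k, hk⟩ : ∃ k : ℤ, ∀ x, B.step (f (x / d)) = Table.shift k (f (d * v x / d)) := by
    refine Table.exists_forall_eq_shift hstep (by fun_prop) fun x => ?_
    refine B.exists_shift_of_chart_eq (hfc _).1 (B.step_mem (hfc _).1) ?_
    rw [mul_div_cancel_left₀ _ hd0', (hfc _).2, hvu, hu]
  exact ⟨{
    carrier := B.strip ∩ B.chart ⁻¹' range c₀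
    sub_strip := inter_subset_left
    isOpen_compl := by
      rw [sdiff_self_inter]
      exact B.isOpen_strip.sdiff
        ((isCompact_range c₀.continuous).isClosed.preimage B.continuous_chart)
    add_mem := fun x y => by
      have := B.chart_shift 1 (x, y)
      have h2 := B.shift_mem_strip 1 (x, y)
      simp only [Table.shift, Int.cast_one, one_mul] at this h2
      simp only [mem_inter_iff, mem_preimage, this, h2]
    step_mem := fun p hp => by
      simp only [mem_inter_iff, mem_preimage, hp, B.step_mem hp, true_and]
      exact B.T_mem_iff hsub hinv hp
    c := fun x => f (x / d)
    continuous_c := by fun_prop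
    n := d.natAbs
    n_pos := Int.natAbs_pos.2 hd0
    c_add := fun x => by
      -- the rescaled parameter moves forward, so a curve winding backwards is run through backwards
      rcases Int.natAbs_eq d with hp | hp
      · have : (d.natAbs : ℝ) = d := by rw [hp]; simp
        rw [this, add_div, mul_div_cancel_left₀ _ hd0', hd, ← hp]
      · have : (d.natAbs : ℝ) = -d := by rw [← Int.cast_natCast, ← Int.cast_neg]; congr 1; omega
        rw [this, add_div, neg_mul, neg_div, mul_div_cancel_left₀ _ hd0', ← sub_eq_add_neg, hdneg]
        congr 1; omega
    c_mem := fun x => ⟨(hfc _).1, _, (hfc (x / d)).2.symm⟩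
    exists_eq := by
      rintro p ⟨hp, t, ht⟩
      obtain ⟨s, rfl⟩ := QuotientAddGroup.mk_surjective t
      obtain ⟨j, hj⟩ := B.exists_shift_of_chart_eq (hfc s).1 hp ((hfc s).2.trans ht)
      exact ⟨d * s, j, by simpa only [mul_div_cancel_left₀ _ hd0'] using hj⟩
    h := fun x => d * v x
    continuous_h := by fun_prop
    k := k
    step_c := hk }⟩

lemma Table.not_isInvariantEssentialCurve (B : Table) (hB : ∃ t, curvature B.γ t = 0)
    (Γ : Set (Circ × ℝ)) : ¬ B.IsInvariantEssentialCurve Γ := by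
  intro h
  obtain ⟨t, ht⟩ := hB
  obtain ⟨t₀, rfl⟩ := QuotientAddGroup.mk_surjective t
  obtain ⟨C⟩ := exists_liftedCurve B h
  have hn : ‖velocity B.γ (t₀ : Circ)‖ ^ 3 ≠ 0 :=
    pow_ne_zero _ (norm_ne_zero_iff.2 (B.regular _))
  have h0 := (div_eq_zero_iff.1 ht).resolve_right hn
  refine C.false_of_parallel (t₀ := t₀) ?_
  rw [← show _ = deriv B.vel t₀ from velocity_coe (velocity B.γ) t₀]
  exact h0

end SymplecticBilliard

end

theorem proposition5p8 (B : SymplecticBilliard.Table)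
    (hB : ∃ t, SymplecticBilliard.curvature B.γ t = 0) :
    B.IsInstabilityRegion B.Phase ∧
      ¬ ∃ Γ : Set (SymplecticBilliard.Circ × ℝ), B.IsInvariantEssentialCurve Γ := by
  have hno := B.not_isInvariantEssentialCurve hB
  have hV : B.V = ∅ := by
    rw [SymplecticBilliard.Table.V, sUnion_eq_empty]
    exact fun Γ hΓ => (hno Γ hΓ).elim
  refine ⟨⟨B.isOpen_phase, B.isBounded_phase, ⟨(0, 0), ?_, ?_⟩, _,
    SymplecticBilliard.isEssentialCurve_zero, ?_⟩, fun ⟨Γ, hΓ⟩ => hno Γ hΓ⟩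
  · rw [hV, sdiff_empty]; exact B.zero_mem_phase 0
  · rw [hV, sdiff_empty, B.isPreconnected_phase.connectedComponentIn (B.zero_mem_phase 0)]
  · rw [B.isOpen_phase.interior_eq]
    rintro _ ⟨t, rfl⟩
    exact B.zero_mem_phase t
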